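/- Let $G$ be a compact (Hausdorff) abelian group with normalized Haar measure $\mu$ and dual group $\hat G$, and let $\ell\mapsto A^\ell$ be a $\mathbb{Z}^d$-action on $G$ by continuous automorphisms which is mixing of all orders: for every $r\ge 2$ and all Borel sets $B_1,\dots,B_r\subset G$, $\mu\bigl(\bigcap_{i} A^{-n_i}B_i\bigr)\to\prod_i\mu(B_i)$ as $\min_{i\ne j}\|n_i-n_j\|\to\infty$. Let $(R_n)_{n\ge1}$ be a summation sequence, i.e. a sequence of functions $R_n:\mathbb{Z}^d\to[0,\infty)$ with $0<\sum_{\ell}R_n(\ell)<\infty$ for every $n$. Suppose that it is $\zeta$-regular for a probability measure $\zeta$ on $\mathbb{T}^d=(\mathbb{R}/\mathbb{Z})^d$, i.e. the kernels $\tilde R_n(t)=\bigl|\sum_\ell R_n(\ell)e^{2\pi i\langle \ell,t\rangle}\bigr|^2\big/\sum_\ell R_n(\ell)^2$ satisfy $\int_{\mathbb{T}^d}\tilde R_n\,\varphi\,dt\to\int_{\mathbb{T}^d}\varphi\,d\zeta$ for every continuous $\varphi$ on $\mathbb{T}^d$. Suppose moreover that for every integer $r\ge 3$, as $n\to\infty$,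 $$\Bigl(\sup_\ell R_n(\ell)\Bigr)^{r-1}\sum_\ell R_n(\ell)=o\Bigl(\bigl(\sum_\ell R_n(\ell)^2\bigr)^{r/2}\Bigr).$$ Let $f$ belong to $AC_0(G)$, i.e. $f$ is a real integrable function on $G$ with $\int_G f\,d\mu=0$ and absolutely convergent Fourier series, $\sum_{\chi\in\hat G}|c_f(\chi)|<\infty$, where $c_f(\chi)=\int_G\bar\chi f\,d\mu$. Then $f$ has a continuous spectral density $\varphi_f$, i.e. a continuous nonnegative function on $\mathbb{T}^d$ with $\int_{\mathbb{T}^d}e^{-2\pi i\langle \ell,t\rangle}\varphi_f(t)\,dt=\int_G (f\circ A^\ell)\,f\,d\mu$ for all $\ell\in\mathbb{Z}^d$, and, with respect to $\mu$, $$\Bigl(\sum_{\ell}R_n(\ell)^2\Bigr)^{-1/2}\sum_{\ell\in\mathbb{Z}^d}R_n(\ell)\,f\circ A^\ell\ \longrightarrow\ \mathcal N\bigl(0,\zeta(\varphi_f)\bigr)\quad\text{in distribution as } n\to\infty,$$ where $\zeta(\varphi_f)=\int_{\mathbb{T}^d}\varphi_f\,d\zeta$ and $\mathcal N(0,0)$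 means $\delta_0$. -/

import Mathlib

open MeasureTheory ProbabilityTheory Filter Topology Asymptotics

noncomputable section

/-- A summation sequence on `ℤ^d`: a sequence of nonnegative functions on `ℤ^d` with
`0 < ∑_ℓ R_n(ℓ) < ∞` for every `n`. -/
structure IsSummationSequence {d : ℕ} (R : ℕ → (Fin d → ℤ) → ℝ) : Prop where
  nonneg : ∀ n l, 0 ≤ R n l
  summable : ∀ n, Summable (R n)
  tsum_pos : ∀ n, 0 < ∑' l, R n l

/-- The normalized Haar (Lebesgue) measure `dt` of the torus `𝕋^d = (ℝ/ℤ)^d`. -/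
def torusHaar (d : ℕ) : Measure (UnitAddTorus (Fin d)) :=
  Measure.pi fun _ => AddCircle.haarAddCircle

/-- The normalized nonnegative kernel
`|∑_ℓ R(ℓ) e^{2πi⟨ℓ,t⟩}|² / ∑_ℓ R(ℓ)²` of a summable weight `R`. -/
def normalizedKernel {d : ℕ} (R : (Fin d → ℤ) → ℝ) (t : UnitAddTorus (Fin d)) : ℝ :=
  ‖∑' l, (R l : ℂ) * UnitAddTorus.mFourier l t‖ ^ 2 / ∑' l, R l ^ 2

/-- `ζ`-regularity: the measures `R̃_n dt` converge weakly to `ζ` on the torus. -/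
def IsRegularSummation {d : ℕ} (R : ℕ → (Fin d → ℤ) → ℝ)
    (ζ : Measure (UnitAddTorus (Fin d))) : Prop :=
  ∀ φ : C(UnitAddTorus (Fin d), ℝ),
    Tendsto (fun n => ∫ t, normalizedKernel (R n) t * φ t ∂torusHaar d) atTop
      (𝓝 (∫ t, φ t ∂ζ))

/-- Mixing of all orders of a `ℤ^d`-indexed family of transformations: for every `r ≥ 2` and all
measurable `B_1, …, B_r`, one has `μ(⋂ T^{-n_i} B_i) → ∏ μ(B_i)` as
`min_{i ≠ j} ‖n_i - n_j‖ → ∞`. -/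
def IsMixingOfAllOrders {d : ℕ} {X : Type*} [MeasurableSpace X] (μ : Measure X)
    (T : (Fin d → ℤ) → X → X) : Prop :=
  ∀ r : ℕ, 2 ≤ r → ∀ B : Fin r → Set X, (∀ i, MeasurableSet (B i)) →
    ∀ ε : ℝ, 0 < ε → ∃ M : ℝ, ∀ n : Fin r → (Fin d → ℤ),
      (∀ i j, i ≠ j → M ≤ ‖n i - n j‖) →
        |μ.real (⋂ i, T (n i) ⁻¹' B i) - ∏ i, μ.real (B i)| < ε

/-- `φ` is a density, with respect to the normalized Haar measure of the torus, of the spectral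
measure of the real function `f` under the action `T`, i.e. of the positive measure on `𝕋^d` whose
Fourier coefficients are `⟨f ∘ T^ℓ, f⟩`. -/
structure IsSpectralDensity {d : ℕ} {X : Type*} [MeasurableSpace X] (μ : Measure X)
    (T : (Fin d → ℤ) → X → X) (f : X → ℝ) (φ : UnitAddTorus (Fin d) → ℝ) : Prop where
  integrable : Integrable φ (torusHaar d)
  nonneg : 0 ≤ᵐ[torusHaar d] φ
  fourier : ∀ l : Fin d → ℤ,
    ∫ t, (starRingEnd ℂ) (UnitAddTorus.mFourier l t) * (φ t : ℂ) ∂torusHaar d =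
      ((∫ x, f (T l x) * f x ∂μ : ℝ) : ℂ)

section Group

variable {G : Type*} [CommGroup G] [TopologicalSpace G] [MeasurableSpace G]

/-- The Fourier coefficient `c_f(χ) = ∫ χ̄ f dμ`. -/
def charFourierCoeff (μ : Measure G) (f : G → ℝ) (χ : PontryaginDual G) : ℂ :=
  ∫ x, (starRingEnd ℂ) (χ x : ℂ) * (f x : ℂ) ∂μ

/-- The class `AC_0(G)`: integrable real functions with zero mean and absolutely convergent
Fourier series. -/
structure MemAC0 (μ : Measure G) (f : G → ℝ) : Prop where
  integrable : Integrable f μ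
  integral_eq_zero : ∫ x, f x ∂μ = 0
  summable : Summable fun χ : PontryaginDual G => ‖charFourierCoeff μ f χ‖

end Group

end

/-! ### Gelfand theory for commuting families in a Banach algebra -/

section BanachCharacter

/-! A function in `AC_0` agrees almost everywhere with the uniform sum of its Fourier series, so `f`
may be taken continuous. Two consequences of mixing carry the proof.

First, the dual action is free on nontrivial characters. The orbit of each such character is
therefore orthonormal, so the `L²` norm of `∑ w_l f ∘ A^l` is at most the `ℓ²` norm of `w` times `∑
|c_f|` (`norm_toL2_weightedSum_le`). Hence `f` can be replaced by a real trigonometric polynomial at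
a cost uniform in `n`. Freeness also makes the correlations summable; their Fourier series is the
continuous spectral density, and `ζ`-regularity says exactly that the normalized variances tend to
`ζ(φ_f)`.

Second, for a trigonometric polynomial the joint moments factorize exactly, not just asymptotically,
over well separated clusters of indices, because the integral of a character is 0 or 1. Consequently
a joint cumulant vanishes once some index is farther than a fixed radius from the first
(`exists_radius_jointCumulant_eq_zero`). The cumulant of order `r + 1` of `∑ w_l f ∘ A^l` is thus
`O((sup w)^r ∑ w)`, which tends to 0 for `r ≥ 2` by the smallness assumption on `R_n`. With bounded
variances, the moments approach Gaussian ones, and so do the characteristic functions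
(`tendsto_integral_exp_sub_of_cumulants`). Lévy's theorem concludes.

The Fourier analysis needed on `G` rests on the fact that characters separate points. This comes
from Gelfand theory: a multiplicative functional on the algebra of convolution operators, evaluated
on translates of one function, produces a character. -/

theorem spectralRadius_ne_zero_of_pow_le {E : Type*} [NormedRing E] [NormedAlgebra ℂ E]
    [CompleteSpace E] {q : E} {c K : ℝ} (hc : 0 < c)
    (h : ∀ n : ℕ, c ^ 2 ^ n ≤ K * ‖q ^ 2 ^ n‖) : spectralRadius ℂ q ≠ 0 := by
  intro h0
  have hK : 0 < K := by
    by_contra hK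
    have := h 0
    have h1 : K * ‖q ^ 2 ^ 0‖ ≤ 0 := mul_nonpos_of_nonpos_of_nonneg (not_lt.1 hK) (norm_nonneg _)
    have h2 : 0 < c ^ 2 ^ 0 := by positivity
    linarith
  have ht := spectrum.pow_norm_pow_one_div_tendsto_nhds_spectralRadius q
  rw [h0] at ht
  have ht' : Tendsto (fun n : ℕ => ‖q ^ n‖ ^ (1 / n : ℝ)) atTop (𝓝 0) := by
    have := (ENNReal.tendsto_toReal ENNReal.zero_ne_top).comp ht
    refine this.congr fun n => ?_
    simp only [Function.comp]
    exact ENNReal.toReal_ofReal (by positivity)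
  have hexp : Tendsto (fun n : ℕ => 2 ^ n) atTop atTop :=
    tendsto_pow_atTop_atTop_of_one_lt (by norm_num)
  have ht2 := ht'.comp hexp
  have hK1 : Tendsto (fun n : ℕ => K ^ (1 / ((2 ^ n : ℕ) : ℝ))) atTop (𝓝 1) := by
    have h3 : Tendsto (fun n : ℕ => 1 / ((2 ^ n : ℕ) : ℝ)) atTop (𝓝 0) :=
      tendsto_const_div_atTop_nhds_zero_nat (1 : ℝ) |>.comp hexp
    have := (Real.continuousAt_const_rpow hK.ne' (b := 0)).tendsto.comp h3
    simpa [Function.comp_def] using this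
  -- Taking `2 ^ n`-th roots in the hypothesis, the constant `K` disappears and Gelfand's formula
  -- sends the right side to 0.
  have hlim := hK1.mul ht2
  simp only [mul_zero] at hlim
  have hle : c ≤ 0 := by
    refine ge_of_tendsto' hlim fun n => ?_
    simp only [Function.comp]
    rw [← Real.mul_rpow hK.le (norm_nonneg _)]
    have hn : ((2 ^ n : ℕ) : ℝ) ≠ 0 := by positivity
    calc c = (c ^ (2 ^ n : ℕ)) ^ (1 / ((2 ^ n : ℕ) : ℝ)) := by
          rw [← Real.rpow_natCast, ← Real.rpow_mul hc.le, mul_one_div_cancel hn, Real.rpow_one]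
      _ ≤ _ := Real.rpow_le_rpow (by positivity) (h n) (by positivity)
  linarith

/-- A product in a commuting family of a Banach algebra that is not quasinilpotent is not killed by
some continuous multiplicative functional. -/
theorem exists_continuousOn_multiplicative_ne_zero {E : Type*} [NormedRing E] [NormedAlgebra ℂ E]
    [CompleteSpace E] (S : Set E) (hS : ∀ a ∈ S, ∀ b ∈ S, a * b = b * a) {s t : E}
    (hs : s ∈ S) (ht : t ∈ S) {c K : ℝ} (hc : 0 < c)
    (h : ∀ n : ℕ, c ^ 2 ^ n ≤ K * ‖(s * t) ^ 2 ^ n‖) :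
    ∃ ψ : E → ℂ, (∀ a ∈ S, ∀ b ∈ S, ψ (a * b) = ψ a * ψ b) ∧
      (∀ a ∈ S, ∀ b ∈ S, ψ (a - b) = ψ a - ψ b) ∧ ContinuousOn ψ S ∧ ψ s ≠ 0 := by
  classical
  -- The closed algebra generated by `S` is a commutative Banach algebra. There a nonzero spectral
  -- radius of `s * t` yields a nonzero spectral value, which is the value of a character at `s *
  -- t`.
  let B := (Algebra.adjoin ℂ S).topologicalClosure
  have hcomm : ∀ x y : Algebra.adjoin ℂ S, x * y = y * x :=
    fun x y => (Algebra.isMulCommutative_adjoin ℂ hS).is_comm.comm x y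
  let _ : CommRing B := Subalgebra.commRingTopologicalClosure _ hcomm
  let _ : NormedCommRing B :=
    { (inferInstance : NormedRing B) with
      mul_comm := fun x y => mul_comm x y }
  have : CompleteSpace B :=
    (Subalgebra.isClosed_topologicalClosure (Algebra.adjoin ℂ S)).completeSpace_coe
  have hSB : S ⊆ B := Algebra.subset_adjoin.trans (Subalgebra.le_topologicalClosure _)
  let q : B := ⟨s, hSB hs⟩ * ⟨t, hSB ht⟩
  have hr : spectralRadius ℂ q ≠ 0 :=
    spectralRadius_ne_zero_of_pow_le hc (K := K) fun n => h n
  have hex : ∃ z ∈ spectrum ℂ q, z ≠ 0 := by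
    by_contra hcon
    push Not at hcon
    apply hr
    rw [spectralRadius]
    simp only [ENNReal.iSup_eq_zero]
    intro z hz
    simp [hcon z hz]
  obtain ⟨z, hz, hz0⟩ := hex
  obtain ⟨φ, hφ⟩ := WeakDual.CharacterSpace.mem_spectrum_iff_exists.1 hz
  -- The value 0 off `B` is only a default: all the claims concern elements of `S`.
  let ψ : E → ℂ := fun x => if hx : x ∈ B then φ ⟨x, hx⟩ else 0
  have hψ : ∀ x : B, ψ x = φ x := fun x => dif_pos x.2
  refine ⟨ψ, fun a ha b hb => ?_, fun a ha b hb => ?_, ?_, fun h0 => hz0 ?_⟩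
  · exact ((hψ (⟨a, hSB ha⟩ * ⟨b, hSB hb⟩)).trans (map_mul φ _ _)).trans
      (congrArg₂ _ (hψ _).symm (hψ _).symm)
  · exact ((hψ (⟨a, hSB ha⟩ - ⟨b, hSB hb⟩)).trans (map_sub φ _ _)).trans
      (congrArg₂ _ (hψ _).symm (hψ _).symm)
  · refine ContinuousOn.mono (s := (B : Set E)) ?_ hSB
    rw [continuousOn_iff_continuous_domRestrict]
    exact (map_continuous φ).congr fun x => (hψ x).symm
  · rw [← hφ, map_mul, ← hψ]
    exact mul_eq_zero_of_left h0 _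

end BanachCharacter

/-! ### Convolution operators on continuous functions -/

theorem integrable_continuousMap {X E : Type*} [TopologicalSpace X] [CompactSpace X]
    [MeasurableSpace X] [OpensMeasurableSpace X] [NormedAddCommGroup E] (μ : Measure X)
    [IsFiniteMeasure μ] (h : C(X, E)) : Integrable h μ :=
  h.continuous.integrable_of_hasCompactSupport (HasCompactSupport.of_compactSpace _)

/-- Integration against a continuous function as a functional on `C(G, ℂ)`. -/
noncomputable def integralMulCLM {X : Type*} [TopologicalSpace X] [CompactSpace X]
    [MeasurableSpace X] [OpensMeasurableSpace X] (μ : Measure X) [IsProbabilityMeasure μ]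
    (k : C(X, ℂ)) : C(X, ℂ) →L[ℂ] ℂ :=
  LinearMap.mkContinuous
    { toFun := fun h => ∫ x, h x * k x ∂μ
      map_add' := fun h h' => by
        refine Eq.trans ?_ (integral_add (integrable_continuousMap μ (h * k))
          (integrable_continuousMap μ (h' * k)))
        simp [add_mul]
      map_smul' := fun c h => by
        rw [RingHom.id_apply, ← integral_smul]
        simp [mul_assoc] } ‖k‖ (fun h => by
    have := norm_integral_le_of_norm_le_const (μ := μ) (f := fun g => h g * k g)
      (C := ‖k‖ * ‖h‖) (.of_forall fun g => by
        rw [norm_mul, mul_comm]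
        exact mul_le_mul (k.norm_coe_le_norm _) (h.norm_coe_le_norm _) (norm_nonneg _)
          (norm_nonneg _))
    simpa using this)

theorem integralMulCLM_apply {X : Type*} [TopologicalSpace X] [CompactSpace X]
    [MeasurableSpace X] [OpensMeasurableSpace X] (μ : Measure X) [IsProbabilityMeasure μ]
    (k h : C(X, ℂ)) : integralMulCLM μ k h = ∫ x, h x * k x ∂μ := rfl

section Convolution

variable {G : Type*} [CommGroup G] [TopologicalSpace G] [IsTopologicalGroup G] [CompactSpace G]

/-- Translation of a continuous function by a group element. -/
noncomputable def leftTranslate (a : G) (h : C(G, ℂ)) : C(G, ℂ) :=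
  ⟨fun x => h (a⁻¹ * x), by fun_prop⟩

@[simp] theorem leftTranslate_apply (a : G) (h : C(G, ℂ)) (x : G) :
    leftTranslate a h x = h (a⁻¹ * x) := rfl

theorem continuous_leftTranslate (h : C(G, ℂ)) : Continuous fun a : G => leftTranslate a h :=
  (ContinuousMap.curry ⟨fun p : G × G => h (p.1⁻¹ * p.2), by fun_prop⟩).continuous

theorem norm_leftTranslate_le (a : G) (h : C(G, ℂ)) : ‖leftTranslate a h‖ ≤ ‖h‖ :=
  (ContinuousMap.norm_le _ (norm_nonneg _)).2 fun x => h.norm_coe_le_norm _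

variable [MeasurableSpace G] [BorelSpace G] (μ : Measure G) [IsProbabilityMeasure μ]

theorem integrable_smul_leftTranslate (k h : C(G, ℂ)) :
    Integrable (fun g => k g • leftTranslate g h) μ :=
  (k.continuous.smul (continuous_leftTranslate h)).integrable_of_hasCompactSupport
    (HasCompactSupport.of_compactSpace _)

/-- Convolution by a continuous function, as an operator on continuous functions. -/
noncomputable def convOp (k : C(G, ℂ)) : C(G, ℂ) →L[ℂ] C(G, ℂ) :=
  LinearMap.mkContinuous
    { toFun := fun h => ∫ g, k g • leftTranslate g h ∂μ
      map_add' := fun h h' => by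
        rw [← integral_add (integrable_smul_leftTranslate μ k h) (integrable_smul_leftTranslate μ k h')]
        congr 1; ext g x; simp [mul_add]
      map_smul' := fun c h => by
        rw [RingHom.id_apply, ← integral_smul]
        congr 1; ext g x; simp [mul_left_comm] } ‖k‖ (fun h => by
    have := norm_integral_le_of_norm_le_const (μ := μ) (f := fun g => k g • leftTranslate g h)
      (C := ‖k‖ * ‖h‖) (.of_forall fun g => by
        rw [norm_smul]
        exact mul_le_mul (k.norm_coe_le_norm _) (norm_leftTranslate_le _ _) (norm_nonneg _)
          (norm_nonneg _))
    simpa using this)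

theorem convOp_apply (k h : C(G, ℂ)) : convOp μ k h = ∫ g, k g • leftTranslate g h ∂μ := rfl

theorem norm_convOp_le (k : C(G, ℂ)) : ‖convOp μ k‖ ≤ ‖k‖ :=
  LinearMap.mkContinuous_norm_le _ (norm_nonneg _) _

theorem map_convOp {E : Type*} [NormedAddCommGroup E] [NormedSpace ℂ E] [CompleteSpace E]
    (Λ : C(G, ℂ) →L[ℂ] E) (k h : C(G, ℂ)) :
    Λ (convOp μ k h) = ∫ g, k g • Λ (leftTranslate g h) ∂μ := by
  rw [convOp_apply, ← ContinuousLinearMap.integral_comp_comm _ (integrable_smul_leftTranslate μ k h)]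
  simp

theorem convOp_apply_apply (k h : C(G, ℂ)) (x : G) :
    convOp μ k h x = ∫ g, k g * h (g⁻¹ * x) ∂μ := by
  simpa using map_convOp μ (ContinuousMap.evalCLM ℂ x) k h

theorem convOp_translate (k h : C(G, ℂ)) (a : G) :
    convOp μ k (leftTranslate a h) = leftTranslate a (convOp μ k h) := by
  ext x
  simp only [convOp_apply_apply, leftTranslate_apply, mul_left_comm]

theorem translate_convOp [μ.IsMulLeftInvariant] (k h : C(G, ℂ)) (a : G) :
    leftTranslate a (convOp μ k h) = convOp μ (leftTranslate a k) h := by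
  ext x
  simp only [convOp_apply_apply, leftTranslate_apply]
  conv_rhs => rw [← integral_mul_left_eq_self _ a]
  simp [mul_assoc]

/-- `convOp μ k'` is a weighted average of translations, and `convOp μ k` commutes with translations
and passes under the vector-valued integral. Neither Fubini nor invariance of `μ` is needed. -/
theorem convOp_comm (k k' : C(G, ℂ)) : convOp μ k * convOp μ k' = convOp μ k' * convOp μ k := by
  ext1 h
  simp only [mul_apply_eq_comp]
  rw [map_convOp, convOp_apply μ k' ((convOp μ k) h)]
  simp only [convOp_translate]

theorem convOp_sub (k k' : C(G, ℂ)) : convOp μ (k - k') = convOp μ k - convOp μ k' := by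
  ext1 h
  simp only [sub_apply, convOp_apply]
  rw [← integral_sub (integrable_smul_leftTranslate μ k h) (integrable_smul_leftTranslate μ k' h)]
  congr 1; ext g x; simp [sub_mul]

theorem continuous_convOp : Continuous (convOp (G := G) μ) := by
  refine LipschitzWith.continuous (K := 1) (LipschitzWith.of_dist_le_mul fun k k' => ?_)
  rw [dist_eq_norm, ← convOp_sub, NNReal.coe_one, one_mul, dist_eq_norm]
  exact norm_convOp_le μ _

/-- Translations may be moved from one factor to the other; this makes `a ↦ T (leftTranslate a p) /
T p` a homomorphism for multiplicative `T`. -/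
theorem convOp_translate_mul [μ.IsMulLeftInvariant] (k k' : C(G, ℂ)) (a b : G) :
    convOp μ (leftTranslate a k) * convOp μ (leftTranslate b k') =
      convOp μ (leftTranslate (a * b) k) * convOp μ k' := by
  ext h x
  simp only [mul_apply_eq_comp, ← translate_convOp, convOp_translate, leftTranslate_apply,
    mul_inv_rev, mul_assoc]
  rw [mul_left_comm]

/-- The `L²` inner product of continuous functions, conjugate linear in the second variable. -/
noncomputable def pairing (h h' : C(G, ℂ)) : ℂ := ∫ x, h x * (starRingEnd ℂ) (h' x) ∂μ

/-- The involution `k ↦ conj k(g⁻¹)`. -/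
noncomputable def involute (k : C(G, ℂ)) : C(G, ℂ) :=
  ⟨fun x => (starRingEnd ℂ) (k x⁻¹), by fun_prop⟩

/-- Each side becomes a single integral over `g` by `map_convOp`; the substitution `g ↦ g⁻¹`, then a
translation in `x`, matches them. -/
theorem pairing_convOp_left [μ.IsMulLeftInvariant] [μ.IsInvInvariant] (k h h' : C(G, ℂ)) :
    pairing μ (convOp μ k h) h' = pairing μ h (convOp μ (involute k) h') := by
  have h1 := map_convOp μ (integralMulCLM μ (star h')) k h
  have h2 := map_convOp μ (integralMulCLM μ (star h)) (involute k) h'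
  have h3 : pairing μ h (convOp μ (involute k) h') =
      (starRingEnd ℂ) (integralMulCLM μ (star h) (convOp μ (involute k) h')) := by
    rw [pairing, integralMulCLM_apply, ← integral_conj]
    simp [mul_comm]
  have h4 : pairing μ (convOp μ k h) h' = integralMulCLM μ (star h') (convOp μ k h) := by
    simp [pairing, integralMulCLM_apply]
  rw [h3, h4, h1, h2, ← integral_conj, ← integral_inv_eq_self _ μ]
  congr 1; ext g
  simp only [integralMulCLM_apply, smul_eq_mul, map_mul, ← integral_conj, involute,
    leftTranslate_apply, ContinuousMap.coe_mk, ContinuousMap.star_apply, inv_inv, Complex.conj_conj,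
    RCLike.star_def]
  congr 1
  rw [← integral_mul_left_eq_self _ g⁻¹]
  congr 1; ext x
  simp [mul_comm]

end Convolution

/-! ### Characters separate points -/

section SeparatesPoints

variable {G : Type*} [CommGroup G] [TopologicalSpace G] [IsTopologicalGroup G] [CompactSpace G]
  [MeasurableSpace G] [BorelSpace G] (μ : Measure G) [IsProbabilityMeasure μ]

/-- The class in `L²` of a continuous function. -/
noncomputable abbrev toL2 {X : Type*} [TopologicalSpace X] [CompactSpace X] [MeasurableSpace X]
    [BorelSpace X] (μ : Measure X) [IsFiniteMeasure μ] : C(X, ℂ) →L[ℂ] Lp ℂ 2 μ :=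
  ContinuousMap.toLp 2 μ ℂ

theorem norm_toL2_le {X : Type*} [TopologicalSpace X] [CompactSpace X] [MeasurableSpace X]
    [BorelSpace X] (μ : Measure X) [IsProbabilityMeasure μ] (h : C(X, ℂ)) :
    ‖toL2 μ h‖ ≤ ‖h‖ := by
  refine ((toL2 μ).le_opNorm h).trans ?_
  have := ContinuousMap.toLp_norm_le (E := ℂ) (p := 2) (𝕜 := ℂ) (μ := μ)
  have h1 : ‖toL2 μ‖ ≤ 1 := by simpa [measureUnivNNReal] using this
  exact mul_le_of_le_one_left (norm_nonneg _) h1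

theorem norm_toL2_sq {X : Type*} [TopologicalSpace X] [CompactSpace X] [MeasurableSpace X]
    [BorelSpace X] (μ : Measure X) [IsFiniteMeasure μ] (h : C(X, ℂ)) :
    ‖toL2 μ h‖ ^ 2 = ∫ x, ‖h x‖ ^ 2 ∂μ := by
  have h1 := inner_self_eq_norm_sq_to_K (𝕜 := ℂ) (toL2 μ h)
  rw [ContinuousMap.inner_toLp] at h1
  have h2 : ∫ x, h x * (starRingEnd ℂ) (h x) ∂μ = ((∫ x, ‖h x‖ ^ 2 ∂μ : ℝ) : ℂ) := by
    rw [← integral_complex_ofReal]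
    simp [Complex.mul_conj, Complex.normSq_eq_norm_sq]
  rw [h2] at h1
  exact Complex.ofReal_injective (by simpa using h1.symm)

theorem pairing_eq_inner (h h' : C(G, ℂ)) :
    pairing μ h h' = inner ℂ (toL2 μ h') (toL2 μ h) := by
  rw [ContinuousMap.inner_toLp]; rfl

/-- Cauchy–Schwarz gives `‖Q^m u‖² ≤ ‖Q^(2m) u‖ ‖u‖` in `L²`, which is iterated along powers of two.
Symmetry is for the `L²` pairing, but the resulting lower bound is on the operator norm over `C(G,
ℂ)`, as the Banach algebra argument requires. -/
theorem pow_le_norm_pow_of_symmetric (Q : C(G, ℂ) →L[ℂ] C(G, ℂ))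
    (hQ : ∀ h h', pairing μ (Q h) h' = pairing μ h (Q h')) (u : C(G, ℂ))
    (hu : 0 < ‖toL2 μ u‖) (n : ℕ) :
    (‖toL2 μ (Q u)‖ / ‖toL2 μ u‖) ^ 2 ^ n ≤ ‖u‖ / ‖toL2 μ u‖ * ‖Q ^ 2 ^ n‖ := by
  have hpow : ∀ (m : ℕ) h h', pairing μ ((Q ^ m) h) h' = pairing μ h ((Q ^ m) h') := by
    intro m
    induction m with
    | zero => intro h h'; simp
    | succ m ih =>
      intro h h'
      rw [pow_succ, mul_apply_eq_comp, ih, hQ, ← mul_apply_eq_comp,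
        ← pow_succ', ← pow_succ]
  have hstep : ∀ m : ℕ, ‖toL2 μ ((Q ^ m) u)‖ ^ 2 ≤ ‖toL2 μ ((Q ^ (m * 2)) u)‖ * ‖toL2 μ u‖ := by
    intro m
    have h1 := hpow m ((Q ^ m) u) u
    rw [← mul_apply_eq_comp, ← pow_add, ← mul_two, pairing_eq_inner,
      pairing_eq_inner, inner_self_eq_norm_sq_to_K] at h1
    have h2 := norm_inner_le_norm (𝕜 := ℂ) (toL2 μ u) (toL2 μ ((Q ^ (m * 2)) u))
    rw [h1] at h2
    rw [mul_comm]
    simpa using h2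
  have hmain : (‖toL2 μ (Q u)‖ / ‖toL2 μ u‖) ^ 2 ^ n * ‖toL2 μ u‖ ≤
      ‖toL2 μ ((Q ^ 2 ^ n) u)‖ := by
    induction n with
    | zero => simp [hu.ne']
    | succ n ih =>
      have h1 := hstep (2 ^ n)
      rw [← pow_succ] at h1
      have h2 := pow_le_pow_left₀ (by positivity) ih 2
      rw [mul_pow, ← pow_mul, ← pow_succ] at h2
      have h3 := h2.trans h1
      rw [pow_two, ← mul_assoc] at h3
      exact le_of_mul_le_mul_right h3 hu
  rw [div_mul_eq_mul_div, le_div_iff₀ hu]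
  refine hmain.trans ((norm_toL2_le μ _).trans ?_)
  rw [mul_comm]
  exact ContinuousLinearMap.le_opNorm _ _

theorem involute_involute (k : C(G, ℂ)) : involute (involute k) = k := by
  ext x; simp [involute]

variable [μ.IsHaarMeasure] [μ.Regular]

theorem toL2_pos_of_ne_zero {h : C(G, ℂ)} (hh : h ≠ 0) : 0 < ‖toL2 μ h‖ := by
  refine norm_pos_iff.2 fun h0 => hh ?_
  exact ContinuousMap.toLp_injective μ (𝕜 := ℂ) (by rw [h0, map_zero])

/-- A multiplicative bounded map from a group is unimodular. -/
theorem norm_eq_one_of_bounded {G : Type*} [Group G] (χ : G →* ℂ) {C : ℝ}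
    (hC : ∀ g, ‖χ g‖ ≤ C) (g : G) : ‖χ g‖ = 1 := by
  have key : ∀ g, ‖χ g‖ ≤ 1 := by
    intro g
    by_contra hg
    obtain ⟨n, hn⟩ := pow_unbounded_of_one_lt C (not_le.1 hg)
    have := hC (g ^ n)
    rw [map_pow, norm_pow] at this
    linarith
  refine le_antisymm (key g) ?_
  have h1 : ‖χ g‖ * ‖χ g⁻¹‖ = 1 := by
    rw [← norm_mul, ← map_mul, mul_inv_cancel, map_one, norm_one]
  nlinarith [key g, key g⁻¹, norm_nonneg (χ g), norm_nonneg (χ g⁻¹)]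

/-- The characters of a compact abelian group separate points from the identity. -/
theorem PontryaginDual.exists_apply_ne_one {G : Type*} [CommGroup G] [TopologicalSpace G]
    [IsTopologicalGroup G] [CompactSpace G] [T2Space G] [MeasurableSpace G] [BorelSpace G]
    (μ : Measure G) [IsProbabilityMeasure μ] [μ.IsHaarMeasure] [μ.Regular] {g : G} (hg : g ≠ 1) :
    ∃ χ : PontryaginDual G, χ g ≠ 1 := by
  obtain ⟨k₀, hk0, hk1, -⟩ := exists_continuous_zero_one_of_isClosed
    (isClosed_singleton (x := g⁻¹)) (isClosed_singleton (x := (1 : G)))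
    (by simpa using hg)
  let k : C(G, ℂ) := ⟨fun x => (k₀ x : ℂ), by fun_prop⟩
  -- A multiplicative functional whose character is trivial at `g` must vanish on a difference of
  -- this shape, so it suffices to find one that does not kill `p`.
  set p : C(G, ℂ) := leftTranslate g k - k with hp
  have hpne : p ≠ 0 := by
    intro h
    have h1 := DFunLike.congr_fun h 1
    simp [hp, k, hk0 rfl, hk1 rfl] at h1
  set p' := involute p with hp'
  set Q := convOp μ p * convOp μ p' with hQdef
  have hQ : ∀ h h', pairing μ (Q h) h' = pairing μ h (Q h') := by
    intro h h'
    simp only [hQdef, mul_apply_eq_comp]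
    rw [pairing_convOp_left, pairing_convOp_left, ← hp', hp', involute_involute]
  have hu := toL2_pos_of_ne_zero μ hpne
  -- Its value at the identity is the squared `L²` norm of `p`.
  have hv : convOp μ p' p ≠ 0 := by
    intro h
    have h1 := DFunLike.congr_fun h 1
    rw [convOp_apply_apply, ← integral_inv_eq_self] at h1
    have h2 := norm_toL2_sq μ p
    have h3 : ∫ x, p' x⁻¹ * p (x⁻¹⁻¹ * 1) ∂μ = ((∫ x, ‖p x‖ ^ 2 ∂μ : ℝ) : ℂ) := by
      rw [← integral_complex_ofReal]
      simp [hp', involute, ← Complex.normSq_eq_norm_sq, Complex.normSq_eq_conj_mul_self]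
    rw [h3, ← h2] at h1
    simp [hu.ne'] at h1
  -- The pairing of `Q p` with `p` is the squared `L²` norm of `convOp μ p' p`.
  have hQu : Q p ≠ 0 := by
    intro h
    have h1 : pairing μ (Q p) p = 0 := by rw [h]; simp [pairing]
    rw [hQdef, mul_apply_eq_comp, pairing_convOp_left, pairing_eq_inner,
      inner_self_eq_zero] at h1
    exact (toL2_pos_of_ne_zero μ hv).ne' (by rw [h1, norm_zero])
  obtain ⟨φ, hmul, hsub, hφ, hpφ⟩ := exists_continuousOn_multiplicative_ne_zero
    (Set.range (convOp (G := G) μ)) (by rintro _ ⟨a, rfl⟩ _ ⟨b, rfl⟩; exact convOp_comm μ a b)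
    ⟨p, rfl⟩ ⟨p', rfl⟩
    (div_pos (toL2_pos_of_ne_zero μ hQu) hu) (pow_le_norm_pow_of_symmetric μ Q hQ p hu)
  let T : C(G, ℂ) → ℂ := fun h => φ (convOp μ h)
  have hT : Continuous T := hφ.comp_continuous (continuous_convOp μ) fun h => ⟨h, rfl⟩
  change T p ≠ 0 at hpφ
  have hTmul : ∀ h h' a b, T (leftTranslate a h) * T (leftTranslate b h') =
      T (leftTranslate (a * b) h) * T h' := by
    intro h h' a b
    have h1 := hmul _ ⟨leftTranslate a h, rfl⟩ _ ⟨leftTranslate b h', rfl⟩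
    rw [convOp_translate_mul, hmul _ ⟨_, rfl⟩ _ ⟨_, rfl⟩] at h1
    exact h1.symm
  have hT1 : ∀ h, leftTranslate (1 : G) h = h := fun h => by ext x; simp
  let χ₀ : G →* ℂ :=
    { toFun := fun a => (T (leftTranslate a p)) / (T p)
      map_one' := by simp only [hT1, div_self hpφ]
      map_mul' := fun a b => by
        rw [div_mul_div_comm, hTmul, mul_div_mul_right _ _ hpφ] }
  have hχc : Continuous χ₀ :=
    (hT.comp (continuous_leftTranslate p)).div_const _
  obtain ⟨C, hC⟩ := (isCompact_range hχc).isBounded.exists_norm_le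
  have hnorm := norm_eq_one_of_bounded χ₀ fun g => hC _ ⟨g, rfl⟩
  let χ : PontryaginDual G := (⟨⟨⟨fun a => ⟨χ₀ a, by simp [Submonoid.unitSphere, hnorm]⟩,
    by ext; simp⟩, fun a b => by ext; exact _root_.map_mul χ₀ a b⟩, by
      exact hχc.subtype_mk _⟩ : G →ₜ* Circle)
  refine ⟨χ, fun h => hpφ ?_⟩
  have h1 : χ₀ g = 1 := congrArg (fun z : Circle => (z : ℂ)) h
  -- If the character is 1 at `g`, then `T (leftTranslate g p) = T p`. This identity then gives `T
  -- (leftTranslate g k) = T k`, that is `T p = 0`, a contradiction.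
  have h2 : (T (leftTranslate g k)) * (T p) = (T k) * (T (leftTranslate g p)) := by
    have := hTmul k p 1 g
    rw [hT1, one_mul] at this
    exact this.symm
  have h3 : (T (leftTranslate g p)) = (T p) := by
    have : (T (leftTranslate g p)) / (T p) = 1 := h1
    rwa [div_eq_one_iff_eq hpφ] at this
  rw [h3] at h2
  have h4 := mul_right_cancel₀ hpφ h2
  have h5 : T p = T (leftTranslate g k) - T k := by
    rw [← hsub _ ⟨_, rfl⟩ _ ⟨_, rfl⟩, ← convOp_sub]
  rw [h5, h4, sub_self]

end SeparatesPoints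

/-! ### Fourier series on a compact abelian group -/

section CharacterSeries

variable {G : Type*} [CommGroup G] [TopologicalSpace G]

/-- A character as a continuous complex function. -/
noncomputable def charMap (χ : PontryaginDual G) : C(G, ℂ) :=
  ⟨fun x => (χ x : ℂ), continuous_subtype_val.comp (map_continuous χ)⟩

@[simp] theorem charMap_apply (χ : PontryaginDual G) (x : G) : charMap χ x = (χ x : ℂ) := rfl

theorem charMap_mul (χ ψ : PontryaginDual G) : charMap (χ * ψ) = charMap χ * charMap ψ := by
  ext x; exact Circle.coe_mul _ _

theorem charMap_one : charMap (1 : PontryaginDual G) = 1 := by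
  ext x; simp

theorem star_charMap (χ : PontryaginDual G) : star (charMap χ) = charMap χ⁻¹ := by
  ext x; exact (Circle.coe_inv_eq_conj _).symm

theorem conj_char_apply (χ : PontryaginDual G) (x : G) :
    (starRingEnd ℂ) (χ x : ℂ) = ((χ⁻¹ : PontryaginDual G) x : ℂ) :=
  (Circle.coe_inv_eq_conj _).symm

variable [CompactSpace G]

theorem norm_charMap_le (χ : PontryaginDual G) : ‖charMap χ‖ ≤ 1 :=
  (ContinuousMap.norm_le _ zero_le_one).2 fun x => (Circle.norm_coe (χ x)).le

theorem adjoin_range_charMap :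
    Subalgebra.toSubmodule (Algebra.adjoin ℂ (Set.range (charMap (G := G)))) =
      Submodule.span ℂ (Set.range (charMap (G := G))) := by
  apply Algebra.adjoin_eq_span_of_subset
  refine .trans (fun x => Submonoid.closure_induction (fun _ => id) ⟨1, charMap_one⟩ ?_)
    Submodule.subset_span
  rintro _ _ _ _ ⟨m, rfl⟩ ⟨n, rfl⟩
  exact ⟨m * n, charMap_mul m n⟩

variable [IsTopologicalGroup G] [T2Space G] [MeasurableSpace G] [BorelSpace G] (μ : Measure G)
  [IsProbabilityMeasure μ] [μ.IsHaarMeasure] [μ.Regular]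

/-- Stone–Weierstrass: the span is already a star-subalgebra because products and conjugates of
characters are characters. -/
theorem span_charMap_closure_eq_top (μ : Measure G) [IsProbabilityMeasure μ] [μ.IsHaarMeasure]
    [μ.Regular] :
    (Submodule.span ℂ (Set.range (charMap (G := G)))).topologicalClosure = ⊤ := by
  let A : StarSubalgebra ℂ C(G, ℂ) :=
    { Algebra.adjoin ℂ (Set.range (charMap (G := G))) with
      star_mem' := by
        change Algebra.adjoin ℂ (Set.range (charMap (G := G))) ≤
          star (Algebra.adjoin ℂ (Set.range (charMap (G := G))))
        refine Algebra.adjoin_le ?_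
        rintro _ ⟨n, rfl⟩
        exact Algebra.subset_adjoin ⟨n⁻¹, (star_charMap n).symm⟩ }
  have hA : A.SeparatesPoints := by
    intro x y hxy
    obtain ⟨χ, hχ⟩ := PontryaginDual.exists_apply_ne_one μ (g := x / y)
      (by rwa [Ne, div_eq_one])
    refine ⟨_, ⟨charMap χ, Algebra.subset_adjoin ⟨χ, rfl⟩, rfl⟩, fun h => hχ ?_⟩
    have h1 : χ x = χ y := Subtype.ext h
    rw [map_div, h1, div_self']
  rw [← adjoin_range_charMap]
  exact congr_arg (Subalgebra.toSubmodule <| StarSubalgebra.toSubalgebra ·)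
    (ContinuousMap.starSubalgebra_topologicalClosure_eq_top_of_separatesPoints A hA)

/-- The indicator of a closed `K` is replaced by a Urysohn function supported in an open `U ⊇ K`.
The error is at most the integral of `‖f‖` over `U \ K`, small by outer regularity and absolute
continuity of the integral. -/
theorem ae_eq_zero_of_forall_integral_continuous_mul {f : G → ℂ} (hf : Integrable f μ)
    (h : ∀ g : C(G, ℂ), ∫ x, g x * f x ∂μ = 0) : f =ᵐ[μ] 0 := by
  refine ae_eq_zero_of_forall_setIntegral_isClosed_eq_zero hf fun K hK => ?_
  refine norm_le_zero_iff.1 (le_of_forall_pos_le_add fun ε hε => ?_)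
  obtain ⟨δ, hδ, hsmall⟩ := exists_pos_setLIntegral_lt_of_measure_lt (f := fun x => ‖f x‖ₑ) hf.2.ne
    (ENNReal.ofReal_pos.2 hε).ne'
  obtain ⟨U, hKU, hUo, -, hU⟩ := hK.measurableSet.exists_isOpen_sdiff_lt (measure_ne_top μ K) hδ.ne'
  obtain ⟨g, hg0, hg1, hg01⟩ := exists_continuous_zero_one_of_isClosed hUo.isClosed_compl hK
    (Set.disjoint_compl_left_iff_subset.2 hKU)
  have hgi := h ⟨fun x => (g x : ℂ), by fun_prop⟩
  have hint : Integrable (fun x => (g x : ℂ) * f x) μ :=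
    hf.bdd_mul (c := 1) (by fun_prop) (.of_forall fun x => by
      rw [Complex.norm_real, Real.norm_eq_abs, abs_of_nonneg (hg01 x).1]; exact (hg01 x).2)
  have h1 : ∫ x in K, f x ∂μ = ∫ x, (K.indicator f x - (g x : ℂ) * f x) ∂μ := by
    rw [integral_sub (hf.indicator hK.measurableSet) hint, integral_indicator hK.measurableSet]
    rw [show ∫ x, (g x : ℂ) * f x ∂μ = 0 from hgi, sub_zero]
  have hm : MeasurableSet (U \ K) := hUo.measurableSet.diff hK.measurableSet
  have h2 : ‖∫ x in K, f x ∂μ‖ ≤ ∫ x in U \ K, ‖f x‖ ∂μ := by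
    rw [h1, ← integral_indicator hm]
    refine norm_integral_le_of_norm_le (hf.norm.indicator hm) (.of_forall fun x => ?_)
    by_cases hxK : x ∈ K
    · simp [hxK, hg1 hxK]
    · by_cases hxU : x ∈ U
      · simp only [hxK, hxU, Set.indicator_of_notMem, not_false_eq_true, zero_sub, norm_neg,
          norm_mul, Set.mem_sdiff, and_self, Set.indicator_of_mem, Complex.norm_real]
        rw [Real.norm_eq_abs, abs_of_nonneg (hg01 x).1]
        exact mul_le_of_le_one_left (norm_nonneg _) (hg01 x).2
      · simp [hxK, hxU, hg0 (show x ∈ Uᶜ from hxU)]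
  rw [integral_norm_eq_lintegral_enorm hf.1.restrict] at h2
  rw [zero_add]
  exact h2.trans (ENNReal.toReal_le_of_le_ofReal hε.le (hsmall _ hU).le)

theorem ae_eq_zero_of_forall_integral_char_mul {f : G → ℂ} (hf : Integrable f μ)
    (h : ∀ χ : PontryaginDual G, ∫ x, (χ x : ℂ) * f x ∂μ = 0) : f =ᵐ[μ] 0 := by
  refine ae_eq_zero_of_forall_integral_continuous_mul μ hf fun g => ?_
  have hbd : ∀ g : C(G, ℂ), Integrable (fun x => g x * f x) μ := fun g =>
    hf.bdd_mul (c := ‖g‖) g.continuous.aestronglyMeasurable (.of_forall g.norm_coe_le_norm)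
  let Λ : C(G, ℂ) →L[ℂ] ℂ := LinearMap.mkContinuous
    { toFun := fun g => ∫ x, g x * f x ∂μ
      map_add' := fun g g' => by
        rw [← integral_add (hbd g) (hbd g')]
        simp [add_mul]
      map_smul' := fun c g => by
        rw [RingHom.id_apply, ← integral_smul]
        simp [mul_assoc] } (∫ x, ‖f x‖ ∂μ) (fun g => by
      refine (norm_integral_le_integral_norm _).trans ?_
      rw [mul_comm, ← integral_const_mul]
      refine integral_mono (hbd g).norm (hf.norm.const_mul _) fun x => ?_
      simp only [norm_mul]
      exact mul_le_mul_of_nonneg_right (g.norm_coe_le_norm x) (norm_nonneg _))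
  have hle : Submodule.span ℂ (Set.range (charMap (G := G))) ≤ LinearMap.ker Λ.toLinearMap := by
    rw [Submodule.span_le]
    rintro _ ⟨χ, rfl⟩
    exact h χ
  have h2 := Submodule.topologicalClosure_minimal _ hle Λ.isClosed_ker
  rw [span_charMap_closure_eq_top μ] at h2
  exact h2 (Submodule.mem_top (x := g))

open Classical in
theorem integral_char (χ : PontryaginDual G) :
    ∫ x, (χ x : ℂ) ∂μ = if χ = 1 then 1 else 0 := by
  split_ifs with h
  · subst h; simp
  · obtain ⟨g, hg⟩ : ∃ g, χ g ≠ 1 := by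
      by_contra hcon
      push Not at hcon
      exact h (PontryaginDual.ext hcon)
    have h1 := integral_mul_left_eq_self (μ := μ) (fun x => (χ x : ℂ)) g
    simp only [map_mul, Circle.coe_mul, integral_const_mul] at h1
    have h2 : ((χ g : ℂ) - 1) * ∫ x, (χ x : ℂ) ∂μ = 0 := by rw [sub_mul, h1]; ring
    refine (mul_eq_zero.1 h2).resolve_left (sub_ne_zero.2 fun h3 => hg (Circle.ext (by simpa using h3)))

/-- An integrable function with absolutely convergent Fourier series agrees almost everywhere with
the sum of its Fourier series. -/
theorem exists_hasSum_charMap_of_summable {f : G → ℝ} (hf : Integrable f μ)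
    (hs : Summable fun χ : PontryaginDual G => ‖charFourierCoeff μ f χ‖) :
    ∃ F : C(G, ℂ), HasSum (fun χ : PontryaginDual G => charFourierCoeff μ f χ • charMap χ) F ∧
      (fun x => (f x : ℂ)) =ᵐ[μ] F := by
  classical
  have hsum : Summable fun χ : PontryaginDual G => charFourierCoeff μ f χ • charMap χ := by
    refine Summable.of_norm_bounded hs fun χ => ?_
    rw [norm_smul]
    exact mul_le_of_le_one_right (norm_nonneg _) (norm_charMap_le χ)
  obtain ⟨F, hF⟩ := hsum
  refine ⟨F, hF, ?_⟩
  have hfc : Integrable (fun x => (f x : ℂ)) μ := hf.ofReal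
  have hFi := integrable_continuousMap μ F
  have h0 : (fun x => (f x : ℂ) - F x) =ᵐ[μ] 0 := by
    refine ae_eq_zero_of_forall_integral_char_mul μ (hfc.sub hFi) fun χ => ?_
    -- Integrating the series against `χ` leaves only the coefficient at `χ⁻¹`, so `f` and `F` have
    -- equal Fourier coefficients.
    have h1 := hF.mapL (integralMulCLM μ (charMap χ))
    have h2 : ∀ ψ : PontryaginDual G,
        integralMulCLM μ (charMap χ) (charFourierCoeff μ f ψ • charMap ψ) =
          if ψ = χ⁻¹ then charFourierCoeff μ f χ⁻¹ else 0 := by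
      intro ψ
      rw [map_smul, integralMulCLM_apply]
      have h3 : ∀ x, charMap ψ x * charMap χ x = ((ψ * χ : PontryaginDual G) x : ℂ) :=
        fun x => (DFunLike.congr_fun (charMap_mul ψ χ) x).symm
      simp only [h3, integral_char, mul_eq_one_iff_eq_inv]
      split_ifs with h <;> simp [h]
    simp only [h2] at h1
    have h4 := h1.unique (hasSum_ite_eq _ _)
    have hb : ∀ {u : G → ℂ}, Integrable u μ → Integrable (fun x => (χ x : ℂ) * u x) μ := fun hu =>
      hu.bdd_mul (c := 1) (charMap χ).continuous.aestronglyMeasurable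
        (.of_forall fun x => (Circle.norm_coe (χ x)).le)
    simp only [mul_sub]
    rw [integral_sub (hb hfc) (hb hFi), sub_eq_zero]
    rw [integralMulCLM_apply, charFourierCoeff] at h4
    simp only [conj_char_apply, inv_inv, charMap_apply] at h4
    rw [← h4]
    simp only [mul_comm]
  filter_upwards [h0] with x hx using sub_eq_zero.1 hx

end CharacterSeries

/-! ### Joint cumulants on multisets -/

section Cumulants

variable {ι : Type*}

/-- The product of functions on multisets dual to the splitting of a multiset into two parts. -/
def splitMul (u v : Multiset ι → ℂ) (s : Multiset ι) : ℂ :=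
  (s.antidiagonal.map fun p => u p.1 * v p.2).sum

theorem splitMul_zero (u v : Multiset ι → ℂ) : splitMul u v 0 = u 0 * v 0 := by
  simp [splitMul]

theorem splitMul_cons (u v : Multiset ι → ℂ) (x : ι) (s : Multiset ι) :
    splitMul u v (x ::ₘ s) =
      splitMul (fun t => u (x ::ₘ t)) v s + splitMul u (fun t => v (x ::ₘ t)) s := by
  simp [splitMul, Multiset.antidiagonal_cons, add_comm]

/-- The joint cumulant `κ(a, s)` associated with a moment function `m` on multisets, with a
distinguished index `a`, defined recursively by
`m(a, s) = ∑_{s = b + c} κ(a, b) m(c)`. -/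
noncomputable def jointCumulant (m : Multiset ι → ℂ) (a : ι) (s : Multiset ι) : ℂ :=
  Multiset.strongInductionOn (p := fun _ => ℂ) s fun s ih =>
    open Classical in
    m (a ::ₘ s) - (s.antidiagonal.map fun p => if h : p.1 < s then ih p.1 h * m p.2 else 0).sum

theorem jointCumulant_eq (m : Multiset ι → ℂ) (a : ι) (s : Multiset ι) :
    open Classical in
    jointCumulant m a s = m (a ::ₘ s) -
      (s.antidiagonal.map fun p => if p.1 < s then jointCumulant m a p.1 * m p.2 else 0).sum := by
  classical
  rw [jointCumulant, Multiset.strongInductionOn_eq]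
  congr 3

open Classical in
-- Splittings are counted with multiplicity, but `(s, 0)` occurs exactly once and is the only one
-- whose first part is not strictly below `s`.
theorem splitMul_eq_add_sum_lt (u v : Multiset ι → ℂ) (hv : v 0 = 1) (s : Multiset ι) :
    splitMul u v s = u s + (s.antidiagonal.map fun p => if p.1 < s then u p.1 * v p.2 else 0).sum := by
  have h : ∀ (s : Multiset ι) (w : Multiset ι × Multiset ι → ℂ),
      (s.antidiagonal.map w).sum =
        w (s, 0) + (s.antidiagonal.map fun p => if p.1 < s then w p else 0).sum := by
    intro s
    induction s using Multiset.induction with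
    | empty => intro w; simp
    | cons x s ih =>
      intro w
      simp only [Multiset.antidiagonal_cons, Multiset.map_add, Multiset.map_map, Multiset.sum_add,
        Function.comp_def, Prod.map, id, Multiset.cons_lt_cons_iff]
      rw [ih (fun p => w (x ::ₘ p.1, p.2))]
      have h2 : ∀ p ∈ s.antidiagonal, (if p.1 < x ::ₘ s then w (p.1, x ::ₘ p.2) else 0) =
          w (p.1, x ::ₘ p.2) := by
        intro p hp
        have : p.1 ≤ s := by
          rw [← Multiset.mem_antidiagonal.1 hp]; exact Multiset.le_add_right _ _
        rw [if_pos (lt_of_le_of_lt this (Multiset.lt_cons_self _ _))]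
      rw [Multiset.map_congr rfl h2]
      ring
  rw [splitMul, h s (fun p => u p.1 * v p.2), hv, mul_one]

theorem splitMul_jointCumulant (m : Multiset ι → ℂ) (hm : m 0 = 1) (a : ι) (s : Multiset ι) :
    splitMul (jointCumulant m a) m s = m (a ::ₘ s) := by
  classical
  rw [splitMul_eq_add_sum_lt _ _ hm, jointCumulant_eq]
  ring

theorem splitMul_eq_zero {u v : Multiset ι → ℂ} {s : Multiset ι}
    (h : ∀ b c, b + c = s → u b * v c = 0) : splitMul u v s = 0 := by
  rw [splitMul]
  refine Multiset.sum_eq_zero fun x hx => ?_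
  obtain ⟨p, hp, rfl⟩ := Multiset.mem_map.1 hx
  exact h _ _ (Multiset.mem_antidiagonal.1 hp)

/-- If `u` vanishes on the multisets meeting `¬ p`, except possibly the whole of `s + t`, then the
split product over `s + t`, where `s` lives on `p` and `t ≠ 0` on `¬ p`, reduces to `s`. -/
theorem splitMul_add_of_vanish {p : ι → Prop} {u v : Multiset ι → ℂ} (t : Multiset ι)
    (s : Multiset ι) (ht : ∀ x ∈ t, ¬ p x)
    (hu : ∀ b ≤ s + t, (∃ x ∈ b, ¬ p x) → u b = 0) :
    splitMul u v (s + t) = splitMul u (fun c => v (c + t)) s := by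
  induction t using Multiset.induction generalizing v with
  | empty => simp
  | cons x t ih =>
    rw [Multiset.add_cons, splitMul_cons, ih (v := fun c => v (x ::ₘ c))
      (fun y hy => ht y (Multiset.mem_cons_of_mem hy))
      (fun b hb => hu b (hb.trans (by simp [Multiset.add_cons, Multiset.le_cons_self])))]
    have h0 : splitMul (fun t => u (x ::ₘ t)) v (s + t) = 0 := by
      refine splitMul_eq_zero fun b c hbc => ?_
      rw [hu (x ::ₘ b) ?_ ⟨x, Multiset.mem_cons_self _ _, ht x (Multiset.mem_cons_self _ _)⟩, zero_mul]
      rw [Multiset.add_cons, Multiset.cons_le_cons_iff, ← hbc]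
      exact Multiset.le_add_right _ _
    rw [h0, zero_add]
    simp [Multiset.add_cons]

/-- Joint cumulants vanish when the moments factorize along a nontrivial splitting. -/
theorem jointCumulant_eq_zero (m : Multiset ι → ℂ) (hm0 : m 0 = 1) (p : ι → Prop)
    [DecidablePred p] (a : ι) (ha : p a)
    (s : Multiset ι) (hm : ∀ t ≤ a ::ₘ s, m t = m (t.filter p) * m (t.filter fun x => ¬ p x))
    (hs : ∃ x ∈ s, ¬ p x) : jointCumulant m a s = 0 := by
  classical
  induction s using Multiset.strongInductionOn with
  | ih s ih =>
    set s₁ := s.filter p with hs₁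
    set s₂ := s.filter (fun x => ¬ p x) with hs₂
    have hsplit : s₁ + s₂ = s := Multiset.filter_add_not p s
    -- The cumulant is cut off at `s` itself. By the induction hypothesis the rest vanishes on
    -- multisets meeting `¬ p`, so its split product with `m` already gives all of `m (a ::ₘ s)`.
    -- Nothing is left for the cumulant at `s`.
    let u : Multiset ι → ℂ := fun b => if b < s then jointCumulant m a b else 0
    have hu : ∀ b ≤ s₁ + s₂, (∃ x ∈ b, ¬ p x) → u b = 0 := by
      intro b hb hx
      rw [hsplit] at hb
      by_cases hlt : b < s
      · simp only [u, if_pos hlt]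
        exact ih b hlt (fun t ht => hm t (ht.trans (Multiset.cons_le_cons _ hlt.le))) hx
      · simp [u, hlt]
    have hs₁lt : s₁ < s := by
      refine lt_of_le_of_ne (Multiset.filter_le _ _) fun h => ?_
      obtain ⟨x, hx, hpx⟩ := hs
      rw [← h] at hx
      exact hpx (Multiset.mem_filter.1 hx).2
    have h1 : splitMul u m s = m (a ::ₘ s) := by
      rw [← hsplit, splitMul_add_of_vanish (p := p) s₂ s₁
        (fun x hx => (Multiset.mem_filter.1 hx).2) hu]
      have h2 : splitMul u (fun c => m (c + s₂)) s₁ =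
          splitMul (jointCumulant m a) m s₁ * m s₂ := by
        rw [splitMul, splitMul, ← Multiset.sum_map_mul_right]
        congr 1
        refine Multiset.map_congr rfl fun q hq => ?_
        rw [Multiset.mem_antidiagonal] at hq
        have hq1 : q.1 ≤ s₁ := hq ▸ Multiset.le_add_right _ _
        have hq2 : q.2 ≤ s₁ := hq ▸ Multiset.le_add_left _ _
        have h3 : m (q.2 + s₂) = m q.2 * m s₂ := by
          rw [hm (q.2 + s₂)]
          · rw [Multiset.filter_add, Multiset.filter_add]
            have e1 : q.2.filter p = q.2 := Multiset.filter_eq_self.2 fun x hx =>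
              (Multiset.mem_filter.1 (Multiset.mem_of_le hq2 hx)).2
            have e2 : s₂.filter p = 0 := Multiset.filter_eq_nil.2 fun x hx =>
              (Multiset.mem_filter.1 hx).2
            have e3 : q.2.filter (fun x => ¬ p x) = 0 := Multiset.filter_eq_nil.2 fun x hx =>
              not_not.2 (Multiset.mem_filter.1 (Multiset.mem_of_le hq2 hx)).2
            have e4 : s₂.filter (fun x => ¬ p x) = s₂ := Multiset.filter_eq_self.2 fun x hx =>
              (Multiset.mem_filter.1 hx).2
            rw [e1, e2, e3, e4, add_zero, zero_add]
          · exact (add_le_add_left hq2 s₂).trans (hsplit.le.trans (Multiset.le_cons_self _ _))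
        simp only [u, if_pos (lt_of_le_of_lt hq1 hs₁lt)]
        rw [h3, mul_assoc]
      rw [h2, splitMul_jointCumulant m hm0, hsplit, hm (a ::ₘ s) le_rfl,
        Multiset.filter_cons_of_pos _ ha, Multiset.filter_cons_of_neg (p := fun x => ¬ p x) _ (not_not.2 ha)]
    have h4 := splitMul_eq_add_sum_lt u m hm0 s
    rw [h1] at h4
    rw [jointCumulant_eq, h4]
    simp only [u, lt_irrefl, if_false, zero_add]
    rw [sub_eq_zero]
    congr 1
    refine Multiset.map_congr rfl fun q _ => ?_
    split_ifs <;> simp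

/-- A bound for joint cumulants in terms of a bound for moments. -/
theorem exists_norm_jointCumulant_le (m : Multiset ι → ℂ) (C : ℕ → ℝ)
    (hC : ∀ s, ‖m s‖ ≤ C (Multiset.card s)) (r : ℕ) :
    ∃ K : ℝ, ∀ a s, Multiset.card s ≤ r → ‖jointCumulant m a s‖ ≤ K := by
  classical
  obtain ⟨D, hD0, hD⟩ : ∃ D : ℝ, 0 ≤ D ∧ ∀ j ≤ r + 1, C j ≤ D := by
    refine ⟨∑ j ∈ Finset.range (r + 2), |C j|, by positivity, fun j hj => ?_⟩
    exact (le_abs_self _).trans (Finset.single_le_sum (f := fun j => |C j|)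
      (fun i _ => abs_nonneg _) (Finset.mem_range.2 (by omega)))
  suffices h : ∀ j ≤ r, ∃ K : ℝ, 0 ≤ K ∧ ∀ a s, Multiset.card s ≤ j → ‖jointCumulant m a s‖ ≤ K by
    obtain ⟨K, -, hK⟩ := h r le_rfl
    exact ⟨K, hK⟩
  intro j
  induction j with
  | zero =>
    intro _
    refine ⟨D, hD0, fun a s hs => ?_⟩
    obtain rfl : s = 0 := Multiset.card_eq_zero.1 (Nat.le_zero.1 hs)
    rw [jointCumulant_eq]
    simpa using (hC {a}).trans (hD 1 (by omega))
  | succ j ih =>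
    intro hj
    obtain ⟨K, hK0, hK⟩ := ih (by omega)
    -- A multiset of card at most `j + 1` has at most `2 ^ (j + 1)` splittings.
    refine ⟨D + 2 ^ (j + 1) * (K * D), by positivity, fun a s hs => ?_⟩
    rw [jointCumulant_eq]
    refine (norm_sub_le _ _).trans (add_le_add ((hC _).trans (hD _ (by simp; omega))) ?_)
    refine (Multiset.le_sum_of_subadditive (fun z : ℂ => ‖z‖) norm_zero.le norm_add_le _).trans ?_
    rw [Multiset.map_map]
    refine (Multiset.sum_le_card_nsmul _ (K * D) ?_).trans ?_
    · intro x hx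
      obtain ⟨q, hq, rfl⟩ := Multiset.mem_map.1 hx
      rw [Multiset.mem_antidiagonal] at hq
      simp only [Function.comp]
      have hcard : Multiset.card q.1 + Multiset.card q.2 = Multiset.card s := by
        rw [← hq, Multiset.card_add]
      split_ifs with hlt
      · have := Multiset.card_lt_card hlt
        rw [norm_mul]
        exact mul_le_mul (hK _ _ (by omega)) ((hC _).trans (hD _ (by omega))) (norm_nonneg _) hK0
      · rw [norm_zero]; positivity
    · rw [Multiset.card_map, Multiset.card_antidiagonal, nsmul_eq_mul]
      push_cast
      refine mul_le_mul_of_nonneg_right (pow_le_pow_right₀ (by norm_num) hs) (by positivity)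

end Cumulants

/-! ### Weighted sums over words -/

section Words

variable {ι : Type*} (F : Finset ι) (w : ι → ℂ)

/-- The weighted sum of a function on multisets over all words of length `r` in `F`. -/
def wordSum : ℕ → (Multiset ι → ℂ) → ℂ
  | 0, u => u 0
  | r + 1, u => ∑ x ∈ F, w x * wordSum r fun s => u (x ::ₘ s)

theorem wordSum_add (r : ℕ) (u v : Multiset ι → ℂ) :
    wordSum F w r (fun s => u s + v s) = wordSum F w r u + wordSum F w r v := by
  induction r generalizing u v with
  | zero => rfl
  | succ r ih => simp only [wordSum, ih, mul_add, Finset.sum_add_distrib]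

/-- Prepending a letter acts on `splitMul` by the Leibniz rule, so iteration produces binomial
coefficients. This turns the recursion for joint cumulants into the one for a single random
variable. -/
theorem wordSum_splitMul (r : ℕ) (u v : Multiset ι → ℂ) :
    wordSum F w r (splitMul u v) =
      ∑ p ∈ Finset.HasAntidiagonal.antidiagonal r, (r.choose p.1 : ℂ) * (wordSum F w p.1 u * wordSum F w p.2 v) := by
  induction r generalizing u v with
  | zero => simp [wordSum, splitMul_zero]
  | succ r ih =>
    have h1 : ∀ x, (fun s => splitMul u v (x ::ₘ s)) =
        fun s => splitMul (fun t => u (x ::ₘ t)) v s + splitMul u (fun t => v (x ::ₘ t)) s :=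
      fun x => funext fun s => splitMul_cons u v x s
    simp only [wordSum, h1]
    simp only [wordSum_add, ih, mul_add, Finset.sum_add_distrib]
    rw [Finset.sum_antidiagonal_choose_succ_mul
      (fun i j => wordSum F w i u * wordSum F w j v) r, add_comm]
    congr 1
    · simp only [Finset.mul_sum, wordSum]
      rw [Finset.sum_comm]
      refine Finset.sum_congr rfl fun p _ => Finset.sum_congr rfl fun x _ => ?_
      ring
    · simp only [Finset.mul_sum, wordSum, Finset.sum_mul]
      rw [Finset.sum_comm]
      refine Finset.sum_congr rfl fun p hp => Finset.sum_congr rfl fun x _ => ?_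
      rw [← Nat.choose_symm_of_eq_add (Finset.HasAntidiagonal.mem_antidiagonal.1 hp).symm]
      ring

/-- A bound for word sums of functions supported on words in a finite set. -/
theorem norm_wordSum_le (r : ℕ) (u : Multiset ι → ℂ) (p : ι → Prop) [DecidablePred p] {K : ℝ}
    (hK : 0 ≤ K) (hu : ∀ s, Multiset.card s = r → ‖u s‖ ≤ K)
    (hp : ∀ s, Multiset.card s = r → (∃ x ∈ s, ¬ p x) → u s = 0) :
    ‖wordSum F w r u‖ ≤ K * (∑ x ∈ F with p x, ‖w x‖) ^ r := by
  induction r generalizing u K with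
  | zero => simpa [wordSum] using hu 0 rfl
  | succ r ih =>
    rw [wordSum, ← Finset.sum_filter_add_sum_filter_not F p]
    have h0 : ∑ x ∈ F with ¬ p x, w x * wordSum F w r (fun s => u (x ::ₘ s)) = 0 := by
      refine Finset.sum_eq_zero fun x hx => ?_
      have hx' := (Finset.mem_filter.1 hx).2
      -- A first letter outside `p` kills the whole word sum: this is the induction hypothesis with
      -- bound 0.
      have h2 : ‖wordSum F w r (fun s => u (x ::ₘ s))‖ ≤ 0 * (∑ x ∈ F with p x, ‖w x‖) ^ r :=
        ih (fun s => u (x ::ₘ s)) le_rfl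
          (fun s hs => by rw [hp _ (by simp [hs]) ⟨x, Multiset.mem_cons_self _ _, hx'⟩, norm_zero])
          (fun s hs _ => hp _ (by simp [hs]) ⟨x, Multiset.mem_cons_self _ _, hx'⟩)
      rw [zero_mul, norm_le_zero_iff] at h2
      rw [h2, mul_zero]
    rw [h0, add_zero, pow_succ', mul_left_comm, Finset.sum_mul]
    refine norm_sum_le_of_le _ fun x _ => ?_
    rw [norm_mul]
    refine mul_le_mul_of_nonneg_left (ih _ hK (fun s hs => hu _ (by simp [hs]))
      fun s hs hx => hp _ (by simp [hs]) ?_) (norm_nonneg _)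
    obtain ⟨y, hy, hpy⟩ := hx
    exact ⟨y, Multiset.mem_cons_of_mem hy, hpy⟩

end Words

/-! ### The method of moments -/

section MomentMethod

/-- On the segment from 0 to `z` the exponential has modulus at most 1, so integrating the remainder
bound `k` times adds no exponential factor. It serves both imaginary `z` and negative real `z`. -/
theorem norm_exp_sub_sum_le_of_re_nonpos {z : ℂ} (hz : z.re ≤ 0) (k : ℕ) :
    ‖Complex.exp z - ∑ j ∈ Finset.range k, z ^ j / (j.factorial : ℂ)‖ ≤
      ‖z‖ ^ k / (k.factorial : ℝ) := by
  suffices h : ∀ x ∈ Set.Icc (0 : ℝ) 1,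
      ‖Complex.exp (x * z) - ∑ j ∈ Finset.range k, (x * z) ^ j / (j.factorial : ℂ)‖ ≤
        (x * ‖z‖) ^ k / (k.factorial : ℝ) by
    simpa using h 1 (by simp)
  induction k with
  | zero =>
    intro x hx
    simp only [Finset.range_zero, Finset.sum_empty, sub_zero, Complex.norm_exp, pow_zero,
      Nat.factorial_zero, Nat.cast_one, div_one]
    rw [Real.exp_le_one_iff, Complex.re_ofReal_mul]
    exact mul_nonpos_of_nonneg_of_nonpos hx.1 hz
  | succ k ih =>
    have hfact : ∀ j : ℕ, ((j + 1 : ℕ) : ℂ) / ((j + 1).factorial : ℂ) = 1 / (j.factorial : ℂ) := by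
      intro j
      rw [Nat.factorial_succ]
      push_cast
      field_simp [Nat.cast_add_one_ne_zero j, Nat.cast_ne_zero.2 (Nat.factorial_ne_zero j)]
    have hd : ∀ x : ℝ, HasDerivAt (fun x : ℝ => Complex.exp (x * z) -
        ∑ j ∈ Finset.range (k + 1), (x * z) ^ j / (j.factorial : ℂ))
        (z * (Complex.exp (x * z) - ∑ j ∈ Finset.range k, (x * z) ^ j / (j.factorial : ℂ))) x := by
      intro x
      have h0 : HasDerivAt (fun x : ℝ => (x : ℂ) * z) z x := by
        simpa using (Complex.ofRealCLM.hasDerivAt (x := x)).mul_const z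
      have h2 : HasDerivAt (fun x : ℝ => ∑ j ∈ Finset.range (k + 1), (x * z) ^ j / (j.factorial : ℂ))
          (∑ j ∈ Finset.range (k + 1), (j : ℂ) * (x * z) ^ (j - 1) * z / (j.factorial : ℂ)) x :=
        HasDerivAt.fun_sum fun j _ => (h0.pow j).div_const _
      refine (h0.cexp.sub h2).congr_deriv ?_
      rw [Finset.sum_range_succ']
      simp only [Nat.cast_zero, zero_mul, zero_div, add_zero, Nat.add_sub_cancel]
      rw [mul_sub, Finset.mul_sum, mul_comm z]
      congr 1
      refine Finset.sum_congr rfl fun j _ => ?_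
      calc ((j + 1 : ℕ) : ℂ) * (x * z) ^ j * z / ((j + 1).factorial : ℂ)
          = (((j + 1 : ℕ) : ℂ) / ((j + 1).factorial : ℂ)) * ((x * z) ^ j * z) := by ring
        _ = _ := by rw [hfact]; ring
    have hB : ∀ x : ℝ, HasDerivAt (fun x : ℝ => (x * ‖z‖) ^ (k + 1) / ((k + 1).factorial : ℝ))
        (‖z‖ * ((x * ‖z‖) ^ k / (k.factorial : ℝ))) x := by
      intro x
      have h0 : HasDerivAt (fun x : ℝ => x * ‖z‖) ‖z‖ x := by
        simpa using (hasDerivAt_id x).mul_const ‖z‖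
      refine ((h0.pow (k + 1)).div_const _).congr_deriv ?_
      rw [Nat.factorial_succ]
      push_cast
      have h1 : (k.factorial : ℝ) ≠ 0 := Nat.cast_ne_zero.2 (Nat.factorial_ne_zero k)
      have h2 : (k : ℝ) + 1 ≠ 0 := by positivity
      field_simp
    intro x hx
    refine image_norm_le_of_norm_deriv_right_le_deriv_boundary
      (fun y _ => (hd y).continuousAt.continuousWithinAt) (fun y _ => (hd y).hasDerivWithinAt)
      ?_ hB (fun y hy => ?_) hx
    · simp [Finset.sum_range_succ']
    · rw [norm_mul]
      exact mul_le_mul_of_nonneg_left (ih y ⟨hy.1, hy.2.le⟩) (norm_nonneg _)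

/-- The moments of the centered Gaussian law of variance `s`. -/
def gaussianMoment (s : ℝ) : ℕ → ℝ
  | 0 => 1
  | 1 => 0
  | r + 2 => (r + 1) * s * gaussianMoment s r

theorem gaussianMoment_nonneg {s : ℝ} (hs : 0 ≤ s) (r : ℕ) : 0 ≤ gaussianMoment s r := by
  induction r using Nat.twoStepInduction with
  | zero => simp [gaussianMoment]
  | one => simp [gaussianMoment]
  | more r ih _ => rw [gaussianMoment]; positivity

theorem gaussianMoment_mono {s B : ℝ} (hs : 0 ≤ s) (hB : s ≤ B) (r : ℕ) :
    gaussianMoment s r ≤ gaussianMoment B r := by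
  induction r using Nat.twoStepInduction with
  | zero => simp [gaussianMoment]
  | one => simp [gaussianMoment]
  | more r ih _ =>
    rw [gaussianMoment, gaussianMoment]
    have := gaussianMoment_nonneg hs r
    have := hs.trans hB
    gcongr

theorem gaussianMoment_odd (s : ℝ) (j : ℕ) : gaussianMoment s (2 * j + 1) = 0 := by
  induction j with
  | zero => rfl
  | succ j ih => rw [show 2 * (j + 1) + 1 = (2 * j + 1) + 2 by ring, gaussianMoment, ih, mul_zero]

theorem gaussianMoment_even (s : ℝ) (j : ℕ) :
    gaussianMoment s (2 * j) / ((2 * j).factorial : ℝ) = (s / 2) ^ j / (j.factorial : ℝ) := by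
  induction j with
  | zero => simp [gaussianMoment]
  | succ j ih =>
    rw [show 2 * (j + 1) = 2 * j + 2 by ring, gaussianMoment, Nat.factorial_succ,
      Nat.factorial_succ, Nat.factorial_succ, pow_succ, mul_comm ((s / 2) ^ j)]
    have h1 : ((2 * j).factorial : ℝ) ≠ 0 := Nat.cast_ne_zero.2 (Nat.factorial_ne_zero _)
    have h2 : (j.factorial : ℝ) ≠ 0 := Nat.cast_ne_zero.2 (Nat.factorial_ne_zero _)
    rw [div_eq_div_iff h1 h2] at ih
    push_cast
    rw [div_eq_div_iff (by positivity) (by positivity)]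
    linear_combination (2 * (j : ℝ) + 1) * s * (j + 1) * ih

/-- Odd moments vanish and the even ones reassemble the Taylor polynomial of `exp (-(s * t ^ 2 /
2))`; no Gaussian variable is involved. -/
theorem sum_gaussianMoment (s t : ℝ) (k : ℕ) :
    ∑ r ∈ Finset.range (2 * k), (t * Complex.I) ^ r / (r.factorial : ℂ) * (gaussianMoment s r : ℂ) =
      ∑ j ∈ Finset.range k, (((-(s * t ^ 2 / 2) : ℝ) : ℂ)) ^ j / (j.factorial : ℂ) := by
  induction k with
  | zero => simp
  | succ k ih =>
    rw [show 2 * (k + 1) = 2 * k + 1 + 1 by ring, Finset.sum_range_succ, Finset.sum_range_succ, ih,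
      Finset.sum_range_succ, gaussianMoment_odd]
    simp only [Complex.ofReal_zero, mul_zero, add_zero]
    congr 1
    have h1 := congrArg (fun x : ℝ => (x : ℂ)) (gaussianMoment_even s k)
    push_cast at h1
    rw [mul_comm_div, h1, pow_mul, mul_pow, Complex.I_sq, mul_div_assoc', ← mul_pow]
    push_cast
    congr 2
    ring

variable {Ω : Type*} [MeasurableSpace Ω] (μ : Measure Ω) [IsProbabilityMeasure μ]

/-- The truncation order is even so that the remainder, an absolute moment, is again an ordinary
moment. -/
theorem norm_integral_exp_sub_le {Y : Ω → ℝ} (hY : AEStronglyMeasurable Y μ) {C : ℝ}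
    (hC : ∀ x, |Y x| ≤ C) (t : ℝ) (k : ℕ) :
    ‖∫ x, Complex.exp (t * Y x * Complex.I) ∂μ -
      ∑ r ∈ Finset.range (2 * k), (t * Complex.I) ^ r / (r.factorial : ℂ) * ∫ x, (Y x : ℂ) ^ r ∂μ‖ ≤
      |t| ^ (2 * k) / ((2 * k).factorial : ℝ) * ∫ x, Y x ^ (2 * k) ∂μ := by
  have hYc : AEStronglyMeasurable (fun x => (Y x : ℂ)) μ :=
    Complex.continuous_ofReal.comp_aestronglyMeasurable hY
  have hint : ∀ r : ℕ, Integrable (fun x => (Y x : ℂ) ^ r) μ := fun r =>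
    Integrable.of_bound (hYc.pow r) (C ^ r) (.of_forall fun x => by
      rw [norm_pow, Complex.norm_real]; exact pow_le_pow_left₀ (norm_nonneg _) (hC x) r)
  have hintR : Integrable (fun x => Y x ^ (2 * k)) μ :=
    Integrable.of_bound (hY.pow _) (C ^ (2 * k)) (.of_forall fun x => by
      rw [norm_pow]; exact pow_le_pow_left₀ (norm_nonneg _) (hC x) _)
  have hexp : Integrable (fun x => Complex.exp (t * Y x * Complex.I)) μ :=
    Integrable.of_bound (Complex.continuous_exp.comp_aestronglyMeasurable
      ((hYc.const_mul _).mul_const _)) 1 (.of_forall fun x => by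
      rw [← Complex.ofReal_mul, Complex.norm_exp_ofReal_mul_I])
  have hsum : ∑ r ∈ Finset.range (2 * k),
      (t * Complex.I) ^ r / (r.factorial : ℂ) * ∫ x, (Y x : ℂ) ^ r ∂μ =
      ∫ x, ∑ r ∈ Finset.range (2 * k), (t * Complex.I) ^ r / (r.factorial : ℂ) * (Y x : ℂ) ^ r ∂μ := by
    rw [integral_finsetSum _ fun r _ => (hint r).const_mul _]
    simp only [integral_const_mul]
  rw [hsum, ← integral_sub hexp (integrable_finsetSum _ fun r _ => (hint r).const_mul _),
    ← integral_const_mul]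
  refine norm_integral_le_of_norm_le (hintR.const_mul _) (.of_forall fun x => ?_)
  have h := norm_exp_sub_sum_le_of_re_nonpos (z := t * Y x * Complex.I) (by simp) (2 * k)
  have h2 : ‖(t * Y x * Complex.I : ℂ)‖ ^ (2 * k) / ((2 * k).factorial : ℝ) =
      |t| ^ (2 * k) / ((2 * k).factorial : ℝ) * Y x ^ (2 * k) := by
    rw [norm_mul, norm_mul, Complex.norm_real, Complex.norm_real, Complex.norm_I, mul_one,
      Real.norm_eq_abs, Real.norm_eq_abs, mul_pow, pow_mul |Y x|, sq_abs, ← pow_mul]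
    ring
  rw [h2] at h
  refine le_of_eq_of_le ?_ h
  congr 2
  refine Finset.sum_congr rfl fun r _ => ?_
  ring

/-- Convergence of moments to Gaussian moments from the decay of the higher cumulants. -/
theorem tendsto_moment_sub_gaussianMoment {M k : ℕ → ℕ → ℂ} {s : ℕ → ℝ} {B : ℝ}
    (hs0 : ∀ n, 0 ≤ s n) (hsB : ∀ n, s n ≤ B) (hM0 : ∀ n, M n 0 = 1) (hM2 : ∀ n, M n 2 = s n)
    (hrec : ∀ n r, M n (r + 1) =
      ∑ p ∈ Finset.HasAntidiagonal.antidiagonal r, (r.choose p.1 : ℂ) * (k n p.1 * M n p.2))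
    (hk0 : ∀ n, k n 0 = 0) (hk : ∀ j, 2 ≤ j → Tendsto (fun n => k n j) atTop (𝓝 0)) (r : ℕ) :
    Tendsto (fun n => M n r - (gaussianMoment (s n) r : ℂ)) atTop (𝓝 0) := by
  have hM1 : ∀ n, M n 1 = 0 := fun n => by simpa [hk0] using hrec n 0
  have hk1 : ∀ n, k n 1 = s n := fun n => by
    have h := hrec n 1
    rw [Finset.Nat.sum_antidiagonal_eq_sum_range_succ_mk] at h
    simp [Finset.sum_range_succ, hk0, hM0, hM2] at h
    exact h.symm
  have hbd : ∀ r, Tendsto (fun n => M n r - (gaussianMoment (s n) r : ℂ)) atTop (𝓝 0) →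
      IsBoundedUnder (· ≤ ·) atTop (fun n => ‖M n r‖) := by
    intro r hr
    have h1 : ∀ n, ‖(gaussianMoment (s n) r : ℂ)‖ ≤ gaussianMoment B r := fun n => by
      rw [Complex.norm_real, Real.norm_eq_abs, abs_of_nonneg (gaussianMoment_nonneg (hs0 n) r)]
      exact gaussianMoment_mono (hs0 n) (hsB n) r
    refine ⟨1 + gaussianMoment B r, ?_⟩
    rw [eventually_map]
    filter_upwards [(tendsto_zero_iff_norm_tendsto_zero.1 hr).eventually_le_const one_pos] with n hn
    calc ‖M n r‖ = ‖(M n r - (gaussianMoment (s n) r : ℂ)) + (gaussianMoment (s n) r : ℂ)‖ := by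
          rw [sub_add_cancel]
      _ ≤ _ := (norm_add_le _ _).trans (add_le_add hn (h1 n))
  induction r using Nat.strong_induction_on with
  | _ r ih =>
    match r, ih with
    | 0, _ => simp [hM0, gaussianMoment]
    | 1, _ => simp [hM1, gaussianMoment]
    | r + 2, ih =>
      -- `k n j` is the cumulant of order `j + 1`. The first vanishes, the second gives the Gaussian
      -- recursion, and the sum collects orders three and above, each tending to 0 against a bounded
      -- moment.
      have hsplit : ∀ n, M n (r + 2) - (gaussianMoment (s n) (r + 2) : ℂ) =
          (r + 1) * s n * (M n r - (gaussianMoment (s n) r : ℂ)) +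
            ∑ j ∈ Finset.range r, ((r + 1).choose (j + 2) : ℂ) *
              (k n (j + 2) * M n (r - 1 - j)) := by
        intro n
        rw [hrec n (r + 1), Finset.Nat.sum_antidiagonal_eq_sum_range_succ_mk,
          Finset.sum_range_succ', Finset.sum_range_succ']
        simp only [hk0, zero_mul, mul_zero, add_zero, zero_add, Nat.choose_one_right, hk1]
        rw [gaussianMoment]
        have hsum : ∑ j ∈ Finset.range r, ((r + 1).choose (j + 1 + 1) : ℂ) *
            (k n (j + 1 + 1) * M n (r + 1 - (j + 1 + 1))) =
            ∑ j ∈ Finset.range r, ((r + 1).choose (j + 2) : ℂ) *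
              (k n (j + 2) * M n (r - 1 - j)) :=
          Finset.sum_congr rfl fun j _ => by
            rw [show r + 1 - (j + 1 + 1) = r - 1 - j by omega]
        rw [← hsum]
        push_cast
        ring
      simp only [hsplit]
      rw [← add_zero (0 : ℂ)]
      refine Tendsto.add ?_ ?_
      · have h1 := ih r (by omega)
        have h2 : IsBoundedUnder (· ≤ ·) atTop (fun n => ‖((r : ℂ) + 1) * s n‖) := by
          refine isBoundedUnder_of ⟨(r + 1) * B, fun n => ?_⟩
          rw [norm_mul, Complex.norm_real, Real.norm_eq_abs, abs_of_nonneg (hs0 n)]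
          have h3 : ‖(r : ℂ) + 1‖ = r + 1 := by
            rw [← Nat.cast_add_one, Complex.norm_natCast]; push_cast; ring
          rw [h3]
          exact mul_le_mul_of_nonneg_left (hsB n) (by positivity)
        simpa [mul_comm] using h1.zero_mul_isBoundedUnder_le h2
      · rw [← Finset.sum_const_zero (s := Finset.range r)]
        refine tendsto_finsetSum _ fun j hj => ?_
        have hj := Finset.mem_range.1 hj
        have h1 := (hk (j + 2) (by omega)).zero_mul_isBoundedUnder_le
          (hbd (r - 1 - j) (ih _ (by omega)))
        simpa using h1.const_mul ((r + 1).choose (j + 2) : ℂ)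

/-- The method of moments for asymptotically Gaussian bounded random variables, in terms of
characteristic functions. -/
theorem tendsto_integral_exp_sub_of_cumulants {Y : ℕ → Ω → ℝ}
    (hY : ∀ n, AEStronglyMeasurable (Y n) μ) (hbd : ∀ n, ∃ C, ∀ x, |Y n x| ≤ C)
    {k : ℕ → ℕ → ℂ} {s : ℕ → ℝ} {B : ℝ} (hsB : ∀ n, s n ≤ B)
    (hM2 : ∀ n, ∫ x, Y n x ^ 2 ∂μ = s n)
    (hrec : ∀ n r, ∫ x, (Y n x : ℂ) ^ (r + 1) ∂μ =
      ∑ p ∈ Finset.HasAntidiagonal.antidiagonal r,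
        (r.choose p.1 : ℂ) * (k n p.1 * ∫ x, (Y n x : ℂ) ^ p.2 ∂μ))
    (hk0 : ∀ n, k n 0 = 0) (hk : ∀ j, 2 ≤ j → Tendsto (fun n => k n j) atTop (𝓝 0)) (t : ℝ) :
    Tendsto (fun n => ∫ x, Complex.exp (t * Y n x * Complex.I) ∂μ -
      Complex.exp ((-(s n * t ^ 2 / 2) : ℝ) : ℂ)) atTop (𝓝 0) := by
  have hs0 : ∀ n, 0 ≤ s n := fun n => by
    rw [← hM2]; exact integral_nonneg fun x => sq_nonneg _
  have hcast : ∀ n r, ∫ x, (Y n x : ℂ) ^ r ∂μ = ((∫ x, Y n x ^ r ∂μ : ℝ) : ℂ) := fun n r => by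
    rw [← integral_complex_ofReal]; simp
  have hmom := tendsto_moment_sub_gaussianMoment (M := fun n r => ∫ x, (Y n x : ℂ) ^ r ∂μ) hs0 hsB
    (fun n => by simp) (fun n => by simp only [hcast, hM2]) hrec hk0 hk
  set X : ℝ := B * t ^ 2 / 2 with hX
  have hXs : ∀ n, s n * t ^ 2 / 2 ≤ X := fun n => by
    rw [hX]; have := hsB n; gcongr
  rw [Metric.tendsto_atTop']
  intro ε hε
  -- The error has four quarters: the Gaussian moment in the remainder, the moment discrepancy
  -- there, the discrepancy in the polynomial, and the Taylor remainder of the Gaussian. This choice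
  -- settles the first and the last for all `n`.
  obtain ⟨k₀, hk₀⟩ : ∃ k₀ : ℕ, X ^ k₀ / (k₀.factorial : ℝ) < ε / 4 :=
    ((FloorSemiring.tendsto_pow_div_factorial_atTop X).eventually_lt_const (by positivity)).exists
  have hreal : Tendsto (fun n => |t| ^ (2 * k₀) / ((2 * k₀).factorial : ℝ) *
      ‖∫ x, (Y n x : ℂ) ^ (2 * k₀) ∂μ - (gaussianMoment (s n) (2 * k₀) : ℂ)‖) atTop (𝓝 0) := by
    simpa using ((hmom (2 * k₀)).norm).const_mul (|t| ^ (2 * k₀) / ((2 * k₀).factorial : ℝ))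
  have hpoly : Tendsto (fun n => ∑ r ∈ Finset.range (2 * k₀),
      (t * Complex.I) ^ r / (r.factorial : ℂ) *
        (∫ x, (Y n x : ℂ) ^ r ∂μ - (gaussianMoment (s n) r : ℂ))) atTop (𝓝 0) := by
    rw [← Finset.sum_const_zero (s := Finset.range (2 * k₀))]
    refine tendsto_finsetSum _ fun r _ => ?_
    simpa using (hmom r).const_mul ((t * Complex.I) ^ r / (r.factorial : ℂ))
  obtain ⟨N, hN⟩ := eventually_atTop.1 ((hreal.eventually_lt_const
    (show (0 : ℝ) < ε / 4 by positivity)).and (hpoly.norm.eventually_lt_const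
    (show ‖(0 : ℂ)‖ < ε / 4 by simpa using by positivity)))
  refine ⟨N, fun n hn => ?_⟩
  obtain ⟨h1, h2⟩ := hN n hn.le
  rw [dist_zero_right]
  obtain ⟨C, hC⟩ := hbd n
  have e1 := norm_integral_exp_sub_le μ (hY n) hC t k₀
  have e2 : |t| ^ (2 * k₀) / ((2 * k₀).factorial : ℝ) * ∫ x, Y n x ^ (2 * k₀) ∂μ < ε / 4 + ε / 4 := by
    have h3 : ∫ x, Y n x ^ (2 * k₀) ∂μ ≤ gaussianMoment (s n) (2 * k₀) +
        ‖∫ x, (Y n x : ℂ) ^ (2 * k₀) ∂μ - (gaussianMoment (s n) (2 * k₀) : ℂ)‖ := by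
      rw [hcast, ← Complex.ofReal_sub, Complex.norm_real, Real.norm_eq_abs]
      linarith [le_abs_self (∫ x, Y n x ^ (2 * k₀) ∂μ - gaussianMoment (s n) (2 * k₀))]
    have h4 : |t| ^ (2 * k₀) / ((2 * k₀).factorial : ℝ) * gaussianMoment (s n) (2 * k₀) < ε / 4 := by
      refine lt_of_le_of_lt ?_ hk₀
      rw [div_mul_eq_mul_div, mul_div_assoc, gaussianMoment_even, pow_mul, sq_abs, ← mul_div_assoc,
        ← mul_pow]
      have : t ^ 2 * (s n / 2) ≤ X := by rw [show t ^ 2 * (s n / 2) = s n * t ^ 2 / 2 by ring]; exact hXs n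
      have := hs0 n
      gcongr
    have h5 := mul_le_mul_of_nonneg_left h3
      (show 0 ≤ |t| ^ (2 * k₀) / ((2 * k₀).factorial : ℝ) by positivity)
    rw [mul_add] at h5
    linarith
  have e3 := norm_exp_sub_sum_le_of_re_nonpos (z := ((-(s n * t ^ 2 / 2) : ℝ) : ℂ))
    (by rw [Complex.ofReal_re]; have := hs0 n; have : 0 ≤ s n * t ^ 2 / 2 := by positivity
        linarith) k₀
  have e4 : ‖((-(s n * t ^ 2 / 2) : ℝ) : ℂ)‖ ^ k₀ / (k₀.factorial : ℝ) < ε / 4 := by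
    refine lt_of_le_of_lt ?_ hk₀
    have h0 : 0 ≤ s n * t ^ 2 / 2 := by have := hs0 n; positivity
    rw [Complex.norm_real, norm_neg, Real.norm_eq_abs, abs_of_nonneg h0]
    have := hXs n
    gcongr
  rw [← sum_gaussianMoment] at e3
  have e5 : ∫ x, Complex.exp (t * Y n x * Complex.I) ∂μ -
      Complex.exp ((-(s n * t ^ 2 / 2) : ℝ) : ℂ) =
      (∫ x, Complex.exp (t * Y n x * Complex.I) ∂μ - ∑ r ∈ Finset.range (2 * k₀),
        (t * Complex.I) ^ r / (r.factorial : ℂ) * ∫ x, (Y n x : ℂ) ^ r ∂μ) +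
      (∑ r ∈ Finset.range (2 * k₀), (t * Complex.I) ^ r / (r.factorial : ℂ) *
        (∫ x, (Y n x : ℂ) ^ r ∂μ - (gaussianMoment (s n) r : ℂ))) -
      (Complex.exp ((-(s n * t ^ 2 / 2) : ℝ) : ℂ) - ∑ r ∈ Finset.range (2 * k₀),
        (t * Complex.I) ^ r / (r.factorial : ℂ) * (gaussianMoment (s n) r : ℂ)) := by
    simp only [mul_sub, Finset.sum_sub_distrib]
    ring
  rw [e5]
  refine (norm_sub_le _ _).trans_lt ?_
  have e6 := norm_add_le (∫ x, Complex.exp (t * Y n x * Complex.I) ∂μ -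
      ∑ r ∈ Finset.range (2 * k₀),
        (t * Complex.I) ^ r / (r.factorial : ℂ) * ∫ x, (Y n x : ℂ) ^ r ∂μ)
      (∑ r ∈ Finset.range (2 * k₀), (t * Complex.I) ^ r / (r.factorial : ℂ) *
        (∫ x, (Y n x : ℂ) ^ r ∂μ - (gaussianMoment (s n) r : ℂ)))
  linarith

end MomentMethod

/-! ### The action on functions and on characters -/

section Action

variable {ι G : Type*} [CommGroup G] [TopologicalSpace G] (A : ι → (G ≃ₜ* G))

/-- Composition of continuous functions with the automorphisms `A l`. -/
noncomputable def actMap (l : ι) : C(G, ℂ) →ₐ[ℂ] C(G, ℂ) :=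
  ContinuousMap.compRightAlgHom ℂ ℂ (⟨A l, (A l).continuous⟩ : C(G, G))

@[simp] theorem actMap_apply (l : ι) (h : C(G, ℂ)) (x : G) : actMap A l h x = h (A l x) := rfl

/-- The dual action on characters. -/
noncomputable def actChar (l : ι) (χ : PontryaginDual G) : PontryaginDual G :=
  PontryaginDual.map (⟨(A l : G →* G), (A l).continuous⟩ : G →ₜ* G) χ

@[simp] theorem actChar_apply (l : ι) (χ : PontryaginDual G) (x : G) :
    actChar A l χ x = χ (A l x) := rfl

theorem actMap_charMap (l : ι) (χ : PontryaginDual G) :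
    actMap A l (charMap χ) = charMap (actChar A l χ) := rfl

theorem actMap_actMap {ι : Type*} [Add ι] (A : ι → (G ≃ₜ* G))
    (hA : ∀ k l x, A (k + l) x = A k (A l x)) (k l : ι) (h : C(G, ℂ)) :
    actMap A l (actMap A k h) = actMap A (k + l) h := by
  ext x; simp [hA]

variable [IsTopologicalGroup G] [CompactSpace G] [MeasurableSpace G] [BorelSpace G]
  (μ : Measure G) [IsProbabilityMeasure μ] [μ.IsHaarMeasure]

/-- Uniqueness of the regular Haar probability measure. -/
theorem measurePreserving_continuousMulEquiv [μ.Regular] (B : G ≃ₜ* G) :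
    MeasurePreserving B μ μ := by
  have hr : (μ.map B).Regular := Measure.Regular.map B.toHomeomorph
  have hh : (μ.map B).IsHaarMeasure := B.isHaarMeasure_map μ
  have hp : IsProbabilityMeasure (μ.map B) :=
    Measure.isProbabilityMeasure_map B.continuous.measurable.aemeasurable
  exact ⟨B.continuous.measurable, Measure.isHaarMeasure_eq_of_isProbabilityMeasure _ _⟩

theorem integral_actMap [μ.Regular] (l : ι) (h : C(G, ℂ)) :
    ∫ x, actMap A l h x ∂μ = ∫ x, h x ∂μ :=
  (measurePreserving_continuousMulEquiv μ (A l)).integral_comp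
    (A l).toHomeomorph.measurableEmbedding h

end Action

/-! ### Mixing in terms of characters -/

section Mixing

theorem Circle.dist_mul_self_left (a z : Circle) : dist (a * z) a = dist z 1 := by
  change dist ((a * z : Circle) : ℂ) a = dist (z : ℂ) ((1 : Circle) : ℂ)
  rw [dist_eq_norm, dist_eq_norm, Circle.coe_mul]
  calc ‖(a : ℂ) * z - a‖ = ‖(a : ℂ) * (z - 1)‖ := by rw [mul_sub, mul_one]
    _ = _ := by rw [norm_mul, Circle.norm_coe, one_mul]; rfl

theorem Circle.dist_inv_one (z : Circle) : dist z⁻¹ 1 = dist z 1 := by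
  rw [← Circle.dist_mul_self_left z⁻¹ z, inv_mul_cancel, dist_comm]

variable {d : ℕ} {G : Type*} [CommGroup G] [TopologicalSpace G]
    [IsTopologicalGroup G] [CompactSpace G] [MeasurableSpace G] [BorelSpace G]
    {μ : Measure G} [μ.IsHaarMeasure] [IsProbabilityMeasure μ]
    {A : (Fin d → ℤ) → (G ≃ₜ* G)}

/-- If the transported characters multiplied to 1, then at no point could one factor be far from 1
while all the others are very near it. Such configurations define open sets of positive measure,
which mixing forces to be visited simultaneously. -/
theorem exists_separation_prod_char_ne_one
    (hmix : IsMixingOfAllOrders μ (fun l x => A l x)) {r : ℕ} (hr : 2 ≤ r)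
    (χ : Fin r → PontryaginDual G) (hχ : ∃ i, χ i ≠ 1) :
    ∃ M : ℝ, ∀ n : Fin r → (Fin d → ℤ), (∀ i j, i ≠ j → M ≤ ‖n i - n j‖) →
      ∏ i, actChar A (n i) (χ i) ≠ 1 := by
  obtain ⟨i₀, hi₀⟩ := hχ
  obtain ⟨g, hg⟩ : ∃ g, χ i₀ g ≠ 1 := by
    by_contra hcon
    push Not at hcon
    exact hi₀ (PontryaginDual.ext hcon)
  have hpos : 0 < dist (χ i₀ g) 1 := dist_pos.2 hg
  set δ : ℝ := dist (χ i₀ g) 1 / r with hδ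
  have hr0 : (0 : ℝ) < r := by exact_mod_cast (by omega : 0 < r)
  have hδ0 : 0 < δ := div_pos hpos hr0
  -- The other `r - 1` factors, each within `δ` of 1, have product within `(r - 1) * δ` of 1. The
  -- exceptional set is nonempty because `χ i₀ g` is at distance exactly `r * δ`.
  let B : Fin r → Set G := fun i =>
    if i = i₀ then {x | (r - 1) * δ < dist (χ i x) 1} else {x | dist (χ i x) 1 < δ}
  have hcont : ∀ i, Continuous fun x => dist (χ i x) 1 := fun i =>
    (map_continuous (χ i)).dist continuous_const
  have hopen : ∀ i, IsOpen (B i) := by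
    intro i
    simp only [B]
    split_ifs
    · exact isOpen_lt continuous_const (hcont i)
    · exact isOpen_lt (hcont i) continuous_const
  have hne : ∀ i, (B i).Nonempty := by
    intro i
    simp only [B]
    split_ifs with h
    · subst h
      refine ⟨g, ?_⟩
      have : dist (χ i g) 1 = r * δ := by rw [hδ]; field_simp
      simp only [Set.mem_ofPred_eq, this]
      nlinarith
    · exact ⟨1, by simp [hδ0]⟩
  have hBpos : ∀ i, 0 < μ.real (B i) := fun i => by
    rw [measureReal_def]
    exact ENNReal.toReal_pos ((hopen i).measure_pos μ (hne i)).ne' (measure_ne_top _ _)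
  obtain ⟨M, hM⟩ := hmix r hr B (fun i => (hopen i).measurableSet) (∏ i, μ.real (B i))
    (Finset.prod_pos fun i _ => hBpos i)
  refine ⟨M, fun n hn h1 => ?_⟩
  have hempty : (⋂ i, (fun x => A (n i) x) ⁻¹' B i) = ∅ := by
    rw [Set.eq_empty_iff_forall_notMem]
    intro x hx
    rw [Set.mem_iInter] at hx
    have hx1 : ∏ i, χ i (A (n i) x) = 1 := by
      have h2 : ∀ s : Finset (Fin r), (∏ i ∈ s, actChar A (n i) (χ i)) x =
          ∏ i ∈ s, χ i (A (n i) x) := by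
        intro s
        induction s using Finset.cons_induction with
        | empty => simp
        | cons a s ha ih => rw [Finset.prod_cons, Finset.prod_cons, ← ih]; rfl
      rw [← h2, h1]; rfl
    have hprod : ∀ s : Finset (Fin r), dist (∏ i ∈ s, χ i (A (n i) x)) 1 ≤
        ∑ i ∈ s, dist (χ i (A (n i) x)) 1 := by
      intro s
      induction s using Finset.cons_induction with
      | empty => simp
      | cons a s ha ih =>
        rw [Finset.prod_cons, Finset.sum_cons]
        refine (dist_triangle _ (χ a (A (n a) x)) _).trans ?_
        rw [add_comm]
        refine add_le_add_right ?_ _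
        refine le_trans (le_of_eq ?_) ih
        exact Circle.dist_mul_self_left _ _
    rw [← Finset.mul_prod_erase _ _ (Finset.mem_univ i₀)] at hx1
    have h3 : dist (χ i₀ (A (n i₀) x)) 1 ≤
        ∑ i ∈ Finset.univ.erase i₀, dist (χ i (A (n i) x)) 1 := by
      refine le_trans (le_of_eq ?_) (hprod _)
      rw [eq_inv_of_mul_eq_one_left hx1, Circle.dist_inv_one]
    have h4 : ∑ i ∈ Finset.univ.erase i₀, dist (χ i (A (n i) x)) 1 ≤ (r - 1) * δ := by
      have h5 := Finset.sum_le_card_nsmul (Finset.univ.erase i₀)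
        (fun i => dist (χ i (A (n i) x)) 1) δ (fun i hi => by
          have := hx i
          simp only [B, if_neg (Finset.ne_of_mem_erase hi)] at this
          exact le_of_lt this)
      rw [Finset.card_erase_of_mem (Finset.mem_univ _), Finset.card_univ, Fintype.card_fin,
        nsmul_eq_mul, Nat.cast_sub (by omega), Nat.cast_one] at h5
      exact h5
    have h6 := hx i₀
    simp only [B, if_true] at h6
    have h7 : (r - 1) * δ < dist (χ i₀ (A (n i₀) x)) 1 := h6
    linarith
  have := hM n hn
  rw [hempty] at this
  simp only [measureReal_empty, zero_sub, abs_neg] at this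
  exact absurd this (not_lt.2 (le_abs_self _))

theorem charMap_prod {α : Type*} (s : Finset α) (χ : α → PontryaginDual G) :
    charMap (∏ i ∈ s, χ i) = ∏ i ∈ s, charMap (χ i) := by
  induction s using Finset.cons_induction with
  | empty => simp [charMap_one]
  | cons a s ha ih => rw [Finset.prod_cons, Finset.prod_cons, charMap_mul, ih]

variable [T2Space G] [μ.Regular]

/-- Both sides are 0 or 1, so factorization is an exact equality. The cases of fewer than two
factors fall outside mixing and are immediate. -/
theorem exists_separation_integral_prod_char
    (hmix : IsMixingOfAllOrders μ (fun l x => A l x)) {r : ℕ}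
    (χ : Fin r → PontryaginDual G) :
    ∃ M : ℝ, ∀ n : Fin r → (Fin d → ℤ), (∀ i j, i ≠ j → M ≤ ‖n i - n j‖) →
      ∫ x, (∏ i, actMap A (n i) (charMap (χ i))) x ∂μ = ∏ i, ∫ x, charMap (χ i) x ∂μ := by
  classical
  match r, χ with
  | 0, χ => exact ⟨0, fun n _ => by simp⟩
  | 1, χ => exact ⟨0, fun n _ => by simpa using integral_actMap A μ (n 0) (charMap (χ 0))⟩
  | r + 2, χ =>
    by_cases h : ∃ i, χ i ≠ 1
    · obtain ⟨M, hM⟩ := exists_separation_prod_char_ne_one (A := A) hmix (by omega) χ h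
      refine ⟨M, fun n hn => ?_⟩
      obtain ⟨i, hi⟩ := h
      simp only [actMap_charMap]
      rw [← charMap_prod, Finset.prod_eq_zero (Finset.mem_univ i)]
      · simp only [charMap_apply, integral_char, if_neg (hM n hn)]
      · simp only [charMap_apply, integral_char, if_neg hi]
    · push Not at h
      refine ⟨0, fun n _ => ?_⟩
      simp [h, charMap_one]

/-- The separation is uniform over all polynomials with spectrum in `Λ`, since only finitely many
tuples of characters occur. -/
theorem exists_separation_integral_prod
    (hmix : IsMixingOfAllOrders μ (fun l x => A l x)) (Λ : Finset (PontryaginDual G)) (r : ℕ) :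
    ∃ M : ℝ, ∀ n : Fin r → (Fin d → ℤ), (∀ i j, i ≠ j → M ≤ ‖n i - n j‖) →
      ∀ h : Fin r → C(G, ℂ), (∀ i, ∃ c : PontryaginDual G → ℂ, h i = ∑ χ ∈ Λ, c χ • charMap χ) →
      ∫ x, (∏ i, actMap A (n i) (h i)) x ∂μ = ∏ i, ∫ x, h i x ∂μ := by
  classical
  choose M hM using fun χ : Fin r → PontryaginDual G =>
    exists_separation_integral_prod_char (A := A) hmix χ
  obtain ⟨M₀, hM₀⟩ : ∃ M₀ : ℝ, ∀ χ ∈ Fintype.piFinset fun _ : Fin r => Λ, M χ ≤ M₀ := by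
    obtain ⟨M₀, h⟩ := ((Fintype.piFinset fun _ : Fin r => Λ).image M).bddAbove
    exact ⟨M₀, fun χ hχ => h (Finset.mem_coe.2 (Finset.mem_image_of_mem _ hχ))⟩
  refine ⟨M₀, fun n hn h hh => ?_⟩
  choose c hc using hh
  have hI : ∀ u : C(G, ℂ), ∫ x, u x ∂μ = integralMulCLM μ 1 u := fun u => by
    simp [integralMulCLM_apply]
  have h1 : ∏ i, actMap A (n i) (h i) = ∑ p ∈ Fintype.piFinset fun _ : Fin r => Λ,
      (∏ i, c i (p i)) • ∏ i, actMap A (n i) (charMap (p i)) := by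
    simp only [hc, map_sum, map_smul]
    rw [Finset.prod_univ_sum]
    exact Finset.sum_congr rfl fun p _ => Finset.prod_smul _ _ _
  rw [h1, hI, map_sum]
  have h2 : ∀ i, ∫ x, h i x ∂μ = ∑ χ ∈ Λ, c i χ * ∫ x, charMap χ x ∂μ := by
    intro i
    rw [hI, hc, map_sum]
    exact Finset.sum_congr rfl fun χ _ => by rw [map_smul, ← hI, smul_eq_mul]
  simp only [h2]
  rw [Finset.prod_univ_sum]
  refine Finset.sum_congr rfl fun p hp => ?_
  rw [map_smul, ← hI, hM p n fun i j hij => (hM₀ p hp).trans (hn i j hij), smul_eq_mul,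
    Finset.prod_mul_distrib]

theorem exists_separation_integral_prod_finset
    (hmix : IsMixingOfAllOrders μ (fun l x => A l x)) (Λ : Finset (PontryaginDual G)) (r : ℕ) :
    ∃ M : ℝ, ∀ C : Finset (Fin d → ℤ), C.card ≤ r →
      (∀ c ∈ C, ∀ c' ∈ C, c ≠ c' → M ≤ ‖c - c'‖) →
      ∀ h : (Fin d → ℤ) → C(G, ℂ),
      (∀ c ∈ C, ∃ a : PontryaginDual G → ℂ, h c = ∑ χ ∈ Λ, a χ • charMap χ) →
      ∫ x, (∏ c ∈ C, actMap A c (h c)) x ∂μ = ∏ c ∈ C, ∫ x, h c x ∂μ := by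
  choose M hM using fun r => exists_separation_integral_prod (A := A) hmix Λ r
  obtain ⟨M₀, hM₀⟩ : ∃ M₀ : ℝ, ∀ j ∈ Finset.range (r + 1), M j ≤ M₀ := by
    obtain ⟨M₀, h⟩ := ((Finset.range (r + 1)).image M).bddAbove
    exact ⟨M₀, fun χ hχ => h (Finset.mem_coe.2 (Finset.mem_image_of_mem _ hχ))⟩
  refine ⟨M₀, fun C hC hsep h hh => ?_⟩
  have h1 := hM C.card (fun i => (C.equivFin.symm i : Fin d → ℤ)) (fun i j hij =>
    (hM₀ _ (Finset.mem_range.2 (by omega))).trans (hsep _ (C.equivFin.symm i).2 _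
      (C.equivFin.symm j).2 fun h => hij (C.equivFin.symm.injective (Subtype.ext h))))
    (fun i => h (C.equivFin.symm i)) (fun i => hh _ (C.equivFin.symm i).2)
  rw [Equiv.prod_comp C.equivFin.symm (fun c : C => actMap A (c : Fin d → ℤ) (h c)),
    Equiv.prod_comp C.equivFin.symm (fun c : C => ∫ x, h c x ∂μ),
    Finset.prod_coe_sort C (fun c => actMap A c (h c)),
    Finset.prod_coe_sort C (fun c => ∫ x, h c x ∂μ)] at h1
  exact h1

end Mixing

/-! ### Trigonometric polynomials -/

section TrigPolynomials

variable {G : Type*} [CommGroup G] [TopologicalSpace G] [CompactSpace G]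

variable (G) in
/-- The algebra of trigonometric polynomials. -/
noncomputable abbrev trigPoly : Subalgebra ℂ C(G, ℂ) :=
  Algebra.adjoin ℂ (Set.range (charMap (G := G)))

theorem charMap_mem_trigPoly (χ : PontryaginDual G) : charMap χ ∈ trigPoly G :=
  Algebra.subset_adjoin ⟨χ, rfl⟩

theorem exists_finset_of_mem_trigPoly {h : C(G, ℂ)} (hh : h ∈ trigPoly G) :
    ∃ Λ : Finset (PontryaginDual G), ∀ Λ', Λ ⊆ Λ' →
      ∃ a : PontryaginDual G → ℂ, h = ∑ χ ∈ Λ', a χ • charMap χ := by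
  have h1 : h ∈ Submodule.span ℂ (Set.range (charMap (G := G))) := by
    rw [← adjoin_range_charMap]; exact hh
  obtain ⟨c, rfl⟩ := Finsupp.mem_span_range_iff_exists_finsupp.1 h1
  refine ⟨c.support, fun Λ' hΛ => ⟨c, ?_⟩⟩
  exact Finset.sum_subset hΛ fun χ _ hχ => by simp [Finsupp.notMem_support_iff.1 hχ]

theorem exists_common_finset_of_mem_trigPoly {H : Set C(G, ℂ)} (hfin : H.Finite)
    (hH : ∀ h ∈ H, h ∈ trigPoly G) :
    ∃ Λ : Finset (PontryaginDual G), ∀ h ∈ H,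
      ∃ a : PontryaginDual G → ℂ, h = ∑ χ ∈ Λ, a χ • charMap χ := by
  classical
  choose! Λ hΛ using fun h (hh : h ∈ H) => exists_finset_of_mem_trigPoly (hH h hh)
  refine ⟨hfin.toFinset.biUnion Λ, fun h hh => hΛ h hh _ ?_⟩
  exact Finset.subset_biUnion_of_mem Λ (hfin.mem_toFinset.2 hh)

theorem actMap_mem_trigPoly {ι : Type*} (A : ι → (G ≃ₜ* G)) (l : ι) {h : C(G, ℂ)}
    (hh : h ∈ trigPoly G) : actMap A l h ∈ trigPoly G := by
  obtain ⟨Λ, hΛ⟩ := exists_finset_of_mem_trigPoly hh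
  obtain ⟨a, rfl⟩ := hΛ Λ subset_rfl
  rw [map_sum]
  refine Subalgebra.sum_mem _ fun χ _ => ?_
  rw [map_smul, actMap_charMap]
  exact Subalgebra.smul_mem _ (charMap_mem_trigPoly _) _

end TrigPolynomials

/-! ### Factorization over clusters and vanishing of cumulants -/

section Clusters

variable {d : ℕ} {G : Type*} [CommGroup G] [TopologicalSpace G]
    [IsTopologicalGroup G] [CompactSpace G] [MeasurableSpace G] [BorelSpace G]
    (μ : Measure G) [μ.IsHaarMeasure] [IsProbabilityMeasure μ]
    (A : (Fin d → ℤ) → (G ≃ₜ* G)) (f : C(G, ℂ))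

/-- The joint moments of the family `f ∘ A^l`. -/
noncomputable def jointMoment (s : Multiset (Fin d → ℤ)) : ℂ :=
  ∫ x, (s.map fun l => actMap A l f).prod x ∂μ

theorem jointMoment_zero : jointMoment μ A f 0 = 1 := by
  simp [jointMoment]

theorem norm_jointMoment_le (s : Multiset (Fin d → ℤ)) :
    ‖jointMoment μ A f s‖ ≤ ‖f‖ ^ Multiset.card s := by
  have h : ∀ x, ‖(s.map fun l => actMap A l f).prod x‖ ≤ ‖f‖ ^ Multiset.card s := by
    intro x
    induction s using Multiset.induction with
    | empty => simp
    | cons l s ih =>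
      simp only [Multiset.map_cons, Multiset.prod_cons, ContinuousMap.mul_apply, norm_mul,
        Multiset.card_cons, pow_succ']
      exact mul_le_mul (f.norm_coe_le_norm _) ih (norm_nonneg _) (norm_nonneg _)
  simpa [jointMoment] using norm_integral_le_of_norm_le_const (μ := μ) (.of_forall h)

theorem prod_filter_fiber {ι κ M : Type*} [DecidableEq κ] [CommMonoid M] (X : ι → M) (cl : ι → κ)
    (C : Finset κ) (T : Multiset ι) (hT : ∀ l ∈ T, cl l ∈ C) :
    ∏ c ∈ C, ((T.filter fun l => cl l = c).map X).prod = (T.map X).prod := by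
  induction T using Multiset.induction with
  | empty => simp
  | cons l T ih =>
    have h1 : ∀ c, (((l ::ₘ T).filter fun l => cl l = c).map X).prod =
        (if cl l = c then X l else 1) * ((T.filter fun l => cl l = c).map X).prod := by
      intro c
      by_cases h : cl l = c
      · rw [Multiset.filter_cons_of_pos (p := fun l => cl l = c) _ h, Multiset.map_cons, Multiset.prod_cons, if_pos h]
      · rw [Multiset.filter_cons_of_neg (p := fun l => cl l = c) _ h, if_neg h, one_mul]
    simp only [h1, Finset.prod_mul_distrib]
    rw [ih fun l' hl' => hT l' (Multiset.mem_cons_of_mem hl'), Finset.prod_ite_eq,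
      if_pos (hT l (Multiset.mem_cons_self _ _)), Multiset.map_cons, Multiset.prod_cons]

variable {μ A f} [T2Space G] [μ.Regular]

/-- Joint moments factorize over well separated clusters of bounded size. -/
theorem exists_separation_jointMoment (hA : ∀ k l x, A (k + l) x = A k (A l x))
    (hmix : IsMixingOfAllOrders μ (fun l x => A l x)) (hf : f ∈ trigPoly G) (r : ℕ) (D : ℝ) :
    ∃ M : ℝ, ∀ (cl : (Fin d → ℤ) → (Fin d → ℤ)) (C : Finset (Fin d → ℤ)), C.card ≤ r →
      (∀ c ∈ C, ∀ c' ∈ C, c ≠ c' → M ≤ ‖c - c'‖) →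
      ∀ T : Multiset (Fin d → ℤ), Multiset.card T ≤ r → (∀ l ∈ T, cl l ∈ C) →
      (∀ l ∈ T, ‖l - cl l‖ ≤ D) →
      jointMoment μ A f T = ∏ c ∈ C, jointMoment μ A f (T.filter fun l => cl l = c) := by
  classical
  have hball : (Metric.closedBall (0 : Fin d → ℤ) D).Finite :=
    (isCompact_closedBall _ _).finite_of_discrete
  -- Every multiset of at most `r` offsets `l - cl l` in the ball lies below `N`. Up to translation
  -- there are thus finitely many cluster products, and one separation constant serves them all.
  let N : Multiset (Fin d → ℤ) := r • hball.toFinset.val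
  let prodOf : Multiset (Fin d → ℤ) → C(G, ℂ) := fun v => (v.map fun l => actMap A l f).prod
  have hfin : (prodOf '' Set.Iic N).Finite := (Set.finite_Iic N).image _
  have hmem : ∀ h ∈ prodOf '' Set.Iic N, h ∈ trigPoly G := by
    rintro _ ⟨v, -, rfl⟩
    refine Subalgebra.multiset_prod_mem _ fun u hu => ?_
    obtain ⟨l, -, rfl⟩ := Multiset.mem_map.1 hu
    exact actMap_mem_trigPoly A l hf
  obtain ⟨Λ, hΛ⟩ := exists_common_finset_of_mem_trigPoly hfin hmem
  obtain ⟨M, hM⟩ := exists_separation_integral_prod_finset (A := A) hmix Λ r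
  refine ⟨M, fun cl C hC hsep T hT hTC hTD => ?_⟩
  -- The product over a cluster, moved to the origin; acting by `c` restores it.
  let h : (Fin d → ℤ) → C(G, ℂ) := fun c => prodOf ((T.filter fun l => cl l = c).map fun l => l - c)
  have hact : ∀ c, actMap A c (h c) =
      ((T.filter fun l => cl l = c).map fun l => actMap A l f).prod := by
    intro c
    simp only [h, prodOf]
    rw [map_multiset_prod, Multiset.map_map, Multiset.map_map]
    congr 1
    refine Multiset.map_congr rfl fun l _ => ?_
    simp only [Function.comp]
    rw [actMap_actMap A hA, sub_add_cancel]
  have hh : ∀ c ∈ C, ∃ a : PontryaginDual G → ℂ, h c = ∑ χ ∈ Λ, a χ • charMap χ := by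
    intro c _
    refine hΛ _ ⟨_, ?_, rfl⟩
    rw [Set.mem_Iic, Multiset.le_iff_count]
    intro v
    rw [Multiset.count_nsmul]
    by_cases hv : v ∈ (T.filter fun l => cl l = c).map fun l => l - c
    · have h1 : v ∈ hball.toFinset.val := by
        obtain ⟨l, hl, rfl⟩ := Multiset.mem_map.1 hv
        obtain ⟨hl1, rfl⟩ := Multiset.mem_filter.1 hl
        rw [Finset.mem_val, Set.Finite.mem_toFinset, mem_closedBall_zero_iff]
        exact hTD l hl1
      calc Multiset.count v ((T.filter fun l => cl l = c).map fun l => l - c)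
          ≤ Multiset.card ((T.filter fun l => cl l = c).map fun l => l - c) :=
            Multiset.count_le_card _ _
        _ ≤ r := by
            rw [Multiset.card_map]
            exact (Multiset.card_le_card (Multiset.filter_le _ _)).trans hT
        _ ≤ r * Multiset.count v hball.toFinset.val :=
            Nat.le_mul_of_pos_right _ (Multiset.count_pos.2 h1)
    · rw [Multiset.count_eq_zero_of_notMem hv]; exact Nat.zero_le _
  have h1 := hM C hC hsep h hh
  simp only [hact] at h1
  rw [prod_filter_fiber _ _ _ _ hTC] at h1
  rw [jointMoment, h1]
  refine Finset.prod_congr rfl fun c _ => ?_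
  rw [jointMoment, ← hact, integral_actMap]

/-- Joint cumulants vanish when some index is far from the distinguished one. -/
theorem exists_radius_jointCumulant_eq_zero (hA : ∀ k l x, A (k + l) x = A k (A l x))
    (hmix : IsMixingOfAllOrders μ (fun l x => A l x)) (hf : f ∈ trigPoly G) (r : ℕ) :
    ∃ D : ℝ, ∀ a s, Multiset.card s ≤ r → (∃ x ∈ s, D < ‖x - a‖) →
      jointCumulant (jointMoment μ A f) a s = 0 := by
  classical
  -- Induction on the number of clusters, `cl` assigning a centre within `D` to each index. If the
  -- centres are well separated, moments factorize and the cumulant vanishes. Otherwise two close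
  -- centres merge, giving fewer clusters of larger radius. The start is one cluster of radius 0 per
  -- distinct index, hence `r + 1`.
  suffices key : ∀ (k : ℕ) (D : ℝ), ∃ D' : ℝ, ∀ a s, Multiset.card s ≤ r →
      ∀ cl : (Fin d → ℤ) → (Fin d → ℤ), (∀ l ∈ a ::ₘ s, ‖l - cl l‖ ≤ D) →
      ((a ::ₘ s).toFinset.image cl).card ≤ k → (∃ x ∈ s, D' < ‖x - a‖) →
      jointCumulant (jointMoment μ A f) a s = 0 by
    obtain ⟨D', hD'⟩ := key (r + 1) 0
    refine ⟨D', fun a s hs hx => hD' a s hs id (by simp) ?_ hx⟩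
    refine Finset.card_image_le.trans ((Multiset.toFinset_card_le _).trans ?_)
    rw [Multiset.card_cons]; omega
  intro k
  induction k with
  | zero =>
    intro D
    refine ⟨0, fun a s _ cl _ hk _ => ?_⟩
    have : cl a ∈ (a ::ₘ s).toFinset.image cl :=
      Finset.mem_image_of_mem _ (Multiset.mem_toFinset.2 (Multiset.mem_cons_self _ _))
    exact absurd (Finset.card_pos.2 ⟨_, this⟩) (by omega)
  | succ k ih =>
    intro D
    obtain ⟨M, hM⟩ := exists_separation_jointMoment hA hmix hf (max (k + 1) (r + 1)) D
    obtain ⟨D₁, hD₁⟩ := ih (D + |M|)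
    -- Beyond `2 * D` from `a`, an index cannot share its centre, so the splitting along the cluster
    -- of `a` is nontrivial.
    refine ⟨max (2 * D) D₁, fun a s hs cl hcl hk hx => ?_⟩
    obtain ⟨x, hxs, hxD⟩ := hx
    set C := (a ::ₘ s).toFinset.image cl with hC
    have hmemC : ∀ l ∈ a ::ₘ s, cl l ∈ C := fun l hl =>
      Finset.mem_image_of_mem _ (Multiset.mem_toFinset.2 hl)
    have haC := hmemC a (Multiset.mem_cons_self _ _)
    by_cases hsep : ∀ c ∈ C, ∀ c' ∈ C, c ≠ c' → M ≤ ‖c - c'‖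
    · have hfact : ∀ t ≤ a ::ₘ s, jointMoment μ A f t =
          ∏ c ∈ C, jointMoment μ A f (t.filter fun l => cl l = c) := by
        intro t ht
        refine hM cl C (hk.trans (le_max_left _ _)) hsep t ?_
          (fun l hl => hmemC l (Multiset.mem_of_le ht hl))
          (fun l hl => hcl l (Multiset.mem_of_le ht hl))
        refine (Multiset.card_le_card ht).trans (le_trans ?_ (le_max_right _ _))
        rw [Multiset.card_cons]; omega
      refine jointCumulant_eq_zero _ (jointMoment_zero μ A f) (fun l => cl l = cl a) a rfl s ?_ ?_
      · intro t ht
        rw [hfact t ht, hfact (t.filter fun x => ¬ cl x = cl a) ((Multiset.filter_le _ _).trans ht),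
          ← Finset.mul_prod_erase _ _ haC, ← Finset.mul_prod_erase _ _ haC]
        congr 1
        have e1 : ((t.filter fun x => ¬ cl x = cl a).filter fun l => cl l = cl a) = 0 := by
          refine Multiset.filter_eq_nil.2 fun y hy => (Multiset.mem_filter.1 hy).2
        rw [e1, jointMoment_zero, one_mul]
        refine Finset.prod_congr rfl fun c hc => ?_
        congr 1
        rw [Multiset.filter_filter]
        refine Multiset.filter_congr fun y _ => ?_
        have := Finset.ne_of_mem_erase hc
        constructor
        · intro h; exact ⟨h, h ▸ this⟩
        · exact fun h => h.1
      · refine ⟨x, hxs, fun h => ?_⟩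
        have h1 := hcl x (Multiset.mem_cons_of_mem hxs)
        have h2 := hcl a (Multiset.mem_cons_self _ _)
        have h3 : ‖x - a‖ ≤ ‖x - cl x‖ + ‖a - cl a‖ := by
          rw [h]
          calc ‖x - a‖ = ‖(x - cl a) - (a - cl a)‖ := by rw [sub_sub_sub_cancel_right]
            _ ≤ _ := norm_sub_le _ _
        have := (le_max_left (2 * D) D₁).trans_lt hxD
        linarith
    · push Not at hsep
      obtain ⟨c, hc, c', hc', hne, hlt⟩ := hsep
      let cl' : (Fin d → ℤ) → (Fin d → ℤ) := fun l => if cl l = c then c' else cl l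
      refine hD₁ a s hs cl' ?_ ?_ ⟨x, hxs, (le_max_right _ _).trans_lt hxD⟩
      · intro l hl
        have h1 := hcl l hl
        simp only [cl']
        split_ifs with h
        · calc ‖l - c'‖ = ‖(l - cl l) + (c - c')‖ := by rw [h, sub_add_sub_cancel]
            _ ≤ ‖l - cl l‖ + ‖c - c'‖ := norm_add_le _ _
            _ ≤ D + |M| := add_le_add h1 (hlt.le.trans (le_abs_self M))
        · linarith [abs_nonneg M]
      · have hsub : (a ::ₘ s).toFinset.image cl' ⊆ C.erase c := by
          intro y hy
          obtain ⟨l, hl, rfl⟩ := Finset.mem_image.1 hy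
          have hl' := hmemC l (Multiset.mem_toFinset.1 hl)
          simp only [cl']
          split_ifs with h
          · exact Finset.mem_erase.2 ⟨hne.symm, hc'⟩
          · exact Finset.mem_erase.2 ⟨h, hl'⟩
        have := Finset.card_le_card hsub
        rw [Finset.card_erase_of_mem hc] at this
        omega

end Clusters

/-! ### Cumulants of weighted sums -/

section CumulantBound

variable {d : ℕ} {G : Type*} [CommGroup G] [TopologicalSpace G]
    [IsTopologicalGroup G] [CompactSpace G] [MeasurableSpace G] [BorelSpace G]
    (μ : Measure G) [μ.IsHaarMeasure] [IsProbabilityMeasure μ]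
    (A : (Fin d → ℤ) → (G ≃ₜ* G)) (f : C(G, ℂ)) (F : Finset (Fin d → ℤ)) (w : (Fin d → ℤ) → ℂ)

theorem wordSum_linear_prod {ι R : Type*} [CommRing R] [Algebra ℂ R] (F : Finset ι) (w : ι → ℂ)
    (X : ι → R) (Λ : R →ₗ[ℂ] ℂ) (r : ℕ) (Z : R) :
    wordSum F w r (fun s => Λ (Z * (s.map X).prod)) = Λ (Z * (∑ x ∈ F, w x • X x) ^ r) := by
  induction r generalizing Z with
  | zero => simp [wordSum]
  | succ r ih =>
    have h1 : ∀ x, (fun s : Multiset ι => Λ (Z * ((x ::ₘ s).map X).prod)) =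
        fun s => Λ ((Z * X x) * (s.map X).prod) := fun x => funext fun s => by
      rw [Multiset.map_cons, Multiset.prod_cons, mul_assoc]
    simp only [wordSum, h1, ih]
    rw [pow_succ', ← mul_assoc, Finset.mul_sum, Finset.sum_mul, map_sum]
    refine Finset.sum_congr rfl fun x _ => ?_
    rw [mul_smul_comm, smul_mul_assoc, map_smul, smul_eq_mul]

/-- The weighted sum `∑_{l ∈ F} w_l f ∘ A^l`. -/
noncomputable def weightedSum : C(G, ℂ) := ∑ l ∈ F, w l • actMap A l f

/-- The cumulant of order `r + 1` of the weighted sum. -/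
noncomputable def sumCumulant (r : ℕ) : ℂ :=
  ∑ a ∈ F, w a * wordSum F w r (jointCumulant (jointMoment μ A f) a)

theorem integral_mul_weightedSum_pow (Z : C(G, ℂ)) (r : ℕ) :
    ∫ x, Z x * weightedSum A f F w x ^ r ∂μ =
      wordSum F w r fun s => ∫ x, (Z * (s.map fun l => actMap A l f).prod) x ∂μ := by
  have h := wordSum_linear_prod F w (fun l => actMap A l f) (integralMulCLM μ 1).toLinearMap r Z
  simp only [ContinuousLinearMap.coe_coe, integralMulCLM_apply, ContinuousMap.one_apply,
    mul_one] at h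
  rw [h]
  rfl

theorem integral_weightedSum_pow (r : ℕ) :
    ∫ x, weightedSum A f F w x ^ r ∂μ = wordSum F w r (jointMoment μ A f) := by
  have h := integral_mul_weightedSum_pow μ A f F w 1 r
  simp only [ContinuousMap.one_apply, one_mul] at h
  exact h

/-- The moment–cumulant recursion of one variable, obtained by summing the joint recursion over all
words. -/
theorem integral_weightedSum_pow_succ (r : ℕ) :
    ∫ x, weightedSum A f F w x ^ (r + 1) ∂μ =
      ∑ p ∈ Finset.HasAntidiagonal.antidiagonal r,
        (r.choose p.1 : ℂ) * (sumCumulant μ A f F w p.1 * ∫ x, weightedSum A f F w x ^ p.2 ∂μ) := by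
  simp only [integral_weightedSum_pow]
  rw [wordSum]
  have h1 : ∀ a, (fun s => jointMoment μ A f (a ::ₘ s)) =
      splitMul (jointCumulant (jointMoment μ A f) a) (jointMoment μ A f) := fun a =>
    funext fun s => (splitMul_jointCumulant _ (jointMoment_zero μ A f) a s).symm
  simp only [h1, wordSum_splitMul, Finset.mul_sum, sumCumulant, Finset.sum_mul]
  rw [Finset.sum_comm]
  refine Finset.sum_congr rfl fun p _ => Finset.sum_congr rfl fun a _ => ?_
  ring

theorem sumCumulant_zero [μ.Regular] (h0 : ∫ x, f x ∂μ = 0) : sumCumulant μ A f F w 0 = 0 := by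
  refine Finset.sum_eq_zero fun a _ => ?_
  have : jointCumulant (jointMoment μ A f) a 0 = 0 := by
    rw [jointCumulant_eq]
    simp [jointMoment, h0, integral_actMap A μ a f, ← actMap_apply, -actMap_apply]
  rw [wordSum, this, mul_zero]

variable {A f μ} [T2Space G] [μ.Regular]

/-- Once the first index `a` is fixed, each of the `r` others ranges over at most `N` points near
`a`, contributing `(N * W) ^ r`; only the sum over `a` is unrestricted. The constant depends on
neither `F` nor `w`. -/
theorem exists_norm_sumCumulant_le (hA : ∀ k l x, A (k + l) x = A k (A l x))
    (hmix : IsMixingOfAllOrders μ (fun l x => A l x)) (hf : f ∈ trigPoly G) (r : ℕ) :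
    ∃ K : ℝ, 0 ≤ K ∧ ∀ (F : Finset (Fin d → ℤ)) (w : (Fin d → ℤ) → ℂ) (W : ℝ),
      (∀ l, ‖w l‖ ≤ W) → ‖sumCumulant μ A f F w r‖ ≤ K * (W ^ r * ∑ l ∈ F, ‖w l‖) := by
  classical
  obtain ⟨D, hD⟩ := exists_radius_jointCumulant_eq_zero hA hmix hf r
  obtain ⟨K₀, hK₀⟩ := exists_norm_jointCumulant_le (jointMoment μ A f) (fun j => ‖f‖ ^ j)
    (norm_jointMoment_le μ A f) r
  have hball : (Metric.closedBall (0 : Fin d → ℤ) D).Finite :=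
    (isCompact_closedBall _ _).finite_of_discrete
  set N := hball.toFinset.card
  refine ⟨|K₀| * N ^ r, by positivity, fun F w W hW => ?_⟩
  have hW0 : 0 ≤ W := (norm_nonneg _).trans (hW 0)
  have hterm : ∀ a ∈ F, ‖w a * wordSum F w r (jointCumulant (jointMoment μ A f) a)‖ ≤
      |K₀| * N ^ r * W ^ r * ‖w a‖ := by
    intro a _
    rw [norm_mul, mul_comm]
    refine mul_le_mul_of_nonneg_right ?_ (norm_nonneg _)
    have h1 := norm_wordSum_le F w r (jointCumulant (jointMoment μ A f) a) (fun x => ‖x - a‖ ≤ D)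
      (abs_nonneg K₀) (fun s hs => (hK₀ a s hs.le).trans (le_abs_self _))
      (fun s hs hx => hD a s hs.le (by simpa using hx))
    refine h1.trans ?_
    rw [mul_assoc, ← mul_pow]
    refine mul_le_mul_of_nonneg_left (pow_le_pow_left₀ (by positivity) ?_ r) (abs_nonneg _)
    refine (Finset.sum_le_card_nsmul _ _ W fun x _ => hW x).trans ?_
    rw [nsmul_eq_mul]
    refine mul_le_mul_of_nonneg_right (Nat.cast_le.2 ?_) hW0
    refine Finset.card_le_card_of_injOn (fun x => x - a) (fun x hx => ?_)
      fun x _ y _ h => sub_left_injective h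
    have := (Finset.mem_filter.1 hx).2
    simpa using this
  refine (norm_sum_le_of_le _ hterm).trans (le_of_eq ?_)
  rw [← Finset.mul_sum]
  ring

end CumulantBound

/-! ### Fourier coefficients on the torus -/

section Torus

instance isProbabilityMeasure_torusHaar (d : ℕ) : IsProbabilityMeasure (torusHaar d) := by
  unfold torusHaar; infer_instance

theorem integral_mFourier {d : ℕ} (l : Fin d → ℤ) :
    ∫ t, UnitAddTorus.mFourier l t ∂torusHaar d = if l = 0 then 1 else 0 := by
  split_ifs with h
  · subst h; simp [UnitAddTorus.mFourier_zero]
  · obtain ⟨i, hi⟩ := Function.ne_iff.1 h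
    simp only [UnitAddTorus.mFourier, ContinuousMap.coe_mk, torusHaar]
    rw [integral_fintype_prod_eq_prod (f := fun i (x : UnitAddCircle) => fourier (l i) x)]
    refine Finset.prod_eq_zero (Finset.mem_univ i) ?_
    exact integral_eq_zero_of_add_right_eq_neg (fourier_add_half_inv_index hi one_pos)

theorem integral_conj_mFourier_mul_tsum {d : ℕ} {γ : (Fin d → ℤ) → ℂ} {Φ : C(UnitAddTorus (Fin d), ℂ)}
    (h : HasSum (fun l => γ l • UnitAddTorus.mFourier l) Φ) (l : Fin d → ℤ) :
    ∫ t, (starRingEnd ℂ) (UnitAddTorus.mFourier l t) * Φ t ∂torusHaar d = γ l := by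
  classical
  have h1 := h.mapL (integralMulCLM (torusHaar d) (UnitAddTorus.mFourier (-l)))
  have h2 : ∀ k, integralMulCLM (torusHaar d) (UnitAddTorus.mFourier (-l))
      (γ k • UnitAddTorus.mFourier k) = if k = l then γ l else 0 := by
    intro k
    rw [map_smul, integralMulCLM_apply]
    simp only [← UnitAddTorus.mFourier_add, integral_mFourier, add_neg_eq_zero]
    split_ifs with hk <;> simp [hk]
  simp only [h2] at h1
  rw [(hasSum_ite_eq _ _).unique h1, integralMulCLM_apply]
  simp only [UnitAddTorus.mFourier_neg, mul_comm]

end Torus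

/-! ### Freeness of the dual action -/

section FreeOrbits

variable {d : ℕ} {G : Type*} [CommGroup G] [TopologicalSpace G]
    [IsTopologicalGroup G] [CompactSpace G] [MeasurableSpace G] [BorelSpace G]
    {μ : Measure G} [μ.IsHaarMeasure] [IsProbabilityMeasure μ]
    {A : (Fin d → ℤ) → (G ≃ₜ* G)}

theorem action_zero {ι : Type*} [AddMonoid ι] {A : ι → (G ≃ₜ* G)}
    (hA : ∀ k l x, A (k + l) x = A k (A l x)) (x : G) : A 0 x = x := by
  have := hA 0 0 x
  rw [add_zero] at this
  exact ((A 0).injective this).symm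

/-- For a mixing action, the dual action is free on nontrivial characters. -/
theorem actChar_injective (hA : ∀ k l x, A (k + l) x = A k (A l x))
    (hmix : IsMixingOfAllOrders μ (fun l x => A l x)) {χ : PontryaginDual G} (hχ : χ ≠ 1) :
    Function.Injective fun l => actChar A l χ := by
  intro k l hkl
  by_contra hne
  set v := k - l with hv
  have hv0 : v ≠ 0 := sub_ne_zero.2 hne
  have hfix : ∀ x, χ (A v x) = χ x := by
    intro x
    obtain ⟨y, rfl⟩ := (A l).surjective x
    rw [← hA, hv, sub_add_cancel]
    exact DFunLike.congr_fun hkl y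
  have hfixm : ∀ (m : ℕ) x, χ (A (m • v) x) = χ x := by
    intro m
    induction m with
    | zero => intro x; rw [zero_smul, action_zero hA]
    | succ m ih => intro x; rw [succ_nsmul, hA, ih, hfix]
  -- A nonzero period `v` of `χ` makes the product of `χ` at `m • v` and `χ⁻¹` at 0 trivial for
  -- every `m`, although these indices are arbitrarily far apart.
  obtain ⟨M, hM⟩ := exists_separation_prod_char_ne_one (A := A) hmix le_rfl ![χ, χ⁻¹] ⟨0, hχ⟩
  obtain ⟨i, hi⟩ := Function.ne_iff.1 hv0
  obtain ⟨m, hm⟩ := exists_nat_ge M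
  have hnorm : M ≤ ‖m • v‖ := by
    refine hm.trans (le_trans ?_ (norm_le_pi_norm (m • v) i))
    rw [Pi.smul_apply, nsmul_eq_mul, norm_mul, Int.norm_natCast]
    refine le_mul_of_one_le_right (Nat.cast_nonneg m) ?_
    rw [Int.norm_eq_abs]
    exact_mod_cast Int.one_le_abs hi
  refine hM ![m • v, 0] (fun i j hij => ?_) ?_
  · fin_cases i <;> fin_cases j <;> simp_all
  · rw [Fin.prod_univ_two]
    refine PontryaginDual.ext fun x => ?_
    change χ (A (m • v) x) * (χ (A 0 x))⁻¹ = 1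
    rw [hfixm, action_zero hA, mul_inv_cancel]

end FreeOrbits

/-! ### Correlations -/

section Correlation

variable {d : ℕ} {G : Type*} [CommGroup G] [TopologicalSpace G]
    [IsTopologicalGroup G] [CompactSpace G] [T2Space G] [MeasurableSpace G] [BorelSpace G]
    {μ : Measure G} [μ.IsHaarMeasure] [IsProbabilityMeasure μ] [μ.Regular]
    {A : (Fin d → ℤ) → (G ≃ₜ* G)}

/-- A real continuous function as a complex one. -/
def complexify {X : Type*} [TopologicalSpace X] (g : C(X, ℝ)) : C(X, ℂ) :=
  ⟨fun x => (g x : ℂ), by fun_prop⟩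

@[simp] theorem complexify_apply {X : Type*} [TopologicalSpace X] (g : C(X, ℝ)) (x : X) :
    complexify g x = (g x : ℂ) := rfl

theorem charFourierCoeff_congr {f g : G → ℝ} (h : f =ᵐ[μ] g) :
    charFourierCoeff μ f = charFourierCoeff μ g := by
  funext χ
  refine integral_congr_ae ?_
  filter_upwards [h] with x hx
  rw [hx]

theorem charFourierCoeff_one (f : G → ℝ) :
    charFourierCoeff μ f 1 = ((∫ x, f x ∂μ : ℝ) : ℂ) := by
  rw [charFourierCoeff, ← integral_complex_ofReal]
  simp

/-- Functions in `AC₀` have a continuous version, which is the sum of its Fourier series. -/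
theorem MemAC0.exists_continuous_version {f : G → ℝ} (hf : MemAC0 μ f) :
    ∃ g : C(G, ℝ), f =ᵐ[μ] g ∧ MemAC0 μ g ∧
      HasSum (fun χ : PontryaginDual G => charFourierCoeff μ g χ • charMap χ) (complexify g) := by
  obtain ⟨F, hF, hae⟩ := exists_hasSum_charMap_of_summable μ hf.integrable hf.summable
  let g : C(G, ℝ) := ⟨fun x => (F x).re, by fun_prop⟩
  have hfg : f =ᵐ[μ] g := by
    filter_upwards [hae] with x hx
    simp [g, ← hx]
  have hgF : complexify g = F := by
    refine DFunLike.ext' ((Continuous.ae_eq_iff_eq μ (complexify g).continuous F.continuous).1 ?_)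
    filter_upwards [hae] with x hx
    simp [g, ← hx]
  have hc := charFourierCoeff_congr hfg
  refine ⟨g, hfg, ⟨hf.integrable.congr hfg, ?_, ?_⟩, ?_⟩
  · rw [← integral_congr_ae hfg, hf.integral_eq_zero]
  · rw [← hc]; exact hf.summable
  · rw [← hc, hgF]; exact hF

/-- Expanding one factor, the correlation at `l` is the sum over `χ` of `c χ * c (actChar A l χ)⁻¹`.
Since `c 1 = 0` and other orbits are free, summing absolute values over `l` and `χ` gives at most
`(∑ ‖c χ‖)²`. -/
theorem summable_correlation (hA : ∀ k l x, A (k + l) x = A k (A l x))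
    (hmix : IsMixingOfAllOrders μ (fun l x => A l x)) {g : C(G, ℝ)} (hg : MemAC0 μ g)
    (hsum : HasSum (fun χ : PontryaginDual G => charFourierCoeff μ g χ • charMap χ)
      (complexify g)) :
    Summable fun l => ∫ x, g (A l x) * g x ∂μ := by
  set c := charFourierCoeff μ g with hc
  have hc1 : c 1 = 0 := by rw [hc, charFourierCoeff_one, hg.integral_eq_zero, Complex.ofReal_zero]
  have hcorr : ∀ l, HasSum (fun χ => c χ * c (actChar A l χ)⁻¹)
      ((∫ x, g (A l x) * g x ∂μ : ℝ) : ℂ) := by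
    intro l
    have h1 := (hsum.mapL (integralMulCLM μ (actMap A (-l) (complexify g))))
    have h2 : ∀ χ, integralMulCLM μ (actMap A (-l) (complexify g)) (c χ • charMap χ) =
        c χ * c (actChar A l χ)⁻¹ := by
      intro χ
      rw [map_smul, smul_eq_mul, integralMulCLM_apply]
      refine congrArg (c χ * ·) ((integral_actMap A μ l
        (charMap χ * actMap A (-l) (complexify g))).symm.trans ?_)
      rw [hc, charFourierCoeff]
      congr 1; ext x
      simp [conj_char_apply, ← hA, action_zero hA]
    simp only [h2] at h1
    convert! h1 using 1
    rw [integralMulCLM_apply, ← integral_complex_ofReal]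
    refine Eq.trans ?_ (integral_actMap A μ l (complexify g * actMap A (-l) (complexify g)))
    congr 1; ext x
    simp [← hA, action_zero hA]
  have hprod : Summable fun p : PontryaginDual G × (Fin d → ℤ) =>
      ‖c p.1‖ * ‖c (actChar A p.2 p.1)⁻¹‖ := by
    have hrow : ∀ χ, Summable fun l => ‖c χ‖ * ‖c (actChar A l χ)⁻¹‖ := by
      intro χ
      by_cases hχ : χ = 1
      · simp [hχ, hc1, summable_zero]
      · exact (hg.summable.comp_injective
          (inv_injective.comp (actChar_injective hA hmix hχ))).mul_left _
    rw [summable_prod_of_nonneg fun p => by positivity]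
    refine ⟨hrow, Summable.of_nonneg_of_le (fun χ => tsum_nonneg fun l => by positivity)
      (fun χ => ?_) (hg.summable.mul_right (∑' ψ, ‖c ψ‖))⟩
    by_cases hχ : χ = 1
    · simp [hχ, ← hc, hc1]
    · simp only
      rw [tsum_mul_left]
      refine mul_le_mul_of_nonneg_left ?_ (norm_nonneg _)
      have hinj := inv_injective.comp (actChar_injective hA hmix hχ)
      exact tsum_comp_le_tsum_of_inj hg.summable (fun _ => norm_nonneg _) hinj
  have h3 : Summable fun l => ∑' χ, ‖c χ‖ * ‖c (actChar A l χ)⁻¹‖ := hprod.prod_symm.prod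
  refine Summable.of_norm_bounded h3 fun l => ?_
  rw [← Complex.norm_real, ← (hcorr l).tsum_eq]
  refine (norm_tsum_le_tsum_norm ?_).trans (le_of_eq ?_)
  · simpa only [norm_mul, Prod.swap] using hprod.prod_symm.prod_factor l
  · simp only [norm_mul]

/-- The Fourier property of spectral densities, tested against squares of trigonometric
polynomials. -/
theorem integral_density_mul_trig (hA : ∀ k l x, A (k + l) x = A k (A l x)) {g : C(G, ℝ)}
    {φ : C(UnitAddTorus (Fin d), ℝ)}
    (hφ : ∀ l : Fin d → ℤ, ∫ t, (starRingEnd ℂ) (UnitAddTorus.mFourier l t) * (φ t : ℂ) ∂torusHaar d =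
      ((∫ x, g (A l x) * g x ∂μ : ℝ) : ℂ))
    (F : Finset (Fin d → ℤ)) (p : (Fin d → ℤ) → ℂ) :
    ∫ t, (φ t : ℂ) * ((∑ k ∈ F, p k • UnitAddTorus.mFourier k) *
      star (∑ k ∈ F, p k • UnitAddTorus.mFourier k) : C(UnitAddTorus (Fin d), ℂ)) t ∂torusHaar d =
    ∫ x, (weightedSum A (complexify g) F p * star (weightedSum A (complexify g) F p)) x ∂μ := by
  have hL : ∀ u : C(UnitAddTorus (Fin d), ℂ), ∫ t, (φ t : ℂ) * u t ∂torusHaar d =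
      integralMulCLM (torusHaar d) (complexify φ) u := fun u => by
    simp [integralMulCLM_apply, mul_comm]
  have hR : ∀ u : C(G, ℂ), ∫ x, u x ∂μ = integralMulCLM μ 1 u := fun u => by
    simp [integralMulCLM_apply]
  rw [hL, hR, weightedSum, star_sum, star_sum, Finset.sum_mul_sum, Finset.sum_mul_sum, map_sum,
    map_sum]
  refine Finset.sum_congr rfl fun k _ => ?_
  rw [map_sum, map_sum]
  refine Finset.sum_congr rfl fun j _ => ?_
  rw [star_smul, star_smul, smul_mul_smul_comm, smul_mul_smul_comm, map_smul, map_smul]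
  congr 1
  -- Invariance of `μ` reduces the pair `k, j` to the correlation at `j - k`.
  rw [← hL, ← hR, ← integral_actMap A μ (-k)]
  have h1 := hφ (j - k)
  rw [← integral_complex_ofReal] at h1
  refine Eq.trans ?_ (h1.trans ?_)
  · congr 1; ext t
    rw [ContinuousMap.mul_apply, ContinuousMap.star_apply, RCLike.star_def,
      ← UnitAddTorus.mFourier_neg, ← UnitAddTorus.mFourier_neg, ← UnitAddTorus.mFourier_add, mul_comm,
      neg_sub, sub_eq_add_neg]
  · congr 1; ext x
    simp [← hA, action_zero hA, mul_comm, sub_eq_add_neg]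

end Correlation

/-! ### The continuous spectral density and the variance -/

section Density

variable {d : ℕ} {G : Type*} [CommGroup G] [TopologicalSpace G]
    [IsTopologicalGroup G] [CompactSpace G] [T2Space G] [MeasurableSpace G] [BorelSpace G]
    {μ : Measure G} [μ.IsHaarMeasure] [IsProbabilityMeasure μ] [μ.Regular]
    {A : (Fin d → ℤ) → (G ≃ₜ* G)}

theorem weightedSum_mul_star_integral (f : C(G, ℂ)) (F : Finset (Fin d → ℤ)) (p : (Fin d → ℤ) → ℂ) :
    ∫ x, (weightedSum A f F p * star (weightedSum A f F p)) x ∂μ =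
      ((∫ x, ‖weightedSum A f F p x‖ ^ 2 ∂μ : ℝ) : ℂ) := by
  rw [← integral_complex_ofReal]
  simp [Complex.mul_conj, Complex.normSq_eq_norm_sq]

/-- The integral of `φ |P|²` is a squared `L²` norm for trigonometric `P`, hence nonnegative for
every continuous `P` by density. Taking for `P` the negative part of `φ` forces that part to vanish
almost everywhere. -/
theorem density_nonneg (hA : ∀ k l x, A (k + l) x = A k (A l x)) {g : C(G, ℝ)}
    {φ : C(UnitAddTorus (Fin d), ℝ)}
    (hφ : ∀ l : Fin d → ℤ, ∫ t, (starRingEnd ℂ) (UnitAddTorus.mFourier l t) * (φ t : ℂ) ∂torusHaar d =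
      ((∫ x, g (A l x) * g x ∂μ : ℝ) : ℂ)) : 0 ≤ᵐ[torusHaar d] φ := by
  let Q : C(UnitAddTorus (Fin d), ℂ) → ℝ := fun P =>
    (integralMulCLM (torusHaar d) (complexify φ) (P * star P)).re
  have hQc : Continuous Q := Complex.continuous_re.comp
    ((integralMulCLM (torusHaar d) (complexify φ)).continuous.comp (continuous_id.mul continuous_star))
  have hclosed : IsClosed {P | 0 ≤ Q P} := isClosed_le continuous_const hQc
  have hspan : ∀ P ∈ Submodule.span ℂ (Set.range (UnitAddTorus.mFourier (d := Fin d))), 0 ≤ Q P := by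
    intro P hP
    obtain ⟨c, rfl⟩ := Finsupp.mem_span_range_iff_exists_finsupp.1 hP
    have h := integral_density_mul_trig (μ := μ) hA hφ c.support c
    rw [weightedSum_mul_star_integral] at h
    have h2 : Q (c.sum fun i a => a • UnitAddTorus.mFourier i) =
        ∫ x, ‖weightedSum A (complexify g) c.support c x‖ ^ 2 ∂μ := by
      rw [← Complex.ofReal_re (∫ x, ‖weightedSum A (complexify g) c.support c x‖ ^ 2 ∂μ), ← h]
      simp only [Q, integralMulCLM_apply, Finsupp.sum, complexify_apply, mul_comm]
    rw [h2]
    exact integral_nonneg fun x => by positivity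
  have hall : ∀ P, 0 ≤ Q P := by
    intro P
    have hP : P ∈ closure (Submodule.span ℂ (Set.range (UnitAddTorus.mFourier (d := Fin d))) : Set _) := by
      rw [← Submodule.topologicalClosure_coe, UnitAddTorus.span_mFourier_closure_eq_top]
      exact Set.mem_univ _
    exact closure_minimal hspan hclosed hP
  let ψ : C(UnitAddTorus (Fin d), ℝ) := ⟨fun t => max (-φ t) 0, by fun_prop⟩
  have h1 := hall (complexify ψ)
  have h2 : Q (complexify ψ) = ∫ t, φ t * ψ t ^ 2 ∂torusHaar d := by
    simp only [Q, integralMulCLM_apply]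
    rw [← Complex.ofReal_re (∫ t, φ t * ψ t ^ 2 ∂torusHaar d), ← integral_complex_ofReal]
    congr 2; ext t
    simp only [ContinuousMap.mul_apply, ContinuousMap.star_apply, complexify_apply, RCLike.star_def,
      Complex.conj_ofReal]
    push_cast
    ring
  have h3 : ∀ t, φ t * ψ t ^ 2 ≤ 0 := by
    intro t
    rcases le_total (φ t) 0 with h | h
    · exact mul_nonpos_of_nonpos_of_nonneg h (sq_nonneg _)
    · have : ψ t = 0 := max_eq_right (by linarith)
      simp [this]
  have hint : Integrable (fun t => -(φ t * ψ t ^ 2)) (torusHaar d) :=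
    integrable_continuousMap (torusHaar d) (-(φ * ψ ^ 2))
  have h4 : ∫ t, -(φ t * ψ t ^ 2) ∂torusHaar d = 0 := by
    refine le_antisymm ?_ (integral_nonneg fun t => neg_nonneg.2 (h3 t))
    rw [integral_neg, ← h2]
    linarith
  rw [integral_eq_zero_iff_of_nonneg (fun t => neg_nonneg.2 (h3 t)) hint] at h4
  filter_upwards [h4] with t ht
  by_contra hneg
  have hlt : φ t < 0 := not_le.1 hneg
  have hψ : ψ t = -φ t := max_eq_left (by linarith)
  have : -(φ t * ψ t ^ 2) = 0 := ht
  rw [hψ] at this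
  have h5 : φ t * (-φ t) ^ 2 ≠ 0 := mul_ne_zero hlt.ne (pow_ne_zero _ (by linarith [neg_pos.2 hlt]))
  exact h5 (by linarith)

theorem correlation_neg (hA : ∀ k l x, A (k + l) x = A k (A l x)) (g : C(G, ℝ)) (l : Fin d → ℤ) :
    ∫ x, g (A (-l) x) * g x ∂μ = ∫ x, g (A l x) * g x ∂μ := by
  rw [← (measurePreserving_continuousMulEquiv μ (A l)).integral_comp
    (A l).toHomeomorph.measurableEmbedding fun x => g (A (-l) x) * g x]
  congr 1; ext x
  rw [← hA, neg_add_cancel, action_zero hA, mul_comm]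

/-- The density is the uniformly convergent Fourier series of the correlations, real because they
are real and even in `l`. -/
theorem exists_continuous_density (hA : ∀ k l x, A (k + l) x = A k (A l x)) {g : C(G, ℝ)}
    (hs : Summable fun l => ∫ x, g (A l x) * g x ∂μ) :
    ∃ φ : C(UnitAddTorus (Fin d), ℝ), IsSpectralDensity μ (fun l x => A l x) g φ := by
  set γ : (Fin d → ℤ) → ℝ := fun l => ∫ x, g (A l x) * g x ∂μ with hγ
  have hsum : Summable fun l => (γ l : ℂ) • UnitAddTorus.mFourier (d := Fin d) l := by
    refine Summable.of_norm_bounded hs.norm fun l => ?_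
    rw [norm_smul, UnitAddTorus.mFourier_norm, mul_one, Complex.norm_real]
  obtain ⟨Φ, hΦ⟩ := hsum
  have hstar : star Φ = Φ := by
    have h1 := hΦ.star
    rw [← (Equiv.neg (Fin d → ℤ)).hasSum_iff] at h1
    refine h1.unique (hΦ.congr_fun fun l => ?_) |>.trans rfl
    ext t
    simp only [Function.comp, Equiv.neg_apply, star_smul, ContinuousMap.smul_apply,
      ContinuousMap.star_apply, RCLike.star_def, UnitAddTorus.mFourier_neg, Complex.conj_conj,
      Complex.conj_ofReal, hγ]
    rw [correlation_neg hA]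
  let φ : C(UnitAddTorus (Fin d), ℝ) := ⟨fun t => (Φ t).re, by fun_prop⟩
  have hφΦ : ∀ t, (φ t : ℂ) = Φ t := fun t =>
    Complex.conj_eq_iff_re.1 (DFunLike.congr_fun hstar t)
  have hfour : ∀ l : Fin d → ℤ, ∫ t, (starRingEnd ℂ) (UnitAddTorus.mFourier l t) * (φ t : ℂ)
      ∂torusHaar d = ((∫ x, g (A l x) * g x ∂μ : ℝ) : ℂ) := by
    intro l
    simp only [hφΦ]
    exact integral_conj_mFourier_mul_tsum hΦ l
  exact ⟨φ, integrable_continuousMap _ φ, density_nonneg hA hfour, hfour⟩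

theorem hasSum_smul_of_summable {E : Type*} [NormedAddCommGroup E] [NormedSpace ℂ E]
    [CompleteSpace E] {ι : Type*} {R : ι → ℝ} (hR : Summable R) {v : ι → E} {C : ℝ}
    (hv : ∀ l, ‖v l‖ ≤ C) : Summable fun l => (R l : ℂ) • v l :=
  Summable.of_norm_bounded (hR.norm.mul_right C) fun l => by
    rw [norm_smul, Complex.norm_real]
    exact mul_le_mul_of_nonneg_left (hv l) (norm_nonneg _)

theorem norm_actMap_le {ι : Type*} (A : ι → (G ≃ₜ* G)) (l : ι) (f : C(G, ℂ)) :
    ‖actMap A l f‖ ≤ ‖f‖ :=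
  (ContinuousMap.norm_le _ (norm_nonneg _)).2 fun x => f.norm_coe_le_norm _

/-- The variance of a weighted sum in terms of the spectral density. -/
theorem integral_sq_tsum_eq (hA : ∀ k l x, A (k + l) x = A k (A l x)) {g : C(G, ℝ)}
    {φ : C(UnitAddTorus (Fin d), ℝ)}
    (hφ : ∀ l : Fin d → ℤ, ∫ t, (starRingEnd ℂ) (UnitAddTorus.mFourier l t) * (φ t : ℂ) ∂torusHaar d =
      ((∫ x, g (A l x) * g x ∂μ : ℝ) : ℂ))
    {R : (Fin d → ℤ) → ℝ} (hR : Summable R) :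
    ∫ x, (∑' l, R l * g (A l x)) ^ 2 ∂μ =
      ∫ t, ‖∑' l, (R l : ℂ) * UnitAddTorus.mFourier l t‖ ^ 2 * φ t ∂torusHaar d := by
  have hP := (hasSum_smul_of_summable hR (v := UnitAddTorus.mFourier (d := Fin d)) (C := 1)
    fun l => UnitAddTorus.mFourier_norm.le).hasSum
  have hS := (hasSum_smul_of_summable hR (v := fun l => actMap A l (complexify g))
    fun l => norm_actMap_le A l _).hasSum
  set P := ∑' l, (R l : ℂ) • UnitAddTorus.mFourier (d := Fin d) l
  set S := ∑' l, (R l : ℂ) • actMap A l (complexify g)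
  have hPt : ∀ t, ∑' l, (R l : ℂ) * UnitAddTorus.mFourier l t = P t := fun t => by
    simpa using (hP.mapL (ContinuousMap.evalCLM ℂ t)).tsum_eq
  have hSx : ∀ x, ((∑' l, R l * g (A l x) : ℝ) : ℂ) = S x := fun x => by
    rw [Complex.ofReal_tsum]
    simpa using (hS.mapL (ContinuousMap.evalCLM ℂ x)).tsum_eq
  -- The identity for finite sums passes to the limit: both series converge uniformly and both
  -- quadratic forms are continuous for the sup norm.
  have h1 : Tendsto (fun F : Finset (Fin d → ℤ) => integralMulCLM (torusHaar d) (complexify φ)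
      ((∑ k ∈ F, (R k : ℂ) • UnitAddTorus.mFourier k) *
        star (∑ k ∈ F, (R k : ℂ) • UnitAddTorus.mFourier k))) atTop
      (𝓝 (integralMulCLM (torusHaar d) (complexify φ) (P * star P))) :=
    ((integralMulCLM (torusHaar d) (complexify φ)).continuous.comp
      (continuous_id.mul continuous_star)).continuousAt.tendsto.comp hP
  have h2 : Tendsto (fun F : Finset (Fin d → ℤ) => integralMulCLM μ 1
      ((∑ k ∈ F, (R k : ℂ) • actMap A k (complexify g)) *
        star (∑ k ∈ F, (R k : ℂ) • actMap A k (complexify g)))) atTop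
      (𝓝 (integralMulCLM μ 1 (S * star S))) :=
    ((integralMulCLM μ 1).continuous.comp
      (continuous_id.mul continuous_star)).continuousAt.tendsto.comp hS
  have h3 : ∀ F : Finset (Fin d → ℤ), integralMulCLM (torusHaar d) (complexify φ)
      ((∑ k ∈ F, (R k : ℂ) • UnitAddTorus.mFourier k) *
        star (∑ k ∈ F, (R k : ℂ) • UnitAddTorus.mFourier k)) = integralMulCLM μ 1
      ((∑ k ∈ F, (R k : ℂ) • actMap A k (complexify g)) *
        star (∑ k ∈ F, (R k : ℂ) • actMap A k (complexify g))) := by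
    intro F
    have := integral_density_mul_trig (μ := μ) hA hφ F fun l => (R l : ℂ)
    rw [integralMulCLM_apply, integralMulCLM_apply]
    simp only [complexify_apply, ContinuousMap.one_apply, mul_one, weightedSum] at this ⊢
    rw [← this]
    simp only [mul_comm]
  simp only [h3] at h1
  have h4 := tendsto_nhds_unique h2 h1
  apply Complex.ofReal_injective
  rw [← integral_complex_ofReal, ← integral_complex_ofReal]
  simp only [hPt, Complex.ofReal_pow, hSx, Complex.ofReal_mul]
  rw [integralMulCLM_apply, integralMulCLM_apply] at h4
  refine Eq.trans ?_ (h4.trans ?_)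
  · congr 1; ext x
    have hreal : (starRingEnd ℂ) (S x) = S x := by rw [← hSx, Complex.conj_ofReal]
    simp [hreal, sq]
  · congr 1; ext t
    simp [Complex.mul_conj, Complex.normSq_eq_norm_sq]

/-- The normalized variances converge to `ζ(φ)`. -/
theorem tendsto_normalized_variance (hA : ∀ k l x, A (k + l) x = A k (A l x)) {g : C(G, ℝ)}
    {φ : C(UnitAddTorus (Fin d), ℝ)}
    (hφ : ∀ l : Fin d → ℤ, ∫ t, (starRingEnd ℂ) (UnitAddTorus.mFourier l t) * (φ t : ℂ) ∂torusHaar d =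
      ((∫ x, g (A l x) * g x ∂μ : ℝ) : ℂ))
    {R : ℕ → (Fin d → ℤ) → ℝ} (hR : IsSummationSequence R)
    {ζ : Measure (UnitAddTorus (Fin d))} (hreg : IsRegularSummation R ζ) :
    Tendsto (fun n => ∫ x, ((√(∑' l, R n l ^ 2))⁻¹ * ∑' l, R n l * g (A l x)) ^ 2 ∂μ) atTop
      (𝓝 (∫ t, φ t ∂ζ)) := by
  refine (hreg φ).congr fun n => ?_
  simp only [mul_pow, integral_const_mul]
  rw [integral_sq_tsum_eq hA hφ (hR.summable n), inv_pow, Real.sq_sqrt (tsum_nonneg fun l => sq_nonneg _),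
    ← integral_const_mul]
  congr 1; ext t
  rw [normalizedKernel]
  ring

/-- The `L²` bound for weighted sums of absolutely convergent character series. -/
theorem norm_toL2_weightedSum_le (hA : ∀ k l x, A (k + l) x = A k (A l x))
    (hmix : IsMixingOfAllOrders μ (fun l x => A l x)) {a : PontryaginDual G → ℂ} {h : C(G, ℂ)}
    (ha : HasSum (fun χ => a χ • charMap χ) h) (ha1 : a 1 = 0) {K : ℝ}
    (hK : HasSum (fun χ => ‖a χ‖) K) (F : Finset (Fin d → ℤ)) (w : (Fin d → ℤ) → ℂ) :
    ‖toL2 μ (weightedSum A h F w)‖ ≤ √(∑ l ∈ F, ‖w l‖ ^ 2) * K := by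
  classical
  have hcont : ∀ l, Continuous (actMap A l) := fun l =>
    AddMonoidHomClass.continuous_of_bound (actMap A l) 1 fun f => by
      rw [one_mul]; exact norm_actMap_le A l f
  have h1 : HasSum (fun χ => a χ • toL2 μ (weightedSum A (charMap χ) F w))
      (toL2 μ (weightedSum A h F w)) := by
    have h2 : HasSum (fun χ => weightedSum A (a χ • charMap χ) F w) (weightedSum A h F w) :=
      hasSum_sum fun l _ => (ha.map (actMap A l) (hcont l)).const_smul (w l)
    refine (h2.mapL (toL2 μ)).congr_fun fun χ => ?_
    rw [← map_smul]
    congr 1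
    rw [weightedSum, weightedSum, Finset.smul_sum]
    exact Finset.sum_congr rfl fun l _ => by rw [map_smul, smul_comm]
  have horth : Orthonormal ℂ fun χ : PontryaginDual G => toL2 μ (charMap χ) := by
    rw [orthonormal_iff_ite]
    intro χ ψ
    rw [ContinuousMap.inner_toLp]
    have h3 : ∀ x, charMap ψ x * (starRingEnd ℂ) (charMap χ x) =
        ((ψ * χ⁻¹ : PontryaginDual G) x : ℂ) := fun x => by
      rw [charMap_apply, charMap_apply, conj_char_apply]
      exact (Circle.coe_mul _ _).symm
    simp only [h3, integral_char, mul_inv_eq_one, eq_comm]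
  -- For nontrivial `χ` the orbit is orthonormal and Pythagoras gives equality; the trivial
  -- character has coefficient 0.
  have hbound : ∀ χ, ‖a χ • toL2 μ (weightedSum A (charMap χ) F w)‖ ≤
      √(∑ l ∈ F, ‖w l‖ ^ 2) * ‖a χ‖ := by
    intro χ
    by_cases hχ : χ = 1
    · simp [hχ, ha1]
    · have horth' := horth.comp _ (actChar_injective hA hmix hχ)
      rw [norm_smul, mul_comm]
      refine mul_le_mul_of_nonneg_right (le_of_eq ?_) (norm_nonneg _)
      rw [eq_comm, Real.sqrt_eq_iff_mul_self_eq (by positivity) (norm_nonneg _), ← sq]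
      have h4 := inner_self_eq_norm_sq_to_K (𝕜 := ℂ) (toL2 μ (weightedSum A (charMap χ) F w))
      have h5 := horth'.inner_sum w w F
      have h6 : toL2 μ (weightedSum A (charMap χ) F w) =
          ∑ l ∈ F, w l • toL2 μ (charMap (actChar A l χ)) := by
        rw [weightedSum, map_sum]
        exact Finset.sum_congr rfl fun l _ => by rw [map_smul, actMap_charMap]
      rw [h6] at h4 ⊢
      apply Complex.ofReal_injective
      refine (Eq.trans ?_ (h5.symm.trans h4)).trans (by simp)
      push_cast
      refine Finset.sum_congr rfl fun l _ => ?_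
      rw [mul_comm, Complex.mul_conj, Complex.normSq_eq_norm_sq]
      push_cast; rfl
  rw [← h1.tsum_eq, ← (hK.mul_left _).tsum_eq]
  exact (norm_tsum_le_tsum_norm (Summable.of_nonneg_of_le (fun _ => norm_nonneg _) hbound
    (hK.mul_left _).summable)).trans (Summable.tsum_le_tsum hbound
      (Summable.of_nonneg_of_le (fun _ => norm_nonneg _) hbound (hK.mul_left _).summable)
      (hK.mul_left _).summable)

end Density

/-! ### Approximation and the central limit theorem for trigonometric polynomials -/

section CentralLimit

variable {d : ℕ} {G : Type*} [CommGroup G] [TopologicalSpace G]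
    [IsTopologicalGroup G] [CompactSpace G] [MeasurableSpace G] [BorelSpace G]
    {μ : Measure G} [IsProbabilityMeasure μ]
    {A : (Fin d → ℤ) → (G ≃ₜ* G)}

theorem weightedSum_complexify (u : C(G, ℝ)) (F : Finset (Fin d → ℤ)) (w : (Fin d → ℤ) → ℝ) (x : G) :
    weightedSum A (complexify u) F (fun l => (w l : ℂ)) x =
      ((∑ l ∈ F, w l * u (A l x) : ℝ) : ℂ) := by
  simp [weightedSum, ContinuousMap.sum_apply]

theorem integral_norm_le_norm_toL2 (v : C(G, ℂ)) : ∫ x, ‖v x‖ ∂μ ≤ ‖toL2 μ v‖ := by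
  let v' : C(G, ℂ) := ⟨fun x => (‖v x‖ : ℂ), by fun_prop⟩
  have h1 := norm_inner_le_norm (𝕜 := ℂ) (toL2 μ 1) (toL2 μ v')
  rw [ContinuousMap.inner_toLp] at h1
  have h2 : ∫ x, v' x * (starRingEnd ℂ) ((1 : C(G, ℂ)) x) ∂μ = ((∫ x, ‖v x‖ ∂μ : ℝ) : ℂ) := by
    rw [← integral_complex_ofReal]; simp [v']
  have h3 : ‖toL2 μ v'‖ = ‖toL2 μ v‖ := by
    rw [← sq_eq_sq₀ (norm_nonneg _) (norm_nonneg _), norm_toL2_sq, norm_toL2_sq]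
    simp [v']
  have h4 : ‖toL2 μ (1 : C(G, ℂ))‖ ≤ 1 := (norm_toL2_le μ 1).trans
    ((ContinuousMap.norm_le _ zero_le_one).2 fun x => by simp)
  rw [h2, Complex.norm_real, Real.norm_eq_abs, h3] at h1
  exact (le_abs_self _).trans (h1.trans (mul_le_of_le_one_left (norm_nonneg _) h4))

theorem norm_integral_exp_sub_integral_exp_le {X Y : C(G, ℝ)} (t : ℝ) :
    ‖∫ x, Complex.exp (t * X x * Complex.I) ∂μ - ∫ x, Complex.exp (t * Y x * Complex.I) ∂μ‖ ≤
      |t| * ‖toL2 μ (complexify X - complexify Y)‖ := by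
  have hint : ∀ Z : C(G, ℝ), Integrable (fun x => Complex.exp (t * Z x * Complex.I)) μ := fun Z =>
    integrable_continuousMap μ (⟨fun x => Complex.exp (t * Z x * Complex.I), by fun_prop⟩ : C(G, ℂ))
  rw [← integral_sub (hint X) (hint Y)]
  refine le_trans ?_ (mul_le_mul_of_nonneg_left (integral_norm_le_norm_toL2 _) (abs_nonneg t))
  rw [← integral_const_mul]
  refine norm_integral_le_of_norm_le
    ((integrable_continuousMap μ (complexify X - complexify Y)).norm.const_mul _)
    (.of_forall fun x => ?_)
  have h1 : Complex.exp (t * X x * Complex.I) - Complex.exp (t * Y x * Complex.I) =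
      Complex.exp (t * Y x * Complex.I) * (Complex.exp ((t * (X x - Y x) : ℝ) * Complex.I) - 1) := by
    rw [mul_sub, ← Complex.exp_add, mul_one]
    congr 2
    push_cast
    ring
  rw [h1, norm_mul, ← Complex.ofReal_mul, Complex.norm_exp_ofReal_mul_I, one_mul]
  refine (Real.norm_exp_I_mul_ofReal_sub_one_le (x := t * (X x - Y x)) |> fun h => ?_)
  rw [mul_comm] at h
  refine h.trans (le_of_eq ?_)
  rw [norm_mul, Real.norm_eq_abs, ContinuousMap.sub_apply, complexify_apply, complexify_apply,
    ← Complex.ofReal_sub, Complex.norm_real]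

variable [T2Space G] [μ.IsHaarMeasure] [μ.Regular]

/-- Approximation of absolutely convergent character series by trigonometric polynomials, uniformly
in `L²` over normalized weighted sums. -/
theorem exists_trigPoly_approx (hA : ∀ k l x, A (k + l) x = A k (A l x))
    (hmix : IsMixingOfAllOrders μ (fun l x => A l x)) {g : C(G, ℝ)} (hg : MemAC0 μ g)
    (hsum : HasSum (fun χ : PontryaginDual G => charFourierCoeff μ g χ • charMap χ)
      (complexify g)) {ε : ℝ} (hε : 0 < ε) :
    ∃ u : C(G, ℝ), complexify u ∈ trigPoly G ∧ ∫ x, complexify u x ∂μ = 0 ∧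
      ∀ (F : Finset (Fin d → ℤ)) (w : (Fin d → ℤ) → ℝ), ∑ l ∈ F, w l ^ 2 ≤ 1 →
        ‖toL2 μ (weightedSum A (complexify g) F (fun l => (w l : ℂ)) -
          weightedSum A (complexify u) F (fun l => (w l : ℂ)))‖ ≤ ε := by
  classical
  set c := charFourierCoeff μ g with hc
  have hc1 : c 1 = 0 := by rw [hc, charFourierCoeff_one, hg.integral_eq_zero, Complex.ofReal_zero]
  have hK := hg.summable.hasSum
  set K := ∑' χ, ‖c χ‖
  obtain ⟨Λ, hΛ⟩ := (hK.eventually (lt_mem_nhds (show K - ε < K by linarith))).exists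
  set p : C(G, ℂ) := ∑ χ ∈ Λ, c χ • charMap χ with hp
  -- The partial sum `p` need not be real. As `g` and the weights are real, taking real parts can
  -- only decrease the error.
  let u : C(G, ℝ) := ⟨fun x => (p x).re, by fun_prop⟩
  have hpT : p ∈ trigPoly G :=
    Subalgebra.sum_mem _ fun χ _ => Subalgebra.smul_mem _ (charMap_mem_trigPoly χ) _
  have hpsT : star p ∈ trigPoly G := by
    rw [hp, star_sum]
    refine Subalgebra.sum_mem _ fun χ _ => ?_
    rw [star_smul, star_charMap]
    exact Subalgebra.smul_mem _ (charMap_mem_trigPoly _) _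
  have hu : complexify u = (2⁻¹ : ℂ) • (p + star p) := by
    ext x
    simp only [complexify_apply, ContinuousMap.smul_apply, ContinuousMap.add_apply,
      ContinuousMap.star_apply, RCLike.star_def, smul_eq_mul]
    rw [Complex.add_conj]
    simp [u]
  have hint0 : ∫ x, p x ∂μ = 0 := by
    have h1 : ∫ x, p x ∂μ = integralMulCLM μ 1 p := by simp [integralMulCLM_apply]
    rw [h1, hp, map_sum]
    refine Finset.sum_eq_zero fun χ _ => ?_
    rw [map_smul, integralMulCLM_apply]
    simp only [charMap_apply, ContinuousMap.one_apply, mul_one, integral_char]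
    split_ifs with h
    · rw [h, hc1, zero_smul]
    · rw [smul_zero]
  refine ⟨u, ?_, ?_, fun F w hw => ?_⟩
  · rw [hu]; exact Subalgebra.smul_mem _ (Subalgebra.add_mem _ hpT hpsT) _
  · have h1 : ∫ x, complexify u x ∂μ = ((∫ x, (p x).re ∂μ : ℝ) : ℂ) := by
      rw [← integral_complex_ofReal]; rfl
    have h2 := integral_re (integrable_continuousMap μ p)
    rw [h1]
    simp only [RCLike.re_to_complex] at h2
    rw [h2, hint0, Complex.zero_re, Complex.ofReal_zero]
  · let b : PontryaginDual G → ℂ := fun χ => if χ ∈ Λ then 0 else c χ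
    have hb1 : b 1 = 0 := by simp [b, hc1]
    have hbsum : HasSum (fun χ => b χ • charMap χ) (complexify g - p) := by
      have h1 : HasSum (fun χ => (if χ ∈ Λ then c χ else 0) • charMap χ) p := by
        have h2 : HasSum (fun χ => (if χ ∈ Λ then c χ else 0) • charMap χ)
            (∑ χ ∈ Λ, (if χ ∈ Λ then c χ else 0) • charMap χ) :=
          hasSum_sum_of_ne_finset_zero fun χ hχ => by simp [hχ]
        convert! h2 using 1
        exact Finset.sum_congr rfl fun χ hχ => by simp [hχ]
      refine (hsum.sub h1).congr_fun fun χ => ?_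
      rw [← sub_smul]
      congr 1
      simp only [b]
      split_ifs <;> simp [hc]
    have hbK : HasSum (fun χ => ‖b χ‖) (K - ∑ χ ∈ Λ, ‖c χ‖) := by
      have h1 : HasSum (fun χ => if χ ∈ Λ then ‖c χ‖ else 0) (∑ χ ∈ Λ, ‖c χ‖) := by
        have h2 : HasSum (fun χ => if χ ∈ Λ then ‖c χ‖ else 0)
            (∑ χ ∈ Λ, if χ ∈ Λ then ‖c χ‖ else 0) :=
          hasSum_sum_of_ne_finset_zero fun χ hχ => by simp [hχ]
        convert! h2 using 1
        exact Finset.sum_congr rfl fun χ hχ => by simp [hχ]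
      refine (hK.sub h1).congr_fun fun χ => ?_
      simp only [b]
      split_ifs <;> simp [hc]
    have h3 := norm_toL2_weightedSum_le hA hmix hbsum hb1 hbK F fun l => (w l : ℂ)
    have h4 : √(∑ l ∈ F, ‖(w l : ℂ)‖ ^ 2) ≤ 1 := by
      rw [Real.sqrt_le_one]
      simpa using hw
    have h5 : 0 ≤ K - ∑ χ ∈ Λ, ‖c χ‖ := hbK.nonneg fun _ => norm_nonneg _
    have h6 : ‖toL2 μ (weightedSum A (complexify g - p) F fun l => (w l : ℂ))‖ ≤ ε :=
      h3.trans ((mul_le_of_le_one_left h5 h4).trans (by linarith))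
    refine le_trans ?_ h6
    refine (sq_le_sq₀ (norm_nonneg _) (norm_nonneg _)).1 ?_
    rw [norm_toL2_sq, norm_toL2_sq]
    refine integral_mono (integrable_continuousMap μ (⟨fun x => ‖(weightedSum A (complexify g) F
      (fun l => (w l : ℂ)) - weightedSum A (complexify u) F (fun l => (w l : ℂ))) x‖ ^ 2,
      by fun_prop⟩ : C(G, ℝ))) (integrable_continuousMap μ (⟨fun x =>
      ‖weightedSum A (complexify g - p) F (fun l => (w l : ℂ)) x‖ ^ 2, by fun_prop⟩ : C(G, ℝ)))
      fun x => ?_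
    refine pow_le_pow_left₀ (norm_nonneg _) ?_ 2
    rw [ContinuousMap.sub_apply, weightedSum_complexify, weightedSum_complexify,
      ← Complex.ofReal_sub, ← Finset.sum_sub_distrib, Complex.norm_real, Real.norm_eq_abs]
    refine le_trans (le_of_eq ?_) (Complex.abs_re_le_norm _)
    congr 1
    rw [weightedSum, ContinuousMap.sum_apply, Complex.re_sum]
    refine Finset.sum_congr rfl fun l _ => ?_
    simp [u, mul_sub]

/-- The central limit theorem for weighted sums of a trigonometric polynomial, in terms of
characteristic functions. -/
theorem tendsto_integral_exp_sub_of_trigPoly (hA : ∀ k l x, A (k + l) x = A k (A l x))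
    (hmix : IsMixingOfAllOrders μ (fun l x => A l x)) {u : C(G, ℝ)}
    (hu : complexify u ∈ trigPoly G) (hu0 : ∫ x, complexify u x ∂μ = 0)
    (F : ℕ → Finset (Fin d → ℤ)) (w : ℕ → (Fin d → ℤ) → ℝ) (W : ℕ → ℝ)
    (hw0 : ∀ n l, 0 ≤ w n l) (hwW : ∀ n l, w n l ≤ W n)
    (hsmall : ∀ r, 2 ≤ r → Tendsto (fun n => W n ^ r * ∑ l ∈ F n, w n l) atTop (𝓝 0)) {B : ℝ}
    (hB : ∀ n, ∫ x, (∑ l ∈ F n, w n l * u (A l x)) ^ 2 ∂μ ≤ B) (t : ℝ) :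
    Tendsto (fun n => ∫ x, Complex.exp (t * (∑ l ∈ F n, w n l * u (A l x) : ℝ) * Complex.I) ∂μ -
      Complex.exp ((-((∫ x, (∑ l ∈ F n, w n l * u (A l x)) ^ 2 ∂μ) * t ^ 2 / 2) : ℝ) : ℂ))
      atTop (𝓝 0) := by
  let Y : ℕ → C(G, ℝ) := fun n => ⟨fun x => ∑ l ∈ F n, w n l * u (A l x), by
    refine continuous_finsetSum _ fun l _ => continuous_const.mul (u.continuous.comp (A l).continuous)⟩
  refine tendsto_integral_exp_sub_of_cumulants μ (Y := fun n x => ∑ l ∈ F n, w n l * u (A l x))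
    (k := fun n r => sumCumulant μ A (complexify u) (F n) (fun l => (w n l : ℂ)) r)
    (fun n => (Y n).continuous.aestronglyMeasurable)
    (fun n => ⟨‖Y n‖, fun x => (Y n).norm_coe_le_norm x⟩) hB (fun n => rfl) (fun n r => ?_)
    (fun n => sumCumulant_zero μ A _ _ _ hu0) (fun r hr => ?_) t
  · have h := integral_weightedSum_pow_succ μ A (complexify u) (F n) (fun l => (w n l : ℂ)) r
    simpa only [weightedSum_complexify] using h
  · obtain ⟨K, hK0, hK⟩ := exists_norm_sumCumulant_le (μ := μ) hA hmix hu r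
    refine squeeze_zero_norm (fun n => hK (F n) (fun l => (w n l : ℂ)) (W n) fun l => ?_) ?_
    · rw [Complex.norm_real, Real.norm_eq_abs, abs_of_nonneg (hw0 n l)]; exact hwW n l
    · have h1 : ∀ n l, ‖(w n l : ℂ)‖ = w n l := fun n l => by
        rw [Complex.norm_real, Real.norm_eq_abs, abs_of_nonneg (hw0 n l)]
      simp only [h1]
      simpa using (hsmall r hr).const_mul K

end CentralLimit

/-! ### From trigonometric polynomials to `AC_0` -/

section Limit

variable {d : ℕ} {G : Type*} [CommGroup G] [TopologicalSpace G]
    [IsTopologicalGroup G] [CompactSpace G] [T2Space G] [MeasurableSpace G] [BorelSpace G]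

theorem abs_exp_neg_sub_exp_neg_le {a b : ℝ} (ha : 0 ≤ a) (hb : 0 ≤ b) :
    |Real.exp (-a) - Real.exp (-b)| ≤ |a - b| := by
  have key : ∀ {a b : ℝ}, 0 ≤ a → a ≤ b → |Real.exp (-a) - Real.exp (-b)| ≤ |a - b| := by
    intro a b ha hab
    have h1 : Real.exp (-b) ≤ Real.exp (-a) := Real.exp_le_exp.2 (by linarith)
    have h2 : Real.exp (-b) = Real.exp (-a) * Real.exp (-(b - a)) := by
      rw [← Real.exp_add]; ring_nf
    have h3 := Real.add_one_le_exp (-(b - a))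
    have h4 : Real.exp (-a) ≤ 1 := Real.exp_le_one_iff.2 (by linarith)
    rw [abs_of_nonneg (sub_nonneg.2 h1), abs_of_nonpos (by linarith), h2]
    nlinarith [Real.exp_pos (-a)]
  rcases le_total a b with h | h
  · exact key ha h
  · rw [abs_sub_comm, abs_sub_comm a]
    exact key hb h

/-- The series converges uniformly, so infinite weighted sums are continuous and reduce to the
finite ones for which cumulants are defined. -/
theorem exists_continuousMap_tsum (A : (Fin d → ℤ) → (G ≃ₜ* G)) (g : C(G, ℝ))
    {w : (Fin d → ℤ) → ℝ} (hw : Summable w) :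
    ∃ Y : C(G, ℝ), (∀ x, Y x = ∑' l, w l * g (A l x)) ∧ ∀ δ : ℝ, 0 < δ →
      ∃ F : Finset (Fin d → ℤ),
        ‖complexify Y - weightedSum A (complexify g) F (fun l => (w l : ℂ))‖ < δ := by
  have hS := (hasSum_smul_of_summable hw (v := fun l => actMap A l (complexify g))
    fun l => norm_actMap_le A l _).hasSum
  set S := ∑' l, (w l : ℂ) • actMap A l (complexify g)
  have hSx : ∀ x, ((∑' l, w l * g (A l x) : ℝ) : ℂ) = S x := fun x => by
    rw [Complex.ofReal_tsum]
    simpa using (hS.mapL (ContinuousMap.evalCLM ℂ x)).tsum_eq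
  let Y : C(G, ℝ) := ⟨fun x => (S x).re, by fun_prop⟩
  have hY : ∀ x, Y x = ∑' l, w l * g (A l x) := fun x => by
    simp [Y, ← hSx]
  have hYS : complexify Y = S := by
    ext x
    rw [complexify_apply, hY, hSx]
  refine ⟨Y, hY, fun δ hδ => ?_⟩
  obtain ⟨F, hF⟩ := (Metric.tendsto_nhds.1 hS δ hδ).exists
  refine ⟨F, ?_⟩
  rw [hYS, ← dist_eq_norm, dist_comm]
  exact hF

variable {μ : Measure G} [IsProbabilityMeasure μ] {A : (Fin d → ℤ) → (G ≃ₜ* G)}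

theorem integral_sq_eq_norm_toL2_sq (Y : C(G, ℝ)) :
    ∫ x, Y x ^ 2 ∂μ = ‖toL2 μ (complexify Y)‖ ^ 2 := by
  rw [norm_toL2_sq]
  simp

variable [μ.IsHaarMeasure] [μ.Regular]

/-- Convergence of characteristic functions of normalized weighted sums to that of a Gaussian. -/
theorem tendsto_integral_exp_of_memAC0 (hA : ∀ k l x, A (k + l) x = A k (A l x))
    (hmix : IsMixingOfAllOrders μ (fun l x => A l x)) {g : C(G, ℝ)} (hg : MemAC0 μ g)
    (hsum : HasSum (fun χ : PontryaginDual G => charFourierCoeff μ g χ • charMap χ)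
      (complexify g))
    {w : ℕ → (Fin d → ℤ) → ℝ} {W : ℕ → ℝ} (hws : ∀ n, Summable (w n))
    (hw0 : ∀ n l, 0 ≤ w n l) (hwW : ∀ n l, w n l ≤ W n)
    (hw2 : ∀ n (F : Finset (Fin d → ℤ)), ∑ l ∈ F, w n l ^ 2 ≤ 1)
    (hsmall : ∀ r, 2 ≤ r → Tendsto (fun n => W n ^ r * ∑' l, w n l) atTop (𝓝 0)) {s : ℝ}
    (hs : Tendsto (fun n => ∫ x, (∑' l, w n l * g (A l x)) ^ 2 ∂μ) atTop (𝓝 s)) (t : ℝ) :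
    Tendsto (fun n => ∫ x, Complex.exp (t * (∑' l, w n l * g (A l x) : ℝ) * Complex.I) ∂μ)
      atTop (𝓝 (Complex.exp ((-(s * t ^ 2 / 2) : ℝ) : ℂ))) := by
  choose Y hY hYF using fun n => exists_continuousMap_tsum A g (hws n)
  choose F hF using fun n : ℕ => hYF n (1 / ((n : ℝ) + 1)) (by positivity)
  simp only [← hY] at hs ⊢
  set K := ∑' χ, ‖charFourierCoeff μ g χ‖
  have hK0 : 0 ≤ K := tsum_nonneg fun _ => norm_nonneg _
  -- The total loss in units of `ε`: `2 * |t|` for replacing `Y n` by `Z n`, `2 * t ^ 2 * (K + 1)`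
  -- for the resulting change of variance, and 1 each for the limit theorem for `Z n` and the
  -- convergence of the variance of `Y n`.
  set C := 2 * |t| + 2 * t ^ 2 * (K + 1) + 2 with hC
  have hC0 : 0 < C := by positivity
  have hW0 : ∀ n, 0 ≤ W n := fun n => (hw0 n 0).trans (hwW n 0)
  have hnorm : ∀ n, ‖toL2 μ (weightedSum A (complexify g) (F n) (fun l => (w n l : ℂ)))‖ ≤ K := by
    intro n
    refine (norm_toL2_weightedSum_le hA hmix hsum ?_ hg.summable.hasSum (F n) _).trans
      (mul_le_of_le_one_left hK0 ?_)
    · rw [charFourierCoeff_one, hg.integral_eq_zero, Complex.ofReal_zero]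
    · rw [Real.sqrt_le_one]
      simpa using hw2 n (F n)
  rw [Metric.tendsto_nhds]
  intro η hη
  set ε := min 1 (η / C)
  have hε : 0 < ε := lt_min one_pos (by positivity)
  have hε1 : ε ≤ 1 := min_le_left _ _
  have hεη : C * ε ≤ η := by
    rw [← le_div_iff₀' hC0]; exact min_le_right _ _
  obtain ⟨u, huT, hu0, hu⟩ := exists_trigPoly_approx hA hmix hg hsum hε
  let Z : ℕ → C(G, ℝ) := fun n => ⟨fun x => ∑ l ∈ F n, w n l * u (A l x),
    continuous_finsetSum _ fun l _ => continuous_const.mul (u.continuous.comp (A l).continuous)⟩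
  have hZ : ∀ n, complexify (Z n) = weightedSum A (complexify u) (F n) (fun l => (w n l : ℂ)) :=
    fun n => by
      ext x
      rw [weightedSum_complexify]
      rfl
  have hδ : ∀ n : ℕ, ‖toL2 μ (complexify (Y n)) -
      toL2 μ (weightedSum A (complexify g) (F n) (fun l => (w n l : ℂ)))‖ ≤ 1 / ((n : ℝ) + 1) :=
    fun n => by
      rw [← map_sub]
      exact (norm_toL2_le μ _).trans (hF n).le
  have hε2 : ∀ n, ‖toL2 μ (weightedSum A (complexify g) (F n) (fun l => (w n l : ℂ))) -
      toL2 μ (complexify (Z n))‖ ≤ ε := fun n => by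
    rw [← map_sub, hZ]
    exact hu (F n) (w n) (hw2 n (F n))
  have hZK : ∀ n, ‖toL2 μ (complexify (Z n))‖ ≤ K + 1 := fun n => by
    linarith [norm_sub_norm_le (toL2 μ (complexify (Z n)))
      (toL2 μ (weightedSum A (complexify g) (F n) (fun l => (w n l : ℂ)))), hε2 n, hnorm n,
      norm_sub_rev (toL2 μ (weightedSum A (complexify g) (F n) (fun l => (w n l : ℂ))))
        (toL2 μ (complexify (Z n)))]
  have hYK : ∀ n : ℕ, ‖toL2 μ (complexify (Y n))‖ ≤ K + 1 := fun n => by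
    have h1 : 1 / ((n : ℝ) + 1) ≤ 1 := by
      rw [div_le_one (by positivity)]
      linarith [(Nat.cast_nonneg n : (0 : ℝ) ≤ n)]
    linarith [norm_sub_norm_le (toL2 μ (complexify (Y n)))
      (toL2 μ (weightedSum A (complexify g) (F n) (fun l => (w n l : ℂ)))), hδ n, hnorm n]
  have hclt := tendsto_integral_exp_sub_of_trigPoly hA hmix huT hu0 F w W hw0 hwW
    (fun r hr => squeeze_zero
      (fun n => mul_nonneg (pow_nonneg (hW0 n) _) (Finset.sum_nonneg fun l _ => hw0 n l))
      (fun n => mul_le_mul_of_nonneg_left ((hws n).sum_le_tsum _ fun l _ => hw0 n l)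
        (pow_nonneg (hW0 n) _)) (hsmall r hr)) (B := (K + 1) ^ 2)
    (fun n => by
      have h := integral_sq_eq_norm_toL2_sq (μ := μ) (Z n)
      refine le_of_eq_of_le h (pow_le_pow_left₀ (norm_nonneg _) (hZK n) 2)) t
  have hexp : Tendsto (fun n => Complex.exp ((-((∫ x, Y n x ^ 2 ∂μ) * t ^ 2 / 2) : ℝ) : ℂ)) atTop
      (𝓝 (Complex.exp ((-(s * t ^ 2 / 2) : ℝ) : ℂ))) := by
    refine (Complex.continuous_exp.tendsto _).comp ((Complex.continuous_ofReal.tendsto _).comp ?_)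
    exact ((hs.mul_const _).div_const _).neg
  filter_upwards [Metric.tendsto_nhds.1 hclt ε hε, Metric.tendsto_nhds.1 hexp ε hε,
    Metric.tendsto_nhds.1 (tendsto_one_div_add_atTop_nhds_zero_nat (𝕜 := ℝ)) ε hε] with n h1 h2 h3
  have hn : 1 / ((n : ℝ) + 1) ≤ ε := by
    rw [Real.dist_eq, sub_zero] at h3
    exact (le_abs_self _).trans h3.le
  have hYZ : ‖toL2 μ (complexify (Y n)) - toL2 μ (complexify (Z n))‖ ≤ 2 * ε := by
    refine (norm_sub_le_norm_sub_add_norm_sub _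
      (toL2 μ (weightedSum A (complexify g) (F n) (fun l => (w n l : ℂ)))) _).trans ?_
    linarith [hδ n, hε2 n]
  have hsq : |(∫ x, Z n x ^ 2 ∂μ) - ∫ x, Y n x ^ 2 ∂μ| ≤ 2 * ε * (2 * (K + 1)) := by
    rw [integral_sq_eq_norm_toL2_sq, integral_sq_eq_norm_toL2_sq, sq_sub_sq, abs_mul, mul_comm,
      abs_sub_comm ‖toL2 μ (complexify (Z n))‖,
      abs_of_nonneg (add_nonneg (norm_nonneg _) (norm_nonneg _))]
    refine mul_le_mul ((abs_norm_sub_norm_le _ _).trans hYZ) ?_ (by positivity) (by positivity)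
    linarith [hZK n, hYK n]
  have h4 : ‖Complex.exp ((-((∫ x, Z n x ^ 2 ∂μ) * t ^ 2 / 2) : ℝ) : ℂ) -
      Complex.exp ((-((∫ x, Y n x ^ 2 ∂μ) * t ^ 2 / 2) : ℝ) : ℂ)‖ ≤ t ^ 2 / 2 *
        (2 * ε * (2 * (K + 1))) := by
    rw [← Complex.ofReal_exp, ← Complex.ofReal_exp, ← Complex.ofReal_sub, Complex.norm_real,
      Real.norm_eq_abs]
    have hpos : ∀ V : C(G, ℝ), 0 ≤ (∫ x, V x ^ 2 ∂μ) * t ^ 2 / 2 := fun V => by positivity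
    refine (abs_exp_neg_sub_exp_neg_le (hpos _) (hpos _)).trans ?_
    rw [mul_div_assoc, mul_div_assoc, ← sub_mul, abs_mul, abs_of_nonneg (a := t ^ 2 / 2)
      (by positivity), mul_comm]
    exact mul_le_mul_of_nonneg_left hsq (by positivity)
  have h5 : ‖∫ x, Complex.exp (t * Y n x * Complex.I) ∂μ -
      ∫ x, Complex.exp (t * Z n x * Complex.I) ∂μ‖ ≤ |t| * (2 * ε) := by
    refine (norm_integral_exp_sub_integral_exp_le t).trans
      (mul_le_mul_of_nonneg_left ?_ (abs_nonneg t))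
    rwa [map_sub]
  rw [dist_eq_norm, sub_zero] at h1
  rw [dist_eq_norm] at h2 ⊢
  have h6 : ‖∫ x, Complex.exp (t * Z n x * Complex.I) ∂μ -
      Complex.exp ((-((∫ x, Z n x ^ 2 ∂μ) * t ^ 2 / 2) : ℝ) : ℂ)‖ < ε := h1
  calc _ = ‖(∫ x, Complex.exp (t * Y n x * Complex.I) ∂μ -
          ∫ x, Complex.exp (t * Z n x * Complex.I) ∂μ) +
        (∫ x, Complex.exp (t * Z n x * Complex.I) ∂μ -
          Complex.exp ((-((∫ x, Z n x ^ 2 ∂μ) * t ^ 2 / 2) : ℝ) : ℂ)) +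
        (Complex.exp ((-((∫ x, Z n x ^ 2 ∂μ) * t ^ 2 / 2) : ℝ) : ℂ) -
          Complex.exp ((-((∫ x, Y n x ^ 2 ∂μ) * t ^ 2 / 2) : ℝ) : ℂ)) +
        (Complex.exp ((-((∫ x, Y n x ^ 2 ∂μ) * t ^ 2 / 2) : ℝ) : ℂ) -
          Complex.exp ((-(s * t ^ 2 / 2) : ℝ) : ℂ))‖ := by congr 1; ring
    _ ≤ _ := norm_add₄_le
    _ < |t| * (2 * ε) + ε + t ^ 2 / 2 * (2 * ε * (2 * (K + 1))) + ε := by linarith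
    _ = C * ε := by rw [hC]; ring
    _ ≤ η := hεη

end Limit

/-- Lévy's continuity theorem; for `s = 0` the limit law is the point mass at 0. -/
theorem tendstoInDistribution_gaussianReal_of_tendsto_charFun {Ω : Type*} [MeasurableSpace Ω]
    {μ : Measure Ω} [IsProbabilityMeasure μ] {Y : ℕ → Ω → ℝ} (hY : ∀ n, AEMeasurable (Y n) μ)
    {s : ℝ} (hs : 0 ≤ s)
    (h : ∀ t : ℝ, Tendsto (fun n => ∫ x, Complex.exp (t * Y n x * Complex.I) ∂μ)
      atTop (𝓝 (Complex.exp ((-(s * t ^ 2 / 2) : ℝ) : ℂ)))) :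
    TendstoInDistribution Y atTop (id : ℝ → ℝ) (fun _ => μ) (gaussianReal 0 s.toNNReal) := by
  refine ⟨hY, aemeasurable_id, ProbabilityMeasure.tendsto_iff_tendsto_charFun.2 fun t => ?_⟩
  simp only [ProbabilityMeasure.coe_mk, Measure.map_id]
  rw [charFun_gaussianReal]
  have h1 : Complex.exp (t * (0 : ℝ) * Complex.I - (s.toNNReal : ℝ) * t ^ 2 / 2) =
      Complex.exp ((-(s * t ^ 2 / 2) : ℝ) : ℂ) := by
    rw [Real.coe_toNNReal s hs]
    congr 1
    push_cast
    ring
  have h2 := h t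
  rw [← h1] at h2
  refine h2.congr fun n => ?_
  rw [charFun_apply_real, integral_map (hY n) (by fun_prop)]

/-! ### Normalized weights -/

namespace IsSummationSequence

variable {d : ℕ} {R : ℕ → (Fin d → ℤ) → ℝ}

/-- Summability bounds the weights above, so the real `⨆` is a true supremum and not its default
value 0. -/
theorem le_iSup (hR : IsSummationSequence R) (n : ℕ) (l : Fin d → ℤ) : R n l ≤ ⨆ l, R n l :=
  le_ciSup (f := R n) ⟨∑' l, R n l, by
    rintro _ ⟨l, rfl⟩
    exact (hR.summable n).le_tsum l fun k _ => hR.nonneg n k⟩ l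

theorem summable_sq (hR : IsSummationSequence R) (n : ℕ) : Summable fun l => R n l ^ 2 :=
  Summable.of_nonneg_of_le (fun l => sq_nonneg _)
    (fun l => by
      rw [sq]
      exact mul_le_mul_of_nonneg_right (hR.le_iSup n l) (hR.nonneg n l))
    ((hR.summable n).mul_left (⨆ l, R n l))

theorem sum_normalized_sq_le_one (hR : IsSummationSequence R) (n : ℕ)
    (F : Finset (Fin d → ℤ)) : ∑ l ∈ F, ((√(∑' l, R n l ^ 2))⁻¹ * R n l) ^ 2 ≤ 1 := by
  simp only [mul_pow]
  have h0 : 0 ≤ ∑' l, R n l ^ 2 := tsum_nonneg fun l => sq_nonneg _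
  rw [← Finset.mul_sum, inv_pow, Real.sq_sqrt h0]
  exact inv_mul_le_one_of_le₀ ((hR.summable_sq n).sum_le_tsum _ fun l _ => sq_nonneg _) h0

/-- The smallness assumption at `r + 1`, with one normalizing factor absorbed by each of the `r`
suprema and one by the sum. -/
theorem tendsto_normalized_iSup_pow_mul_tsum
    (hsmall : ∀ r : ℕ, 3 ≤ r →
      (fun n => (⨆ l, R n l) ^ (r - 1) * ∑' l, R n l) =o[atTop]
        (fun n => (∑' l, R n l ^ 2) ^ ((r : ℝ) / 2))) {r : ℕ} (hr : 2 ≤ r) :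
    Tendsto (fun n => ((√(∑' l, R n l ^ 2))⁻¹ * ⨆ l, R n l) ^ r *
      ∑' l, (√(∑' l, R n l ^ 2))⁻¹ * R n l) atTop (𝓝 0) := by
  refine (hsmall (r + 1) (by lia)).tendsto_div_nhds_zero.congr fun n => ?_
  have h0 : 0 ≤ ∑' l, R n l ^ 2 := tsum_nonneg fun l => sq_nonneg _
  have h1 : (∑' l, R n l ^ 2) ^ (((r + 1 : ℕ) : ℝ) / 2) = √(∑' l, R n l ^ 2) ^ (r + 1) := by
    rw [Real.sqrt_eq_rpow, ← Real.rpow_natCast, ← Real.rpow_mul h0]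
    congr 1
    ring
  rw [h1, tsum_mul_left, Nat.add_sub_cancel, mul_pow, div_eq_mul_inv, ← inv_pow, pow_succ]
  ring

end IsSummationSequence

/-! ### The main theorem -/

theorem mainTheorem2 {d : ℕ} {G : Type*} [CommGroup G] [TopologicalSpace G]
    [IsTopologicalGroup G] [CompactSpace G] [T2Space G] [MeasurableSpace G] [BorelSpace G]
    (μ : Measure G) [μ.IsHaarMeasure] [IsProbabilityMeasure μ] [μ.Regular]
    (A : (Fin d → ℤ) → (G ≃ₜ* G))
    (hA : ∀ k l x, A (k + l) x = A k (A l x))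
    (hmix : IsMixingOfAllOrders μ (fun l x => A l x))
    (R : ℕ → (Fin d → ℤ) → ℝ) (hR : IsSummationSequence R)
    (ζ : Measure (UnitAddTorus (Fin d))) [IsProbabilityMeasure ζ]
    (hreg : IsRegularSummation R ζ)
    (hsmall : ∀ r : ℕ, 3 ≤ r →
      (fun n => (⨆ l, R n l) ^ (r - 1) * ∑' l, R n l) =o[atTop]
        (fun n => (∑' l, R n l ^ 2) ^ ((r : ℝ) / 2)))
    (f : G → ℝ) (hf : MemAC0 μ f) :
    (∃ φ : C(UnitAddTorus (Fin d), ℝ), IsSpectralDensity μ (fun l x => A l x) f φ) ∧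
    ∀ φ : C(UnitAddTorus (Fin d), ℝ), IsSpectralDensity μ (fun l x => A l x) f φ →
      TendstoInDistribution
        (fun n x => (√(∑' l, R n l ^ 2))⁻¹ * ∑' l, R n l * f (A l x))
        atTop (id : ℝ → ℝ) (fun _ => μ)
        (gaussianReal 0 (∫ t, φ t ∂ζ).toNNReal) := by
  obtain ⟨g, hfg, hg, hsum⟩ := hf.exists_continuous_version
  -- One null set serves all `l` because `ℤ^d` is countable, so the weighted sums of `f` and of its
  -- continuous version agree almost everywhere.
  have hae : ∀ᵐ x ∂μ, ∀ l, f (A l x) = g (A l x) := ae_all_iff.2 fun l =>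
    (measurePreserving_continuousMulEquiv μ (A l)).quasiMeasurePreserving.ae hfg
  have hcorr : ∀ l, ∫ x, f (A l x) * f x ∂μ = ∫ x, g (A l x) * g x ∂μ := fun l =>
    integral_congr_ae (by filter_upwards [hae, hfg] with x h1 h2; rw [h1, h2])
  refine ⟨?_, fun φ hφ => ?_⟩
  · obtain ⟨φ, hφ⟩ := exists_continuous_density hA (summable_correlation hA hmix hg hsum)
    exact ⟨φ, hφ.integrable, hφ.nonneg, fun l => by rw [hφ.fourier, hcorr]⟩
  · have hvar := tendsto_normalized_variance (μ := μ) (g := g) hA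
      (fun l => (hφ.fourier l).trans (by rw [hcorr])) hR hreg
    have hnorm : ∀ n x, (√(∑' l, R n l ^ 2))⁻¹ * ∑' l, R n l * g (A l x) =
        ∑' l, (√(∑' l, R n l ^ 2))⁻¹ * R n l * g (A l x) := fun n x => by
      simp only [mul_assoc, tsum_mul_left]
    have hws : ∀ n, Summable fun l => (√(∑' l, R n l ^ 2))⁻¹ * R n l := fun n =>
      (hR.summable n).mul_left _
    have hg_lim : TendstoInDistribution
        (fun n x => (√(∑' l, R n l ^ 2))⁻¹ * ∑' l, R n l * g (A l x))
        atTop (id : ℝ → ℝ) (fun _ => μ) (gaussianReal 0 (∫ t, φ t ∂ζ).toNNReal) := by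
      refine tendstoInDistribution_gaussianReal_of_tendsto_charFun (fun n => ?_)
        (ge_of_tendsto' hvar fun n => integral_nonneg fun x => sq_nonneg _) fun t => ?_
      · obtain ⟨Y, hY, -⟩ := exists_continuousMap_tsum A g (hws n)
        simp only [hnorm, ← hY]
        exact Y.continuous.aemeasurable
      · simp only [hnorm] at hvar ⊢
        exact tendsto_integral_exp_of_memAC0 hA hmix hg hsum hws
          (W := fun n => (√(∑' l, R n l ^ 2))⁻¹ * ⨆ l, R n l)
          (fun n l => mul_nonneg (by positivity) (hR.nonneg n l))
          (fun n l => mul_le_mul_of_nonneg_left (hR.le_iSup n l) (by positivity))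
          hR.sum_normalized_sq_le_one
          (fun r hr => IsSummationSequence.tendsto_normalized_iSup_pow_mul_tsum hsmall hr) hvar t
    refine hg_lim.congr (fun n => ?_) .rfl
    filter_upwards [hae] with x hx
    simp only [hx]
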